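/- Let $k\in\mathbb N$, $\lambda>0$, and let $\nu$ be a probability measure on the ranked simplex $\{s_1\ge\dots\ge s_k\ge 0,\ \sum_i s_i=1\}$. Let $\mathcal P^{(k)}$ (resp. $\mathcal P^{(k)}_{[n]}$) be the set of partitions of $\mathbb N$ (resp. $[n]=\{1,\dots,n\}$) into at most $k$ blocks, $\mathcal P^{(k)}$ carrying the $\sigma$-algebra generated by the restrictions $B\mapsto B_{|[n]}$. Let $\#B$ denote the number of blocks of $B$. Let $\varrho_\nu$ be the law on $\mathcal P^{(k)}$ of the partition into level sets of a sequence $X_1,X_2,\dots$ which, given $s\sim\nu$, is i.i.d. with $\mathbb P(X_i=j)=s_j$, $1\le j\le k$, and for a finite set $b\subset\mathbb N$ and a partition $C$ of $b$ let $\varrho_\nu(C)$ be the probability that a $\varrho_\nu$-distributed partition has restriction $C$ to $b$. For $B,B'\in\mathcal P^{(k)}_{[n]}$ put $$p_n(B,B')=\frac{k!}{(k-\#B')!}\prod_{b\in B}\frac{(k-\#B'_{|b})!}{k!}\,\varrho_\nu(B'_{|b}),\qquad Q_n^\nu(B,B')=\lambda\,\bigl(p_n(B,B')-\mathbf 1_{\{B=B'\}}\bigr).$$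 Let $P$ be a Poisson point process on $\mathbb R^+\times\prod_{i=1}^k\mathcal P^{(k)}$ with intensity $dt\otimes\lambda\varrho_\nu^{(k)}$, where $\varrho_\nu^{(k)}=\varrho_\nu\otimes\dots\otimes\varrho_\nu$; let $\pi$ be a random element of $\mathcal P^{(k)}$; and attach to the successive atoms of $P$ i.i.d. families $(\sigma_1,\dots,\sigma_k)$ of independent uniform permutations of $[k]$; suppose that $\pi$, $P$ and the permutations are independent. List the blocks of a partition in the order of their least elements, followed by empty sets so as to get $k$ sets. Construct a process $B=(B(t),t\ge0)$ on $\mathcal P^{(k)}$ such that almost surely, for every $n$, the path $t\mapsto B_{|[n]}(t)$ is right-continuous with left limits (in the discrete space $\mathcal P^{(k)}_{[n]}$), starts from $\pi_{|[n]}$, and satisfies for each $t>0$: - if $t$ is not an atom time of $P$, then $B_{|[n]}(t)=B_{|[n]}(t-)$; - if $(t,C_1,\dots,C_k)\in P$, with attached permutations $\sigma_1,\dots,\sigma_k$, and $(B_1,\dots,B_k)$ and $(C_{i1},\dots,C_{ik})$ are the lists of blocks of $B_{|[n]}(t-)$ and of $C_i$, then the blocks of $B_{|[n]}(t)$ are the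 non-empty sets among the column totals $\bigcup_{i=1}^k (C_{i,\sigma_i(j)}\cap B_i)$, $1\le j\le k$. Then such a process $B$ exists, there is a kernel $Q^\nu$ of finite signed measures on $\mathcal P^{(k)}$ such that $$Q^\nu\bigl(B_*,\{B'':B''_{|[n]}=B'\}\bigr)=Q^\nu_n\bigl(B_{*|[n]},B'\bigr)\quad\text{for all } n,\ B_*\in\mathcal P^{(k)},\ B'\in\mathcal P_{[n]}^{(k)},$$ and every such $B$ is a time-homogeneous Markov process on $\mathcal P^{(k)}$ (with respect to its natural filtration) with rates $Q^\nu$, that is, its transition function can be chosen as a semigroup $(\kappa_t)_{t\ge0}$ of Markov kernels with $\lim_{t\downarrow0}\bigl(\kappa_t(x,A)-\mathbf 1_A(x)\bigr)/t=Q^\nu(x,A)$ for all $x\in\mathcal P^{(k)}$ and all measurable $A\subset\mathcal P^{(k)}$. Moreover, for each $n$, $B_{|[n]}$ is in the same sense a Markov process on $\mathcal P^{(k)}_{[n]}$ with $Q$-matrix $Q_n^\nu$. -/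

import Mathlib

open MeasureTheory ProbabilityTheory Filter Topology
open scoped NNReal ENNReal

/-! ### Partitions with at most `k` blocks -/

/-- A partition of `α` into at most `k` (non-empty) blocks, given by its equivalence relation.
`KPartition k ℕ` is the space of partitions of the natural numbers with at most `k` blocks and
`KPartition k (Fin n)` the space of partitions of an `n`-element initial segment (the natural
numbers are numbered from `0` here). -/
@[ext] structure KPartition (k : ℕ) (α : Type*) where
  rel : Setoid α
  card_le : rel.classes.encard ≤ k

namespace KPartition

variable {k : ℕ} {α β : Type*}

theorem card_ker_le (f : α → Fin k) : (Setoid.ker f).classes.encard ≤ k := by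
  refine (Set.encard_le_encard (Setoid.classes_ker_subset_fiber_set f)).trans ?_
  rw [← Set.image_univ]
  refine (Set.encard_image_le _ _).trans ?_
  simp

theorem exists_ker_eq (s : Setoid α) (h : s.classes.encard ≤ k) :
    ∃ f : α → Fin k, Setoid.ker f = s := by
  have hfin : s.classes.Finite := Set.finite_of_encard_le_coe h
  have hcard : s.classes.ncard ≤ k := by
    rw [← hfin.cast_ncard_eq] at h
    exact_mod_cast h
  have := hfin.to_subtype
  let e : s.classes ≃ Fin s.classes.ncard := Finite.equivFin s.classes
  refine ⟨fun x => Fin.castLE hcard (e ⟨{y | s y x}, s.mem_classes x⟩), ?_⟩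
  ext x y
  rw [Setoid.ker_def]
  constructor
  · intro hxy
    have h1 := e.injective (Fin.castLE_injective hcard hxy)
    have h2 : {z | s z x} = {z | s z y} := congrArg Subtype.val h1
    have : x ∈ {z | s z y} := h2 ▸ s.refl' x
    exact this
  · intro hxy
    have : {z | s z x} = {z | s z y} := by
      ext z
      exact ⟨fun hz => s.trans' hz hxy, fun hz => s.trans' hz (s.symm' hxy)⟩
    simp only [this]

/-- The partition into the colour classes of a colouring with `k` colours. -/
def ofColouring (f : α → Fin k) : KPartition k α := ⟨Setoid.ker f, card_ker_le f⟩

/-- The pull-back of a partition along a map (the restriction, when the map is an inclusion). -/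
def comap (g : β → α) (B : KPartition k α) : KPartition k β :=
  ⟨B.rel.comap g, by
    obtain ⟨f, hf⟩ := exists_ker_eq B.rel B.card_le
    have : B.rel.comap g = Setoid.ker (f ∘ g) := by rw [← hf]; rfl
    rw [this]
    exact card_ker_le _⟩

/-- The restriction of a partition of the natural numbers to its first `n` elements. -/
def restrict (n : ℕ) (B : KPartition k ℕ) : KPartition k (Fin n) := B.comap Fin.val

/-- The number of blocks. -/
noncomputable def numBlocks (B : KPartition k α) : ℕ := B.rel.classes.ncard

/-- The `σ`-algebra on partitions of the natural numbers generated by the finite restrictions. -/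
instance : MeasurableSpace (KPartition k ℕ) :=
  ⨆ n, MeasurableSpace.comap (restrict n) ⊤

instance (n : ℕ) : MeasurableSpace (KPartition k (Fin n)) := ⊤

/-- The number of blocks whose least element is smaller than the least element of the block
of `x`; each such block is represented by its least element `y`. This is the position (counted
from `0`) of the block of `x` when blocks are listed in the order of their least elements. -/
noncomputable def rank [LinearOrder α] (s : Setoid α) (x : α) : ℕ :=
  {y | (∀ z, s z y → y ≤ z) ∧ ∀ z, s z x → y < z}.ncard

theorem rank_lt [LinearOrder α] [WellFoundedLT α] (B : KPartition k α) (x : α) :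
    rank B.rel x < k := by
  obtain ⟨f, hf⟩ := exists_ker_eq B.rel B.card_le
  have hr : ∀ a b, B.rel a b ↔ f a = f b := fun a b => by rw [← hf, Setoid.ker_def]
  obtain ⟨m, hmx, hm⟩ : ∃ m, B.rel m x ∧ ∀ z, B.rel z x → m ≤ z := by
    have hne : {z | B.rel z x}.Nonempty := ⟨x, B.rel.refl' x⟩
    exact ⟨wellFounded_lt.min _ hne, wellFounded_lt.min_mem _ hne,
      fun z hz => wellFounded_lt.min_le (s := {z | B.rel z x}) hz⟩
  set S : Set α := {y | (∀ z, B.rel z y → y ≤ z) ∧ ∀ z, B.rel z x → y < z} with hS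
  have hmS : m ∉ S := fun h => lt_irrefl m (h.2 m hmx)
  have hleast : ∀ a ∈ insert m S, ∀ z, B.rel z a → a ≤ z := by
    rintro a (rfl | ha)
    · exact fun z hz => hm z (B.rel.trans' hz hmx)
    · exact ha.1
  have hinj : Set.InjOn f (insert m S) := by
    intro a ha b hb hab
    exact le_antisymm (hleast a ha b ((hr b a).2 hab.symm)) (hleast b hb a ((hr a b).2 hab))
  have hfin : (insert m S).Finite :=
    Set.Finite.of_finite_image (Set.toFinite _) hinj
  have h1 : (insert m S).ncard ≤ k := by
    rw [← hinj.ncard_image]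
    simpa using Set.ncard_le_card (f '' insert m S)
  rw [Set.ncard_insert_of_notMem hmS (hfin.subset (Set.subset_insert _ _))] at h1
  exact h1

/-- The index in `Fin k` of the block of `x`, for the blocks listed in the order of their least
elements. -/
noncomputable def blockIndex [LinearOrder α] [WellFoundedLT α] (B : KPartition k α) (x : α) :
    Fin k := ⟨rank B.rel x, B.rank_lt x⟩

/-- The list `(B_1, …, B_k)` of the blocks of `B` in the order of their least elements, followed
by `k - #B` empty sets. -/
def block [LinearOrder α] [WellFoundedLT α] (B : KPartition k α) (i : Fin k) : Set α :=
  {x | B.blockIndex x = i}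

/-! ### The matrix construction -/

variable {n : ℕ}

/-- The `(i, j)` entry `C_{i, σ_i(j)} ∩ B_i` of the matrix `B ∩ C^σ`. -/
def matrixEntry (B : KPartition k (Fin n)) (C : Fin k → KPartition k ℕ)
    (σ : Fin k → Equiv.Perm (Fin k)) (i j : Fin k) : Set (Fin n) :=
  {x | (x : ℕ) ∈ (C i).block (σ i j) ∧ x ∈ B.block i}

/-- The `j`-th column total of the matrix `B ∩ C^σ`. -/
def column (B : KPartition k (Fin n)) (C : Fin k → KPartition k ℕ)
    (σ : Fin k → Equiv.Perm (Fin k)) (j : Fin k) : Set (Fin n) :=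
  ⋃ i, matrixEntry B C σ i j

/-- The index of the column of the matrix `B ∩ C^σ` which contains `x`. -/
noncomputable def columnIndex (B : KPartition k (Fin n)) (C : Fin k → KPartition k ℕ)
    (σ : Fin k → Equiv.Perm (Fin k)) (x : Fin n) : Fin k :=
  (σ (B.blockIndex x)).symm ((C (B.blockIndex x)).blockIndex (x : ℕ))

theorem mem_column (B : KPartition k (Fin n)) (C : Fin k → KPartition k ℕ)
    (σ : Fin k → Equiv.Perm (Fin k)) (j : Fin k) (x : Fin n) :
    x ∈ column B C σ j ↔ columnIndex B C σ x = j := by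
  simp only [column, matrixEntry, block, columnIndex, Set.mem_iUnion, Set.mem_ofPred_eq]
  rw [Equiv.symm_apply_eq]
  constructor
  · rintro ⟨i, h1, rfl⟩
    exact h1
  · intro h
    exact ⟨_, h, rfl⟩

/-- The partition `B'` whose blocks are the non-empty column totals of the matrix `B ∩ C^σ`. -/
noncomputable def update (B : KPartition k (Fin n)) (C : Fin k → KPartition k ℕ)
    (σ : Fin k → Equiv.Perm (Fin k)) : KPartition k (Fin n) :=
  ofColouring (columnIndex B C σ)

theorem classes_update (B : KPartition k (Fin n)) (C : Fin k → KPartition k ℕ)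
    (σ : Fin k → Equiv.Perm (Fin k)) :
    (update B C σ).rel.classes = {c | c.Nonempty ∧ ∃ j, c = column B C σ j} := by
  ext c
  constructor
  · rintro ⟨y, rfl⟩
    refine ⟨⟨y, (update B C σ).rel.refl' y⟩, columnIndex B C σ y, ?_⟩
    ext x
    rw [mem_column]
    rfl
  · rintro ⟨⟨y, hy⟩, j, rfl⟩
    rw [mem_column] at hy
    refine ⟨y, ?_⟩
    ext x
    rw [mem_column, ← hy]
    rfl

end KPartition

/-! ### Paintboxes -/

/-- The ranked `k`-simplex `s_1 ≥ … ≥ s_k ≥ 0`, `s_1 + … + s_k = 1`. -/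
def RankedSimplex (k : ℕ) : Type :=
  {s : Fin k → ℝ // Antitone s ∧ (∀ j, 0 ≤ s j) ∧ ∑ j, s j = 1}

instance (k : ℕ) : MeasurableSpace (RankedSimplex k) :=
  inferInstanceAs (MeasurableSpace {s : Fin k → ℝ // Antitone s ∧ (∀ j, 0 ≤ s j) ∧ ∑ j, s j = 1})

/-- The law on `{1, …, k}` with weights `s`. -/
noncomputable def colourLaw {k : ℕ} (s : RankedSimplex k) : Measure (Fin k) :=
  ∑ j, ENNReal.ofReal (s.1 j) • Measure.dirac j

instance {k : ℕ} (s : RankedSimplex k) : IsProbabilityMeasure (colourLaw s) := ⟨by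
  simp only [colourLaw, Measure.coe_finsetSum, Finset.sum_apply, Measure.smul_apply,
    measure_univ, smul_eq_mul, mul_one]
  rw [← ENNReal.ofReal_sum_of_nonneg (fun j _ => s.2.2.1 j), s.2.2.2, ENNReal.ofReal_one]⟩

/-- The paintbox `ϱ_s`: the law of the partition into colour classes of an i.i.d. sequence of
colours with law `s`. -/
noncomputable def paintbox {k : ℕ} (s : RankedSimplex k) : Measure (KPartition k ℕ) :=
  (Measure.infinitePi (fun _ : ℕ => colourLaw s)).map KPartition.ofColouring

/-- The paintbox `ϱ_ν = ∫ ϱ_s ν(ds)` based on `ν`. -/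
noncomputable def mixedPaintbox {k : ℕ} (ν : Measure (RankedSimplex k)) :
    Measure (KPartition k ℕ) :=
  ν.bind paintbox

/-! ### Transition probabilities and rates -/

section Rates

variable {k : ℕ} (ν : Measure (RankedSimplex k))

/-- `ϱ_ν(B'_{|b})`: the probability that the restriction to `b` of a `ϱ_ν`-distributed partition
is the restriction of `B'` to `b`. -/
noncomputable def paintboxProb {n : ℕ} (B' : KPartition k (Fin n)) (b : Set (Fin n)) : ℝ :=
  (mixedPaintbox ν).real
    {C | C.comap (fun x : b => ((x : Fin n) : ℕ)) = B'.comap (fun x : b => (x : Fin n))}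

/-- The transition probability
`p_n(B, B'; ν) = k! / (k - #B')! * ∏_{b ∈ B} (k - #B'_{|b})! / k! * ϱ_ν(B'_{|b})`. -/
noncomputable def transitionProb (n : ℕ) (B B' : KPartition k (Fin n)) : ℝ :=
  (k.factorial : ℝ) / ((k - B'.numBlocks).factorial : ℝ) *
    ∏ b ∈ (Set.toFinite B.rel.classes).toFinset,
      (((k - (B'.comap (fun x : b => (x : Fin n))).numBlocks).factorial : ℝ) /
        (k.factorial : ℝ) * paintboxProb ν B' b)

open Classical in
/-- The entries of the `Q`-matrix `Q_n^ν`. -/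
noncomputable def rateMatrix (lam : ℝ≥0) (n : ℕ) (B B' : KPartition k (Fin n)) : ℝ :=
  (lam : ℝ) * (if B = B' then transitionProb ν n B B - 1 else transitionProb ν n B B')

/-- `Q` is the rate kernel `Q^ν` on partitions of the natural numbers, that is, its
finite-dimensional rates are given by the matrices `Q_n^ν`. These equations determine `Q`, as the
events `{B'' | B''_{|[n]} = B'}` form, with the empty set, a generating `π`-system. -/
def IsRateKernel (lam : ℝ≥0) (Q : KPartition k ℕ → SignedMeasure (KPartition k ℕ)) : Prop :=
  ∀ (n : ℕ) (B : KPartition k ℕ) (B' : KPartition k (Fin n)),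
    Q B {B'' | B''.restrict n = B'} = rateMatrix ν lam n (B.restrict n) B'

end Rates

/-! ### Markov processes in continuous time with given rates -/

/-- `X` is a (time-homogeneous) Markov process, with respect to its natural filtration, whose
transition function `κ` has the rates `Q`, that is, `Q(x, A)` is the right derivative of
`t ↦ κ_t(x, A)` at `0`. -/
structure IsMarkovProcessWithRates {Ω S : Type*} [MeasurableSpace Ω] [MeasurableSpace S]
    (μ : Measure Ω) (X : ℝ≥0 → Ω → S) (Q : S → Set S → ℝ) : Prop where
  measurable : ∀ t, Measurable (X t)
  markov : ∃ κ : ℝ≥0 → Kernel S S,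
    (∀ t, IsMarkovKernel (κ t)) ∧
    κ 0 = Kernel.id ∧
    (∀ s t, κ (s + t) = κ t ∘ₖ κ s) ∧
    (∀ x A, MeasurableSet A →
      Tendsto (fun t : ℝ≥0 => ((κ t x).real A - A.indicator 1 x) / (t : ℝ))
        (𝓝[>] 0) (𝓝 (Q x A))) ∧
    ∀ s t A, MeasurableSet A →
      μ[fun ω => A.indicator (fun _ => (1 : ℝ)) (X (s + t) ω) |
        ⨆ u : Set.Iic s, MeasurableSpace.comap (X u) inferInstance]
        =ᵐ[μ] fun ω => (κ t (X s ω)).real A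

/-! ### Poisson point processes -/

/-- The random set of points `P` is a Poisson point process with intensity `Λ`: the numbers of
points in disjoint measurable sets are independent, and the number of points in a measurable set
of finite intensity is Poisson distributed with mean its intensity. -/
structure IsPoissonPointProcess {Ω E : Type*} [MeasurableSpace Ω] [MeasurableSpace E]
    (μ : Measure Ω) (P : Ω → Set E) (Λ : Measure E) : Prop where
  measurable_count : ∀ A, MeasurableSet A → Measurable fun ω => (P ω ∩ A).encard
  law_count : ∀ A, MeasurableSet A → Λ A ≠ ∞ →
    μ.map (fun ω => (P ω ∩ A).encard) =
      (poissonMeasure (Λ A).toNNReal).map (fun m : ℕ => (m : ℕ∞))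
  indep_count : ∀ A : ℕ → Set E, (∀ i, MeasurableSet (A i)) →
    Pairwise (Function.onFun Disjoint A) → iIndepFun (fun i ω => (P ω ∩ A i).encard) μ

/-- The `σ`-algebra generated by the point counts of a random set of points. -/
@[reducible] noncomputable def pointSigma {Ω E : Type*} [MeasurableSpace E] (P : Ω → Set E) : MeasurableSpace Ω :=
  ⨆ A : {A : Set E // MeasurableSet A},
    MeasurableSpace.comap (fun ω => (P ω ∩ A.1).encard) inferInstance

instance (k : ℕ) : MeasurableSpace (Equiv.Perm (Fin k)) := ⊤

/-! ### The Poissonian construction -/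

/-- The marks `(C_1, …, C_k)` of the atoms. -/
abbrev Mark (k : ℕ) : Type := Fin k → KPartition k ℕ

/-- The intensity `dt ⊗ λ ϱ_ν^{(k)}`. -/
noncomputable def poissonIntensity {k : ℕ} (lam : ℝ≥0) (ν : Measure (RankedSimplex k)) :
    Measure (ℝ≥0 × Mark k) :=
  ((volume : Measure ℝ).comap ((↑) : ℝ≥0 → ℝ)).prod (lam • Measure.pi fun _ : Fin k => mixedPaintbox ν)

/-- The random input of the construction: a random initial partition `π`, a Poisson point process
`P` with intensity `dt ⊗ λ ϱ_ν^{(k)}`, and i.i.d. uniform permutations `σ_{m,i}` of `[k]`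
(`m = 0, 1, …` and `i ∈ [k]`), the three being independent. The permutations `σ_{m,1}, …, σ_{m,k}`
will be used at the atom time which is preceded by exactly `m` atoms. -/
structure IsPoissonianInput {Ω : Type*} [MeasurableSpace Ω] (μ : Measure Ω) {k : ℕ} (lam : ℝ≥0)
    (ν : Measure (RankedSimplex k)) (π : Ω → KPartition k ℕ) (P : Ω → Set (ℝ≥0 × Mark k))
    (σ : ℕ → Ω → Fin k → Equiv.Perm (Fin k)) : Prop where
  measurable_init : Measurable π
  poisson : IsPoissonPointProcess μ P (poissonIntensity lam ν)
  measurable_perm : ∀ m, Measurable (σ m)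
  uniform_perm : ∀ m i τ, μ {ω | σ m ω i = τ} = ((k.factorial : ℝ≥0∞))⁻¹
  iIndep_perm : iIndepFun (fun (q : ℕ × Fin k) ω => σ q.1 ω q.2) μ
  indep_perm : Indep (⨆ m, MeasurableSpace.comap (σ m) inferInstance) (pointSigma P) μ
  indep_init : Indep (MeasurableSpace.comap π inferInstance)
    ((⨆ m, MeasurableSpace.comap (σ m) inferInstance) ⊔ pointSigma P) μ

/-- The number of atoms before time `t`. -/
noncomputable def atomsBefore {k : ℕ} (p : Set (ℝ≥0 × Mark k)) (t : ℝ≥0) : ℕ :=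
  {a ∈ p | a.1 < t}.ncard

/-- The path `x` of partitions of the first `n` numbers is constructed from the initial state
`π_{|[n]}`, the atoms `p` and the permutations `σ`: it is right-continuous, and for each time
`t > 0` it has a left limit `b = x(t-)`, where `x(t) = b` if `t` is not an atom time and `x(t)` is
obtained from `b` by the matrix construction if there is an atom `(t, C_1, …, C_k)`. (Limits are
in a finite discrete space.) -/
structure FollowsConstruction {k : ℕ} (n : ℕ) (π : KPartition k ℕ) (p : Set (ℝ≥0 × Mark k))
    (σ : ℕ → Fin k → Equiv.Perm (Fin k)) (x : ℝ≥0 → KPartition k (Fin n)) : Prop where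
  init : x 0 = π.restrict n
  right_cont : ∀ t, ∀ᶠ s in 𝓝[>] t, x s = x t
  jump : ∀ t, 0 < t → ∃ b, (∀ᶠ s in 𝓝[<] t, x s = b) ∧
    ((¬ ∃ C, (t, C) ∈ p) → x t = b) ∧
    ∀ C, (t, C) ∈ p → x t = b.update C (σ (atomsBefore p t))

/-- `B` is the process on partitions of the natural numbers, all of whose restrictions are
(almost surely) given by the construction. -/
structure IsPoissonianProcess {Ω : Type*} [MeasurableSpace Ω] (μ : Measure Ω) {k : ℕ}
    (π : Ω → KPartition k ℕ) (P : Ω → Set (ℝ≥0 × Mark k))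
    (σ : ℕ → Ω → Fin k → Equiv.Perm (Fin k)) (B : ℝ≥0 → Ω → KPartition k ℕ) : Prop where
  measurable : ∀ t, Measurable (B t)
  follows : ∀ᵐ ω ∂μ, ∀ n, FollowsConstruction n (π ω) (P ω) (fun m => σ m ω)
    (fun t => (B t ω).restrict n)

/-! One atom replaces the current state by the column totals built from marks of law `markLaw ν` and
uniform permutations of law `permLaw k`, both independent of the past. Let K be the resulting
one-step kernel (`stepKernelNat`, or `stepKernel` on partitions of an initial segment). Atoms arrive
at the finite rate λ, so the process makes steps of K at the times of a Poisson process: its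
semigroup is κ_t = E[K^N] with N Poisson of mean λt (`poissonSemigroup`), and its rates are λ(K −
I), because two or more atoms in a time t have probability O(t²).

Three facts make this rigorous. First, K restricted to [n] is the matrix p_n
(`stepKernel_real_singleton`). Column totals equal B' exactly when the column index is a colouring
with level sets B'. For a fixed colouring the condition factors over the blocks of B, and averaging
over the permutations of one block leaves the factor of that block in p_n; the number of colourings
is the prefactor.

Second, the construction commutes with restriction, because the position of the block of x in the
list depends only on elements up to x (`rank_restrict`, `restrict_updateNat`). Hence K projects to
its finite versions (`map_restrict_stepKernelNat`), and so do its powers and Poisson mixtures.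
Measures on partitions of ℕ are determined by their finite restrictions, so the Markov property need
only be proved on finite state spaces.

Third, fix an event G of the past of time s and follow the vector P(G, state at r = x) for r ≥ s.
Over a short time h this vector moves by κ_h up to an error (λh)² in each coordinate
(`abs_measureReal_step_le`): the contributions of zero and of one atom agree exactly. Cutting an
interval of length t into m pieces leaves a total error O(1/m), whence equality
(`measureReal_restrictedPath_eq`).

Finally, almost surely the atoms are locally finite with distinct positive times, so a path exists
(`followsConstruction_constructedPath`). Two paths that obey the rules coincide
(`FollowsConstruction.unique`), so every admissible process inherits the law of the explicit one. -/

namespace KPartition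

/-! ### Restriction and measurability of the matrix construction -/

variable {k n : ℕ}

instance (n : ℕ) : DiscreteMeasurableSpace (KPartition k (Fin n)) := ⟨fun _ => trivial⟩

instance (n : ℕ) : Finite (KPartition k (Fin n)) := by
  refine Finite.of_injective (fun B : KPartition k (Fin n) => fun x y => B.rel x y) ?_
  intro B B' h
  ext x y
  exact iff_of_eq (congrFun (congrFun h x) y)

noncomputable instance (n : ℕ) : Fintype (KPartition k (Fin n)) := Fintype.ofFinite _

/-- Only blocks with a least element below that of the block of x are counted. Such a least element
is smaller than x, hence lies in [n], and elements outside [n] cannot alter minimality. This is the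
source of all consistency between different n. -/
theorem rank_restrict (B : KPartition k ℕ) (x : Fin n) :
    rank (B.restrict n).rel x = rank B.rel (x : ℕ) := by
  unfold rank
  rw [← Set.ncard_image_of_injective _ Fin.val_injective]
  congr 1
  ext y
  constructor
  · rintro ⟨y, ⟨h1, h2⟩, rfl⟩
    refine ⟨fun z hz => ?_, fun z hz => ?_⟩
    · rcases lt_or_ge z n with hzn | hzn
      · exact h1 ⟨z, hzn⟩ hz
      · exact y.2.le.trans hzn
    · rcases lt_or_ge z n with hzn | hzn
      · exact h2 ⟨z, hzn⟩ hz
      · exact y.2.trans_le hzn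
  · rintro ⟨h1, h2⟩
    have hy : y < n := (h2 x (B.rel.refl' _)).trans x.2
    exact ⟨⟨y, hy⟩, ⟨fun z hz => h1 z hz, fun z hz => h2 z hz⟩, rfl⟩

theorem blockIndex_restrict (B : KPartition k ℕ) (x : Fin n) :
    (B.restrict n).blockIndex x = B.blockIndex (x : ℕ) :=
  Fin.ext (rank_restrict B x)

/-- The matrix construction on partitions of the natural numbers. -/
noncomputable def updateNat (B : KPartition k ℕ) (C : Fin k → KPartition k ℕ)
    (σ : Fin k → Equiv.Perm (Fin k)) : KPartition k ℕ :=
  ofColouring fun x => (σ (B.blockIndex x)).symm ((C (B.blockIndex x)).blockIndex x)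

theorem restrict_updateNat (B : KPartition k ℕ) (C : Fin k → KPartition k ℕ)
    (σ : Fin k → Equiv.Perm (Fin k)) :
    (updateNat B C σ).restrict n = update (B.restrict n) C σ := by
  have h : columnIndex (B.restrict n) C σ = fun x : Fin n =>
      (σ (B.blockIndex x)).symm ((C (B.blockIndex x)).blockIndex (x : ℕ)) := by
    funext x
    simp only [columnIndex, blockIndex_restrict]
  rw [update, h]
  rfl

theorem restrict_ext {B B' : KPartition k ℕ} (h : ∀ n, B.restrict n = B'.restrict n) :
    B = B' := by
  ext x y
  have := congrArg (fun D => D.rel ⟨x, by omega⟩ ⟨y, by omega⟩) (h (x + y + 1))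
  exact iff_of_eq this

theorem measurable_restrict (n : ℕ) : Measurable (restrict (k := k) n) :=
  measurable_iff_comap_le.2 (le_iSup (fun n => MeasurableSpace.comap (restrict (k := k) n) ⊤) n)

theorem measurable_of_restrict {α : Type*} [MeasurableSpace α] {f : α → KPartition k ℕ}
    (h : ∀ n, Measurable fun a => (f a).restrict n) : Measurable f := by
  rw [measurable_iff_comap_le]
  change MeasurableSpace.comap f (⨆ n, MeasurableSpace.comap (restrict n) ⊤) ≤ _
  rw [MeasurableSpace.comap_iSup]
  refine iSup_le fun n => ?_
  rw [MeasurableSpace.comap_comp]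
  exact measurable_iff_comap_le.1 (h n)

/-- The events which depend on a finite restriction. -/
def cylinders (k : ℕ) : Set (Set (KPartition k ℕ)) :=
  {s | ∃ (n : ℕ) (A : Set (KPartition k (Fin n))), s = restrict n ⁻¹' A}

theorem isPiSystem_cylinders : IsPiSystem (cylinders k) := by
  rintro _ ⟨n, A, rfl⟩ _ ⟨m, A', rfl⟩ -
  refine ⟨max n m, {D | D.comap (Fin.castLE (le_max_left n m)) ∈ A ∧
    D.comap (Fin.castLE (le_max_right n m)) ∈ A'}, ?_⟩
  rfl

theorem generateFrom_cylinders :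
    (inferInstance : MeasurableSpace (KPartition k ℕ)) =
      MeasurableSpace.generateFrom (cylinders k) := by
  refine le_antisymm (iSup_le fun n => ?_) (MeasurableSpace.generateFrom_le ?_)
  · rintro _ ⟨A, -, rfl⟩
    exact MeasurableSpace.measurableSet_generateFrom ⟨n, A, rfl⟩
  · rintro _ ⟨n, A, rfl⟩
    exact measurable_restrict n (MeasurableSet.of_discrete)

/-- The index of the block of x is already visible in the restriction to the first x + 1 elements.
-/
theorem measurable_blockIndex (x : ℕ) :
    Measurable fun C : KPartition k ℕ => C.blockIndex x := by
  have : (fun C : KPartition k ℕ => C.blockIndex x) =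
      (fun D : KPartition k (Fin (x + 1)) => D.blockIndex (Fin.last x)) ∘ restrict (x + 1) := by
    funext C
    simp [blockIndex_restrict]
  rw [this]
  exact (Measurable.of_discrete).comp (measurable_restrict _)

theorem measurable_ofColouring :
    Measurable (ofColouring : (ℕ → Fin k) → KPartition k ℕ) := by
  refine measurable_of_restrict fun n => ?_
  have : (fun f : ℕ → Fin k => (ofColouring f).restrict n) =
      (ofColouring : (Fin n → Fin k) → KPartition k (Fin n)) ∘ fun f x => f x := rfl
  rw [this]
  exact (Measurable.of_discrete).comp (measurable_pi_lambda _ fun x => measurable_pi_apply _)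

theorem measurable_update (B : KPartition k (Fin n)) (σ : Fin k → Equiv.Perm (Fin k)) :
    Measurable fun C : Fin k → KPartition k ℕ => update B C σ := by
  have h : Measurable fun C : Fin k → KPartition k ℕ => columnIndex B C σ := by
    refine measurable_pi_lambda _ fun x => ?_
    exact (Measurable.of_discrete (f := (σ (B.blockIndex x)).symm)).comp
      ((measurable_blockIndex _).comp (measurable_pi_apply _))
  exact (Measurable.of_discrete (f := (ofColouring : (Fin n → Fin k) → _))).comp h

theorem measurable_updateNat :
    Measurable fun q : KPartition k ℕ × (Fin k → KPartition k ℕ) ×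
      (Fin k → Equiv.Perm (Fin k)) => updateNat q.1 q.2.1 q.2.2 := by
  refine measurable_of_restrict fun n => ?_
  simp only [restrict_updateNat]
  have h : Measurable fun q : (KPartition k (Fin n) × (Fin k → Equiv.Perm (Fin k))) ×
      (Fin k → KPartition k ℕ) => update q.1.1 q.2 q.1.2 :=
    measurable_from_prod_countable_right fun x => measurable_update x.1 x.2
  exact h.comp (f := fun q : KPartition k ℕ × (Fin k → KPartition k ℕ) ×
    (Fin k → Equiv.Perm (Fin k)) => ((q.1.restrict n, q.2.2), q.2.1))
    ((((measurable_restrict n).comp measurable_fst).prodMk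
      (measurable_snd.comp measurable_snd)).prodMk (measurable_fst.comp measurable_snd))

end KPartition

/-! ### Measurability of the paintbox in the weights -/

section Paintbox

variable {k : ℕ}

theorem measurable_colourLaw : Measurable (colourLaw (k := k)) := by
  refine Measure.measurable_of_measurable_coe _ fun A _ => ?_
  simp only [colourLaw, Measure.coe_finsetSum, Finset.sum_apply, Measure.smul_apply, smul_eq_mul]
  refine Finset.measurable_sum _ fun j _ => Measurable.mul_const ?_ _
  exact (ENNReal.measurable_ofReal).comp ((measurable_pi_apply j).comp measurable_subtype_coe)

/-- Finite-dimensional cylinders form a generating π-system, and on them the product law is a finite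
product of functions measurable in s. -/
theorem measurable_infinitePi_colourLaw :
    Measurable fun s : RankedSimplex k => Measure.infinitePi fun _ : ℕ => colourLaw s := by
  refine Measurable.measure_of_isPiSystem_of_isProbabilityMeasure
    (generateFrom_squareCylinders (ι := ℕ) (α := fun _ => Fin k)).symm
    (isPiSystem_squareCylinders (fun _ => MeasurableSpace.isPiSystem_measurableSet)
      fun _ => MeasurableSet.univ (α := Fin k)) ?_
  rintro _ ⟨I, t, ht', rfl⟩
  have ht : ∀ i, MeasurableSet (t i) := fun i => ht' i (Set.mem_univ i)
  simp only [Measure.infinitePi_pi _ (s := I) (t := t) fun i _ => ht i]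
  exact Finset.measurable_prod _ fun i _ =>
    (Measure.measurable_coe (ht i)).comp measurable_colourLaw

theorem measurable_paintbox : Measurable (paintbox (k := k)) :=
  (Measure.measurable_map _ KPartition.measurable_ofColouring).comp
    measurable_infinitePi_colourLaw

instance (s : RankedSimplex k) : IsProbabilityMeasure (paintbox s) :=
  Measure.isProbabilityMeasure_map KPartition.measurable_ofColouring.aemeasurable

instance (ν : Measure (RankedSimplex k)) [IsProbabilityMeasure ν] :
    IsProbabilityMeasure (mixedPaintbox ν) := ⟨by
  rw [mixedPaintbox, Measure.bind_apply MeasurableSet.univ measurable_paintbox.aemeasurable]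
  simp⟩

end Paintbox

/-! ### Ordered blocks, and counting colourings and permutations -/

namespace KPartition

variable {k n : ℕ} {α : Type*}

theorem exists_isLeast_class [LinearOrder α] [WellFoundedLT α] (s : Setoid α) (x : α) :
    ∃ m, s m x ∧ ∀ z, s z x → m ≤ z := by
  have hne : {z | s z x}.Nonempty := ⟨x, s.refl' x⟩
  exact ⟨wellFounded_lt.min _ hne, wellFounded_lt.min_mem _ hne,
    fun z hz => wellFounded_lt.min_le (s := {z | s z x}) hz⟩

theorem finite_rank_set [LinearOrder α] (B : KPartition k α) (x : α) :
    {y | (∀ z, B.rel z y → y ≤ z) ∧ ∀ z, B.rel z x → y < z}.Finite := by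
  obtain ⟨f, hf⟩ := exists_ker_eq B.rel B.card_le
  have hr : ∀ a b, B.rel a b ↔ f a = f b := fun a b => by rw [← hf, Setoid.ker_def]
  refine Set.Finite.of_finite_image (f := f) (Set.toFinite _) fun a ha b hb hab => ?_
  exact le_antisymm (ha.1 b ((hr b a).2 hab.symm)) (hb.1 a ((hr a b).2 hab))

/-- Every block minimum counted for x is counted for y, and the minimum m of the block of x is
counted for y but not for x. -/
theorem rank_lt_rank [LinearOrder α] (B : KPartition k α) {x y m m' : α}
    (hm : B.rel m x ∧ ∀ z, B.rel z x → m ≤ z) (hm' : B.rel m' y ∧ ∀ z, B.rel z y → m' ≤ z)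
    (h : m < m') : rank B.rel x < rank B.rel y := by
  refine Set.ncard_lt_ncard ⟨?_, ?_⟩ (finite_rank_set B y)
  · rintro a ⟨h1, h2⟩
    exact ⟨h1, fun z hz => (h2 m hm.1).trans (h.trans_le (hm'.2 z hz))⟩
  · intro hsub
    have : m ∈ {a | (∀ z, B.rel z a → a ≤ z) ∧ ∀ z, B.rel z x → a < z} :=
      hsub ⟨fun z hz => hm.2 z (B.rel.trans' hz hm.1), fun z hz => h.trans_le (hm'.2 z hz)⟩
    exact lt_irrefl m (this.2 m hm.1)

theorem blockIndex_eq_iff [LinearOrder α] [WellFoundedLT α] (B : KPartition k α) (x y : α) :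
    B.blockIndex x = B.blockIndex y ↔ B.rel x y := by
  constructor
  · intro h
    have h : rank B.rel x = rank B.rel y := congrArg Fin.val h
    obtain ⟨m, hm⟩ := exists_isLeast_class B.rel x
    obtain ⟨m', hm'⟩ := exists_isLeast_class B.rel y
    rcases lt_trichotomy m m' with hlt | rfl | hlt
    · exact absurd h (rank_lt_rank B hm hm' hlt).ne
    · exact B.rel.trans' (B.rel.symm' hm.1) hm'.1
    · exact absurd h (rank_lt_rank B hm' hm hlt).ne'
  · intro h
    have : ∀ z, B.rel z x ↔ B.rel z y :=
      fun z => ⟨fun hz => B.rel.trans' hz h, fun hz => B.rel.trans' hz (B.rel.symm' h)⟩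
    exact Fin.ext (by simp only [blockIndex, rank, this])

theorem mem_classes_iff_block [LinearOrder α] [WellFoundedLT α] (B : KPartition k α)
    (b : Set α) : b ∈ B.rel.classes ↔ ∃ i, (B.block i).Nonempty ∧ B.block i = b := by
  have key : ∀ x, {z | B.rel z x} = B.block (B.blockIndex x) := fun x => by
    ext z
    exact (blockIndex_eq_iff B z x).symm
  constructor
  · rintro ⟨x, rfl⟩
    exact ⟨B.blockIndex x, ⟨x, rfl⟩, (key x).symm⟩
  · rintro ⟨i, ⟨x, rfl⟩, rfl⟩
    exact ⟨x, (key x).symm⟩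

theorem numBlocks_ofColouring (f : α → Fin k) :
    (ofColouring f).numBlocks = (Set.range f).ncard := by
  have e : (ofColouring f).rel.classes ≃ Set.range f :=
    (Setoid.quotientEquivClasses (Setoid.ker f)).symm.trans (Setoid.quotientKerEquivRange f)
  exact Nat.card_congr e

theorem numBlocks_le (B : KPartition k α) : B.numBlocks ≤ k := by
  have h := B.card_le
  rw [← (Set.finite_of_encard_le_coe h).cast_ncard_eq] at h
  exact_mod_cast h

theorem ofColouring_eq_iff (f : α → Fin k) (B : KPartition k α) :
    ofColouring f = B ↔ ∀ x y, f x = f y ↔ B.rel x y := by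
  constructor
  · rintro rfl x y
    exact Iff.rfl
  · intro h
    ext x y
    exact h x y

/-- Colourings with level sets B are the injections of the set of blocks into the k colours, which
gives a falling factorial. -/
theorem card_ofColouring_eq (B : KPartition k (Fin n)) :
    (Nat.card {f : Fin n → Fin k // ofColouring f = B} : ℝ) =
      (k.factorial : ℝ) / ((k - B.numBlocks).factorial : ℝ) := by
  classical
  have e : {f : Fin n → Fin k // ofColouring f = B} ≃ (Quotient B.rel ↪ Fin k) :=
    { toFun := fun f => ⟨Quotient.lift f.1 fun x y h => ((ofColouring_eq_iff _ _).1 f.2 x y).2 h, by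
        rintro ⟨x⟩ ⟨y⟩ h
        exact Quotient.sound (((ofColouring_eq_iff _ _).1 f.2 x y).1 h)⟩
      invFun := fun g => ⟨fun x => g (Quotient.mk _ x), by
        rw [ofColouring_eq_iff]
        intro x y
        rw [g.injective.eq_iff]
        exact Quotient.eq⟩
      left_inv := fun f => rfl
      right_inv := fun g => by
        ext ⟨x⟩
        rfl }
  have : Fintype (Quotient B.rel) := Fintype.ofFinite _
  have hq : Fintype.card (Quotient B.rel) = B.numBlocks := by
    rw [← Nat.card_eq_fintype_card]
    exact Nat.card_congr (Setoid.quotientEquivClasses B.rel)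
  rw [Nat.card_congr e, Nat.card_eq_fintype_card, Fintype.card_embedding_eq, Fintype.card_fin, hq,
    Nat.descFactorial_eq_div B.numBlocks_le, Nat.cast_div (Nat.factorial_dvd_factorial
    (Nat.sub_le _ _)) (by positivity)]

/-- Since f and g have the same level sets, f x ↦ g x is a bijection between their ranges and
extends to a permutation t₀. All other solutions differ from t₀ by a permutation fixing the range of
f pointwise, that is, by a permutation of its complement. -/
theorem card_perm_extending {ι : Type*} (f g : ι → Fin k) (h : ∀ x y, f x = f y ↔ g x = g y) :
    Nat.card {t : Equiv.Perm (Fin k) // ∀ x, t (f x) = g x} =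
      (k - (Set.range f).ncard).factorial := by
  classical
  obtain ⟨t₀, ht₀⟩ : ∃ t₀ : Equiv.Perm (Fin k), ∀ x, t₀ (f x) = g x := by
    let e : {a // a ∈ Set.range f} ≃ {a // a ∈ Set.range g} :=
      (Setoid.quotientKerEquivRange f).symm.trans
        ((Quotient.congrRight fun x y => h x y).trans (Setoid.quotientKerEquivRange g))
    refine ⟨e.extendSubtype, fun x => ?_⟩
    rw [Equiv.extendSubtype_apply_of_mem _ _ ⟨x, rfl⟩]
    have : (Setoid.quotientKerEquivRange f).symm ⟨f x, ⟨x, rfl⟩⟩ = Quotient.mk _ x := by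
      rw [Equiv.symm_apply_eq]
      rfl
    simp only [e, Equiv.trans_apply, this]
    rfl
  have e1 : {t : Equiv.Perm (Fin k) // ∀ x, t (f x) = g x} ≃
      {t : Equiv.Perm (Fin k) // ∀ a, ¬ a ∉ Set.range f → t a = a} :=
    { toFun := fun t => ⟨t₀⁻¹ * t.1, by
        intro a ha
        obtain ⟨x, rfl⟩ := not_not.1 ha
        rw [Equiv.Perm.mul_apply, t.2, Equiv.Perm.inv_eq_iff_eq, ht₀]⟩
      invFun := fun t => ⟨t₀ * t.1, fun x => by
        rw [Equiv.Perm.mul_apply, t.2 _ (not_not.2 ⟨x, rfl⟩), ht₀]⟩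
      left_inv := fun t => by simp
      right_inv := fun t => by simp }
  rw [Nat.card_congr (e1.trans (Equiv.Perm.subtypeEquivSubtypePerm _).symm),
    Nat.card_eq_fintype_card, Fintype.card_perm, ← Nat.card_eq_fintype_card]
  congr 1
  have : Nat.card {a // a ∉ Set.range f} = ((Set.range f)ᶜ).ncard := rfl
  rw [this, Set.ncard_compl, Nat.card_eq_fintype_card, Fintype.card_fin]

end KPartition

open KPartition

/-! ### The one-step kernel and its identification with the matrix p_n -/

section Step

variable {k n : ℕ} (ν : Measure (RankedSimplex k))

/-- The law of the marks. -/
noncomputable def markLaw : Measure (Mark k) := Measure.pi fun _ : Fin k => mixedPaintbox ν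

instance [IsProbabilityMeasure ν] : IsProbabilityMeasure (markLaw ν) := by
  unfold markLaw
  infer_instance

/-- The law of a family of independent uniform permutations. -/
noncomputable def permLaw (k : ℕ) : Measure (Fin k → Equiv.Perm (Fin k)) :=
  ((k.factorial : ℝ≥0∞)⁻¹) ^ k • Measure.count

theorem permLaw_singleton (τ : Fin k → Equiv.Perm (Fin k)) :
    permLaw k {τ} = ((k.factorial : ℝ≥0∞)⁻¹) ^ k := by
  simp [permLaw]

instance : IsProbabilityMeasure (permLaw k) := ⟨by
  have h : (k.factorial : ℝ≥0∞) ≠ 0 := by exact_mod_cast k.factorial_ne_zero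
  rw [permLaw, Measure.smul_apply, Measure.count_apply_finite _ Set.finite_univ]
  simp only [Set.toFinite_toFinset, Set.toFinset_univ, Finset.card_univ, Fintype.card_pi,
    Fintype.card_perm, Fintype.card_fin, Finset.prod_const, smul_eq_mul]
  rw [Nat.cast_pow, ← mul_pow, ENNReal.inv_mul_cancel h (ENNReal.natCast_ne_top _), one_pow]⟩

/-- The transition kernel of one step of the construction, for partitions of `Fin n`. -/
noncomputable def stepKernel (n : ℕ) : Kernel (KPartition k (Fin n)) (KPartition k (Fin n)) :=
  ⟨fun B => ((markLaw ν).prod (permLaw k)).map fun q => update B q.1 q.2, Measurable.of_discrete⟩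

theorem measurable_update_prod (B : KPartition k (Fin n)) :
    Measurable fun q : Mark k × (Fin k → Equiv.Perm (Fin k)) => update B q.1 q.2 :=
  measurable_from_prod_countable_left fun τ => measurable_update B τ

theorem stepKernel_apply (B : KPartition k (Fin n)) :
    stepKernel ν n B = ((markLaw ν).prod (permLaw k)).map fun q => update B q.1 q.2 := rfl

instance [IsProbabilityMeasure ν] : IsMarkovKernel (stepKernel ν n) := ⟨fun B => by
  rw [stepKernel_apply]
  exact Measure.isProbabilityMeasure_map (measurable_update_prod B).aemeasurable⟩

/-- The transition kernel of one step of the construction, for partitions of `ℕ`. -/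
noncomputable def stepKernelNat : Kernel (KPartition k ℕ) (KPartition k ℕ) :=
  (Kernel.id ×ₖ Kernel.const _ ((markLaw ν).prod (permLaw k))).map
    fun q => updateNat q.1 q.2.1 q.2.2

instance [IsProbabilityMeasure ν] : IsMarkovKernel (stepKernelNat ν) :=
  Kernel.IsMarkovKernel.map _ measurable_updateNat

theorem stepKernelNat_apply [IsProbabilityMeasure ν] (B : KPartition k ℕ) :
    stepKernelNat ν B = ((markLaw ν).prod (permLaw k)).map fun q => updateNat B q.1 q.2 := by
  rw [stepKernelNat, Kernel.map_apply _ measurable_updateNat, Kernel.prod_apply, Kernel.id_apply,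
    Kernel.const_apply, Measure.dirac_prod, Measure.map_map measurable_updateNat
    measurable_prodMk_left]
  rfl

theorem map_restrict_stepKernelNat [IsProbabilityMeasure ν] (B : KPartition k ℕ) :
    (stepKernelNat ν B).map (restrict n) = stepKernel ν n (B.restrict n) := by
  have hB : Measurable fun q : Mark k × (Fin k → Equiv.Perm (Fin k)) => updateNat B q.1 q.2 :=
    measurable_updateNat.comp measurable_prodMk_left
  rw [stepKernelNat_apply, Measure.map_map (measurable_restrict n) hB, stepKernel_apply]
  congr 1
  funext q
  exact restrict_updateNat _ _ _

theorem stepKernel_singleton [IsProbabilityMeasure ν] (B B' : KPartition k (Fin n)) :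
    stepKernel ν n B {B'} = ∑ τ : Fin k → Equiv.Perm (Fin k),
      ((k.factorial : ℝ≥0∞)⁻¹) ^ k * markLaw ν {C | update B C τ = B'} := by
  rw [stepKernel_apply, Measure.map_apply (measurable_update_prod B) (by measurability),
    Measure.prod_apply_symm (measurable_update_prod B (by measurability)), lintegral_fintype]
  refine Finset.sum_congr rfl fun τ _ => ?_
  rw [permLaw_singleton, mul_comm]
  rfl

theorem stepKernel_real_singleton_eq_sum [IsProbabilityMeasure ν] (B B' : KPartition k (Fin n)) :
    (stepKernel ν n B).real {B'} = ∑ τ : Fin k → Equiv.Perm (Fin k),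
      ((k.factorial : ℝ)⁻¹) ^ k * (markLaw ν).real {C | update B C τ = B'} := by
  rw [measureReal_def, stepKernel_singleton, ENNReal.toReal_sum]
  · refine Finset.sum_congr rfl fun τ _ => ?_
    rw [ENNReal.toReal_mul, ENNReal.toReal_pow, ENNReal.toReal_inv, ENNReal.toReal_natCast]
    rfl
  · intro τ _
    exact ENNReal.mul_ne_top (ENNReal.pow_ne_top (by
      simpa using k.factorial_ne_zero)) (measure_ne_top _ _)

/-- Exchange the sum over t with the integral over D. For a given D the number of admissible t is
zero unless D and f induce the same partition of b, and otherwise it is the count of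
`card_perm_extending`, which does not depend on D. -/
theorem sum_perm_measureReal [IsProbabilityMeasure ν] (f : Fin n → Fin k) (b : Set (Fin n)) :
    ∑ t : Equiv.Perm (Fin k),
      (mixedPaintbox ν).real {D | ∀ x ∈ b, t (f x) = D.blockIndex (x : ℕ)} =
    ((k - ((ofColouring f).comap (fun x : b => (x : Fin n))).numBlocks).factorial : ℝ) *
      paintboxProb ν (ofColouring f) b := by
  classical
  have hm : ∀ t : Equiv.Perm (Fin k),
      MeasurableSet {D : KPartition k ℕ | ∀ x ∈ b, t (f x) = D.blockIndex (x : ℕ)} := fun t => by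
    simp only [Set.ofPred_forall]
    exact MeasurableSet.iInter fun x => MeasurableSet.iInter fun _ =>
      measurableSet_eq_fun measurable_const (measurable_blockIndex _)
  set S : Set (KPartition k ℕ) :=
    {C | C.comap (fun x : b => ((x : Fin n) : ℕ)) =
      (ofColouring f).comap (fun x : b => (x : Fin n))} with hS
  have hSiff : ∀ C, C ∈ S ↔ ∀ x y : b, f x = f y ↔ C.blockIndex (x : Fin n) =
      C.blockIndex (y : Fin n) := fun C => by
    simp only [blockIndex_eq_iff]
    constructor
    · intro h x y
      exact (iff_of_eq (congrArg (fun D : KPartition k b => D.rel x y) h)).symm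
    · intro h
      ext x y
      exact (h x y).symm
  have hSm : MeasurableSet S := by
    have : S = ⋂ (x : b) (y : b), {C | f x = f y ↔ C.blockIndex (x : Fin n) =
        C.blockIndex (y : Fin n)} := by
      ext C
      simp only [hSiff, Set.mem_iInter, Set.mem_ofPred_eq]
    rw [this]
    refine MeasurableSet.iInter fun x => MeasurableSet.iInter fun y => ?_
    exact ((measurable_blockIndex _).prodMk (measurable_blockIndex _))
      (MeasurableSet.of_discrete (s := {q : Fin k × Fin k | f x = f y ↔ q.1 = q.2}))
  have hcount : ∀ D : KPartition k ℕ,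
      ∑ t : Equiv.Perm (Fin k),
        {D : KPartition k ℕ | ∀ x ∈ b, t (f x) = D.blockIndex (x : ℕ)}.indicator
          (1 : KPartition k ℕ → ℝ) D =
      S.indicator (fun _ => ((k - ((ofColouring f).comap
        (fun x : b => (x : Fin n))).numBlocks).factorial : ℝ)) D := by
    intro D
    have h1 : (ofColouring f).comap (fun x : b => (x : Fin n)) =
      ofColouring (fun x : b => f x) := rfl
    by_cases hD : D ∈ S
    · rw [Set.indicator_of_mem hD, h1, numBlocks_ofColouring,
        ← card_perm_extending (fun x : b => f x) (fun x : b => D.blockIndex (x : Fin n))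
          ((hSiff D).1 hD), Nat.card_eq_fintype_card, Fintype.card_subtype]
      simp [Set.indicator_apply, Finset.sum_boole]
    · rw [Set.indicator_of_notMem hD]
      refine Finset.sum_eq_zero fun t _ => Set.indicator_of_notMem (fun ht => hD ?_) _
      rw [hSiff]
      intro x y
      rw [← ht x x.2, ← ht y y.2, t.injective.eq_iff]
  calc _ = ∑ t : Equiv.Perm (Fin k), ∫ D,
        {D : KPartition k ℕ | ∀ x ∈ b, t (f x) = D.blockIndex (x : ℕ)}.indicator
          (1 : KPartition k ℕ → ℝ) D ∂(mixedPaintbox ν) :=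
        Finset.sum_congr rfl fun t _ => (integral_indicator_one (hm t)).symm
    _ = ∫ D, S.indicator (fun _ => ((k - ((ofColouring f).comap
        (fun x : b => (x : Fin n))).numBlocks).factorial : ℝ)) D ∂(mixedPaintbox ν) := by
        rw [← integral_finsetSum]
        · simp only [hcount]
        · exact fun t _ => (integrable_const (1 : ℝ)).indicator (hm t)
    _ = _ := by
        rw [integral_indicator_const _ hSm, smul_eq_mul, mul_comm]
        rfl

theorem stepKernel_real_singleton [IsProbabilityMeasure ν] (B B' : KPartition k (Fin n)) :
    (stepKernel ν n B).real {B'} = transitionProb ν n B B' := by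
  classical
  have hk : (k.factorial : ℝ) ≠ 0 := by exact_mod_cast k.factorial_ne_zero
  set F : Set (Fin n) → ℝ := fun b =>
    ((k - (B'.comap (fun x : b => (x : Fin n))).numBlocks).factorial : ℝ) /
        (k.factorial : ℝ) * paintboxProb ν B' b with hF
  have h2 : ∀ τ : Fin k → Equiv.Perm (Fin k), (markLaw ν).real {C | update B C τ = B'} =
      ∑ f : {f : Fin n → Fin k // ofColouring f = B'},
        ∏ i, (mixedPaintbox ν).real
          {D | ∀ x ∈ B.block i, τ i (f.1 x) = D.blockIndex (x : ℕ)} := by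
    intro τ
    -- Once the colouring is prescribed, the condition on the k marks becomes a product set, one
    -- factor per block of B, so independence of the marks applies.
    have hset : ∀ f : Fin n → Fin k, {C : Mark k | columnIndex B C τ = f} =
        Set.univ.pi fun i => {D | ∀ x ∈ B.block i, τ i (f x) = D.blockIndex (x : ℕ)} := by
      intro f
      ext C
      simp only [Set.mem_ofPred_eq, Set.mem_univ_pi, funext_iff, columnIndex, block,
        Equiv.symm_apply_eq]
      constructor
      · rintro h _ x rfl
        exact (h x).symm
      · exact fun h x => (h _ x rfl).symm
    have hm : ∀ f : Fin n → Fin k, MeasurableSet {C : Mark k | columnIndex B C τ = f} := by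
      intro f
      rw [hset]
      refine MeasurableSet.univ_pi fun i => ?_
      simp only [Set.ofPred_forall]
      exact MeasurableSet.iInter fun x => MeasurableSet.iInter fun _ =>
        measurableSet_eq_fun measurable_const (measurable_blockIndex _)
    have hU : {C : Mark k | update B C τ = B'} =
        ⋃ f : {f : Fin n → Fin k // ofColouring f = B'}, {C | columnIndex B C τ = f.1} := by
      ext C
      simp only [Set.mem_iUnion, Set.mem_ofPred_eq]
      exact ⟨fun h => ⟨⟨_, h⟩, rfl⟩, fun ⟨f, hf⟩ => by rw [update, hf, f.2]⟩
    rw [hU, measureReal_iUnion_fintype]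
    · refine Finset.sum_congr rfl fun f _ => ?_
      rw [hset, markLaw, measureReal_def, Measure.pi_pi, ENNReal.toReal_prod]
      rfl
    · intro f g hfg
      refine Set.disjoint_left.2 fun C hC hC' => hfg (Subtype.ext ?_)
      exact hC.symm.trans hC'
    · exact fun f => hm _
  -- The permutations are independent as well: the sum over τ of the product is the product of the
  -- sums over the single permutations. The result no longer depends on the colouring f, only on its
  -- level sets.
  have h3 : ∀ f : {f : Fin n → Fin k // ofColouring f = B'},
      ∑ τ : Fin k → Equiv.Perm (Fin k), ((k.factorial : ℝ)⁻¹) ^ k * ∏ i, (mixedPaintbox ν).real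
          {D | ∀ x ∈ B.block i, τ i (f.1 x) = D.blockIndex (x : ℕ)} =
      ∏ i, F (B.block i) := by
    rintro ⟨f, rfl⟩
    rw [← Finset.mul_sum]
    have hp := Finset.prod_univ_sum (fun _ : Fin k => (Finset.univ : Finset (Equiv.Perm (Fin k))))
      (fun i t => (mixedPaintbox ν).real {D | ∀ x ∈ B.block i, t (f x) = D.blockIndex (x : ℕ)})
    rw [Fintype.piFinset_univ] at hp
    rw [← hp]
    have hc : ((k.factorial : ℝ)⁻¹) ^ k = ∏ _i : Fin k, (k.factorial : ℝ)⁻¹ := by simp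
    rw [hc, ← Finset.prod_mul_distrib]
    refine Finset.prod_congr rfl fun i _ => ?_
    rw [sum_perm_measureReal, hF]
    ring
  have h4 : ∏ i, F (B.block i) = ∏ b ∈ (Set.toFinite B.rel.classes).toFinset, F b := by
    -- The empty sets that fill up the list of blocks contribute k!/k! · 1 = 1, so the product over
    -- k list entries is the product over the blocks.
    have hempty : ∀ b : Set (Fin n), b = ∅ → F b = 1 := by
      rintro b rfl
      have e1 : (B'.comap (fun x : (∅ : Set (Fin n)) => (x : Fin n))).numBlocks = 0 := by
        obtain ⟨f, hf⟩ := exists_ker_eq B'.rel B'.card_le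
        have : B' = ofColouring f := KPartition.ext hf.symm
        subst this
        have h1 : (ofColouring f).comap (fun x : (∅ : Set (Fin n)) => (x : Fin n)) =
          ofColouring (fun x : (∅ : Set (Fin n)) => f x) := rfl
        rw [h1, numBlocks_ofColouring, Set.range_eq_empty_iff.2 ⟨fun x => x.2.elim⟩,
          Set.ncard_empty]
      have e2 : paintboxProb ν B' ∅ = 1 := by
        have : {C : KPartition k ℕ | C.comap (fun x : (∅ : Set (Fin n)) => ((x : Fin n) : ℕ)) =
            B'.comap (fun x : (∅ : Set (Fin n)) => (x : Fin n))} = Set.univ := by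
          refine Set.eq_univ_of_forall fun C => ?_
          ext x
          exact x.2.elim
        rw [paintboxProb, this]
        simp
      change ((k - (B'.comap (fun x : (∅ : Set (Fin n)) => (x : Fin n))).numBlocks).factorial : ℝ) /
        (k.factorial : ℝ) * paintboxProb ν B' ∅ = 1
      rw [e1, e2, Nat.sub_zero, mul_one, div_self hk]
    rw [← Finset.prod_filter_mul_prod_filter_not Finset.univ fun i => (B.block i).Nonempty,
      Finset.prod_eq_one (s := Finset.univ.filter fun i => ¬ (B.block i).Nonempty), mul_one]
    · refine Finset.prod_nbij (fun i => B.block i) ?_ ?_ ?_ fun _ _ => rfl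
      · intro i hi
        simp only [Set.Finite.mem_toFinset, mem_classes_iff_block]
        exact ⟨i, (Finset.mem_filter.1 hi).2, rfl⟩
      · intro i hi j hj hij
        obtain ⟨x, hx⟩ := (Finset.mem_filter.1 hi).2
        have hx' : x ∈ B.block j := by
          have hij : B.block i = B.block j := hij
          rw [← hij]
          exact hx
        exact hx.symm.trans hx'
      · intro b hb
        simp only [Set.Finite.coe_toFinset, mem_classes_iff_block] at hb
        obtain ⟨i, hi, rfl⟩ := hb
        exact ⟨i, by simpa using hi, rfl⟩
    · intro i hi
      exact hempty _ (Set.not_nonempty_iff_eq_empty.1 (Finset.mem_filter.1 hi).2)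
  rw [stepKernel_real_singleton_eq_sum]
  simp only [h2, Finset.mul_sum]
  rw [Finset.sum_comm]
  simp only [h3]
  rw [Finset.sum_const, nsmul_eq_mul, Finset.card_univ, ← Nat.card_eq_fintype_card,
    card_ofColouring_eq, h4, transitionProb]

end Step

/-! ### The semigroup of a chain run at Poisson times -/

section PoissonSemigroup

variable {S S' : Type*} [MeasurableSpace S] [MeasurableSpace S']

theorem isMarkovKernel_pow (K : Kernel S S) [IsMarkovKernel K] (m : ℕ) :
    IsMarkovKernel (K ^ m) := by
  induction m with
  | zero => rw [pow_zero]; exact inferInstanceAs (IsMarkovKernel Kernel.id)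
  | succ m ih => rw [pow_succ]; exact inferInstanceAs (IsMarkovKernel ((K ^ m) ∘ₖ K))

theorem Kernel.pow_add_apply (K : Kernel S S) (m l : ℕ) (x : S) {A : Set S}
    (hA : MeasurableSet A) :
    (K ^ (m + l)) x A = ∫⁻ y, (K ^ l) y A ∂((K ^ m) x) := by
  rw [add_comm, pow_add]
  exact Kernel.comp_apply' _ _ _ hA

/-- The transition function of the continuous time chain which makes steps with the
kernel `K` at the times of a Poisson process, at the instant when the expected number of
steps is `a`. -/
noncomputable def poissonSemigroup (K : Kernel S S) (a : ℝ≥0) : Kernel S S :=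
  ⟨fun x => (poissonMeasure a).bind fun m => (K ^ m) x, by
    refine Measure.measurable_of_measurable_coe _ fun A hA => ?_
    simp_rw [Measure.bind_apply hA (Measurable.of_discrete).aemeasurable, lintegral_countable']
    exact Measurable.tsum fun m => ((K ^ m).measurable_coe hA).mul_const _⟩

variable (K : Kernel S S) (a b : ℝ≥0)

theorem poissonSemigroup_eq_bind (x : S) :
    poissonSemigroup K a x = (poissonMeasure a).bind fun m => (K ^ m) x := rfl

theorem poissonSemigroup_apply (x : S) {A : Set S} (hA : MeasurableSet A) :
    poissonSemigroup K a x A = ∫⁻ m, (K ^ m) x A ∂(poissonMeasure a) :=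
  Measure.bind_apply hA (Measurable.of_discrete).aemeasurable

instance [IsMarkovKernel K] : IsMarkovKernel (poissonSemigroup K a) := ⟨fun x => ⟨by
  have := isMarkovKernel_pow K
  rw [poissonSemigroup_apply K a x MeasurableSet.univ]
  simp⟩⟩

/-- The semigroup law combines K^(m+l) = K^m K^l with the convolution identity Poisson(a) ∗
Poisson(b) = Poisson(a + b). -/
theorem poissonSemigroup_add :
    poissonSemigroup K (a + b) = poissonSemigroup K b ∘ₖ poissonSemigroup K a := by
  ext x A hA
  rw [Kernel.comp_apply' _ _ _ hA, poissonSemigroup_apply K _ x hA,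
    ← poissonMeasure_conv_poissonMeasure, Measure.lintegral_conv Measurable.of_discrete,
    poissonSemigroup_eq_bind K a x, Measure.lintegral_bind
      (Measurable.of_discrete).aemeasurable ((Kernel.measurable_coe _ hA).aemeasurable)]
  refine lintegral_congr fun m => ?_
  simp_rw [Kernel.pow_add_apply K m _ x hA, poissonSemigroup_apply K b _ hA,
    lintegral_countable']
  rw [lintegral_tsum fun l => (((K ^ l).measurable_coe hA).mul_const _).aemeasurable]
  refine tsum_congr fun l => ?_
  rw [lintegral_mul_const _ ((K ^ l).measurable_coe hA)]

variable {K} in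
-- If f intertwines two kernels it intertwines their powers. With f a restriction map, this carries
-- the consistency of one step over to the whole semigroup.
theorem Kernel.map_pow {K' : Kernel S' S'} {f : S → S'} (hf : Measurable f)
    (h : ∀ x, (K x).map f = K' (f x)) (m : ℕ) (x : S) :
    ((K ^ m) x).map f = (K' ^ m) (f x) := by
  induction m generalizing x with
  | zero => exact Measure.map_dirac' hf x
  | succ m ih =>
    ext A hA
    have h1 : ∀ y, (K ^ m) y (f ⁻¹' A) = (K' ^ m) (f y) A := fun y => by
      rw [← ih, Measure.map_apply hf hA]
    rw [Measure.map_apply hf hA, add_comm, Kernel.pow_add_apply K 1 m x (hf hA),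
      Kernel.pow_add_apply K' 1 m _ hA, pow_one, pow_one, ← h,
      lintegral_map ((K' ^ m).measurable_coe hA) hf]
    simp only [h1]

variable {K} in
theorem map_poissonSemigroup {K' : Kernel S' S'} {f : S → S'} (hf : Measurable f)
    (h : ∀ x, (K x).map f = K' (f x)) (x : S) :
    (poissonSemigroup K a x).map f = poissonSemigroup K' a (f x) := by
  ext A hA
  rw [Measure.map_apply hf hA, poissonSemigroup_apply K a x (hf hA),
    poissonSemigroup_apply K' a _ hA]
  refine lintegral_congr fun m => ?_
  rw [← Kernel.map_pow hf h, Measure.map_apply hf hA]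

/-- The left side is the probability that a Poisson variable of mean x is at least 2. Use exp(−x) ≥
1 − x and (1 − x)(1 + x) = 1 − x². -/
theorem one_sub_le_exp_neg_mul (x : ℝ) (hx : 0 ≤ x) :
    1 - Real.exp (-x) - Real.exp (-x) * x ≤ x ^ 2 := by
  have := Real.add_one_le_exp (-x)
  nlinarith

/-- The two explicit terms are those of zero and one step. R collects all terms with at least two
steps, so it is nonnegative and at most the Poisson probability of at least two. -/
theorem poissonSemigroup_expansion [IsMarkovKernel K] (x : S) {A : Set S}
    (hA : MeasurableSet A) : ∃ R, 0 ≤ R ∧ R ≤ (a : ℝ) ^ 2 ∧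
      (poissonSemigroup K a x).real A = Real.exp (-a) * A.indicator 1 x +
        Real.exp (-a) * a * (K x).real A + R := by
  have := isMarkovKernel_pow K
  set p : ℕ → ℝ := fun m => Real.exp (-a) * (a : ℝ) ^ m / m.factorial with hp
  have hp0 : ∀ m, 0 ≤ p m := fun m => by positivity
  have hps : HasSum p 1 := hasSum_one_poissonMeasure a
  have hc1 : ∀ m, ((K ^ m) x).real A ≤ 1 := fun m => measureReal_le_one
  have hle : ∀ m, p m * ((K ^ m) x).real A ≤ p m :=
    fun m => mul_le_of_le_one_right (hp0 m) (hc1 m)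
  have h0 : ∀ m, 0 ≤ p m * ((K ^ m) x).real A := fun m => mul_nonneg (hp0 m) measureReal_nonneg
  have hs : Summable fun m => p m * ((K ^ m) x).real A :=
    Summable.of_nonneg_of_le h0 hle hps.summable
  have h : (poissonSemigroup K a x).real A = ∑' m, p m * ((K ^ m) x).real A := by
    rw [measureReal_def, poissonSemigroup_apply K a x hA, lintegral_countable',
      ENNReal.tsum_toReal_eq fun m => ENNReal.mul_ne_top (measure_ne_top _ _) (measure_ne_top _ _)]
    refine tsum_congr fun m => ?_
    rw [ENNReal.toReal_mul, mul_comm, ← measureReal_def, ← measureReal_def,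
      poissonMeasure_real_singleton]
  have e0 : ((K ^ 0) x).real A = A.indicator 1 x := by
    rw [pow_zero]
    change (Measure.dirac x).real A = _
    rw [measureReal_def, Measure.dirac_apply' _ hA]
    by_cases hx : x ∈ A <;> simp [hx]
  refine ⟨∑' m, p (m + 2) * ((K ^ (m + 2)) x).real A, tsum_nonneg fun m => h0 (m + 2), ?_, ?_⟩
  · calc ∑' m, p (m + 2) * ((K ^ (m + 2)) x).real A ≤ ∑' m, p (m + 2) :=
        Summable.tsum_le_tsum (fun m => hle (m + 2))
          (hs.comp_injective (add_left_injective 2))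
          (hps.summable.comp_injective (add_left_injective 2))
      _ = 1 - p 0 - p 1 := by
        have := hps.summable.sum_add_tsum_nat_add 2
        rw [hps.tsum_eq] at this
        simp only [Finset.sum_range_succ, Finset.sum_range_zero, zero_add] at this
        linarith
      _ ≤ _ := by
        have e : 1 - p 0 - p 1 = 1 - Real.exp (-a) - Real.exp (-a) * a := by
          simp only [hp, pow_zero, pow_one, Nat.factorial_zero, Nat.factorial_one, Nat.cast_one,
            mul_one, div_one]
        rw [e]
        exact one_sub_le_exp_neg_mul a a.2
  · rw [h, ← hs.sum_add_tsum_nat_add 2]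
    have e2 : ∑ m ∈ Finset.range 2, p m * ((K ^ m) x).real A =
        Real.exp (-a) * A.indicator 1 x + Real.exp (-a) * a * (K x).real A := by
      rw [Finset.sum_range_succ, Finset.sum_range_one, e0, pow_one]
      simp only [hp, pow_zero, pow_one, Nat.factorial_zero, Nat.factorial_one, Nat.cast_one,
        mul_one, div_one]
    rw [e2]

theorem poissonSemigroup_zero : poissonSemigroup K 0 = Kernel.id := by
  ext x A hA
  have h : poissonMeasure 0 = Measure.dirac 0 := by
    refine Measure.ext_of_singleton fun n => ?_
    rw [poissonMeasure_singleton]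
    rcases n with _ | n <;> simp
  rw [poissonSemigroup_apply K 0 x hA, h, lintegral_dirac, pow_zero]
  rfl

theorem tendsto_poissonSemigroup_rate [IsMarkovKernel K] (lam : ℝ≥0) (x : S) {A : Set S}
    (hA : MeasurableSet A) :
    Tendsto (fun t : ℝ≥0 =>
        ((poissonSemigroup K (lam * t) x).real A - A.indicator 1 x) / (t : ℝ))
      (𝓝[>] 0) (𝓝 (lam * ((K x).real A - A.indicator 1 x))) := by
  set i : ℝ := A.indicator 1 x with hi
  have hi0 : 0 ≤ i := Set.indicator_nonneg (fun _ _ => zero_le_one) _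
  have hi1 : i ≤ 1 := Set.indicator_le_self' (fun _ _ => zero_le_one) _
  -- The constant 3 counts three errors of size at most a²: replacing exp(−a) by 1 − a in the
  -- zero-step term, replacing it by 1 in the one-step term, and R.
  have hbound : ∀ a : ℝ≥0, |(poissonSemigroup K a x).real A - i - a * ((K x).real A - i)| ≤
      3 * (a : ℝ) ^ 2 := by
    intro a
    obtain ⟨R, hR0, hR, h⟩ := poissonSemigroup_expansion K a x hA
    rw [h, ← hi]
    have h1 := Real.add_one_le_exp (-(a : ℝ))
    -- From exp(−a)(1 + a) ≤ 1 and (1 + a)(1 − a + a²) = 1 + a³ ≥ 1.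
    have h2 : Real.exp (-(a : ℝ)) ≤ 1 - a + (a : ℝ) ^ 2 := by
      have h3 := Real.add_one_le_exp (a : ℝ)
      have h4 : Real.exp (-(a : ℝ)) * Real.exp a = 1 := by rw [← Real.exp_add]; simp
      have h5 := Real.exp_pos (-(a : ℝ))
      have h6 : 0 ≤ (a : ℝ) := a.2
      have h7 : Real.exp (-(a : ℝ)) * (a + 1) ≤ 1 := by nlinarith
      have h8 : 0 ≤ (a : ℝ) ^ 3 := by positivity
      nlinarith
    have h3 : Real.exp (-(a : ℝ)) ≤ 1 := by simp
    have hK0 : 0 ≤ (K x).real A := measureReal_nonneg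
    have hK1 : (K x).real A ≤ 1 := measureReal_le_one
    have ha : (0 : ℝ) ≤ a := a.2
    have e : Real.exp (-a) * i + Real.exp (-a) * a * (K x).real A + R - i -
        a * ((K x).real A - i) = (Real.exp (-a) - 1 + a) * i -
          (1 - Real.exp (-a)) * (a * (K x).real A) + R := by ring
    have b1 : 0 ≤ (Real.exp (-(a : ℝ)) - 1 + a) * i := mul_nonneg (by linarith) hi0
    have b2 : (Real.exp (-(a : ℝ)) - 1 + a) * i ≤ (a : ℝ) ^ 2 * 1 :=
      mul_le_mul (by linarith) hi1 hi0 (by positivity)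
    have b3 : 0 ≤ (1 - Real.exp (-(a : ℝ))) * (a * (K x).real A) :=
      mul_nonneg (by linarith) (by positivity)
    have b4 : (1 - Real.exp (-(a : ℝ))) * (a * (K x).real A) ≤ a * (a * 1) :=
      mul_le_mul (by linarith) (by gcongr) (by positivity) ha
    rw [e, abs_le]
    constructor <;> nlinarith
  have hlim : Tendsto (fun t : ℝ≥0 => 3 * (lam : ℝ) ^ 2 * (t : ℝ)) (𝓝[>] 0) (𝓝 0) := by
    have : Tendsto (fun t : ℝ≥0 => 3 * (lam : ℝ) ^ 2 * (t : ℝ)) (𝓝 0)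
        (𝓝 (3 * (lam : ℝ) ^ 2 * ((0 : ℝ≥0) : ℝ))) :=
      (by fun_prop : Continuous fun t : ℝ≥0 => 3 * (lam : ℝ) ^ 2 * (t : ℝ)).tendsto 0
    rw [NNReal.coe_zero, mul_zero] at this
    exact this.mono_left nhdsWithin_le_nhds
  rw [← tendsto_sub_nhds_zero_iff]
  refine squeeze_zero_norm' ?_ hlim
  filter_upwards [self_mem_nhdsWithin] with t ht
  have ht : (0 : ℝ) < t := ht
  have := hbound (lam * t)
  rw [NNReal.coe_mul] at this
  have e : ((poissonSemigroup K (lam * t) x).real A - i) / (t : ℝ) -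
      lam * ((K x).real A - i) = ((poissonSemigroup K (lam * t) x).real A - i -
        lam * t * ((K x).real A - i)) / t := by
    field_simp
  rw [e, Real.norm_eq_abs, abs_div, abs_of_pos ht, div_le_iff₀ ht]
  refine this.trans (le_of_eq (by ring))

end PoissonSemigroup

/-! ### Deterministic paths driven by a simple configuration of atoms -/

section Atoms

variable {k n : ℕ} {p : Set (ℝ≥0 × Mark k)}

/-- The point configuration has no atom at time `0`, and every bounded time interval has a
uniform subdivision into intervals which contain at most one atom each. -/
def IsSimpleConfiguration (p : Set (ℝ≥0 × Mark k)) : Prop :=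
  (p ∩ {0} ×ˢ Set.univ).encard = 0 ∧ ∀ T : ℕ, ∃ c : ℕ, 0 < c ∧ ∀ i < T * c,
    (p ∩ Set.Ioc ((i : ℝ≥0) / c) (((i : ℝ≥0) + 1) / c) ×ˢ Set.univ).encard ≤ 1

/-- The number of atoms up to time `t`. -/
noncomputable def atomsUpTo (p : Set (ℝ≥0 × Mark k)) (t : ℝ≥0) : ℕ := {a ∈ p | a.1 ≤ t}.ncard

theorem exists_mem_cell {T c : ℕ} (hc : 0 < c) {s : ℝ≥0} (h0 : 0 < s) (hT : s ≤ T) :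
    ∃ i < T * c, s ∈ Set.Ioc ((i : ℝ≥0) / c) (((i : ℝ≥0) + 1) / c) := by
  have hc' : (0 : ℝ≥0) < c := by exact_mod_cast hc
  have hpos : 0 < s * c := by positivity
  -- The cells are open on the left and closed on the right, so the cell index is the ceiling minus
  -- one; positivity of s keeps it a natural number.
  obtain ⟨i, hi⟩ : ∃ i, ⌈s * c⌉₊ = i + 1 :=
    Nat.exists_eq_succ_of_ne_zero (Nat.ceil_pos.2 hpos).ne'
  have h1 : s * c ≤ ((i + 1 : ℕ) : ℝ≥0) := hi ▸ Nat.le_ceil _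
  have h2 : (i : ℝ≥0) < s * c := Nat.lt_ceil.1 (by omega)
  refine ⟨i, ?_, (div_lt_iff₀ hc').2 h2, (le_div_iff₀ hc').2 (by exact_mod_cast h1)⟩
  have : (i : ℝ≥0) < ((T * c : ℕ) : ℝ≥0) := by
    push_cast
    exact h2.trans_le (by gcongr)
  exact_mod_cast this

namespace IsSimpleConfiguration

theorem time_pos (hp : IsSimpleConfiguration p) {a : ℝ≥0 × Mark k} (ha : a ∈ p) : 0 < a.1 := by
  rw [pos_iff_ne_zero]
  intro h
  have := hp.1
  rw [Set.encard_eq_zero] at this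
  exact Set.eq_empty_iff_forall_notMem.1 this a ⟨ha, h, trivial⟩

theorem finite (hp : IsSimpleConfiguration p) (t : ℝ≥0) : {a ∈ p | a.1 ≤ t}.Finite := by
  obtain ⟨T, hT⟩ := exists_nat_ge t
  obtain ⟨c, hc, h⟩ := hp.2 T
  refine Set.Finite.subset (Set.Finite.biUnion (Set.finite_lt_nat (T * c)) fun i hi =>
    Set.finite_of_encard_le_coe (k := 1) (h i hi)) ?_
  rintro a ⟨ha, hat⟩
  obtain ⟨i, hi, hcell⟩ := exists_mem_cell hc (hp.time_pos ha) (hat.trans hT)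
  exact Set.mem_biUnion hi ⟨ha, hcell, trivial⟩

theorem eq_of_time_eq (hp : IsSimpleConfiguration p) {a b : ℝ≥0 × Mark k}
    (ha : a ∈ p) (hb : b ∈ p) (h : a.1 = b.1) :
    a = b := by
  obtain ⟨T, hT⟩ := exists_nat_ge a.1
  obtain ⟨c, hc, h'⟩ := hp.2 T
  obtain ⟨i, hi, hcell⟩ := exists_mem_cell hc (hp.time_pos ha) hT
  exact Set.encard_le_one_iff.1 (h' i hi) a b ⟨ha, hcell, trivial⟩ ⟨hb, h ▸ hcell, trivial⟩

theorem finite_before (hp : IsSimpleConfiguration p) (t : ℝ≥0) : {a ∈ p | a.1 < t}.Finite :=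
  (hp.finite t).subset fun _ ha => ⟨ha.1, ha.2.le⟩

theorem atomsUpTo_of_mem (hp : IsSimpleConfiguration p) {t : ℝ≥0} {C : Mark k} (h : (t, C) ∈ p) :
    atomsUpTo p t = atomsBefore p t + 1 := by
  have : {a ∈ p | a.1 ≤ t} = insert (t, C) {a ∈ p | a.1 < t} := by
    ext a
    constructor
    · rintro ⟨ha, hat⟩
      rcases hat.lt_or_eq with hlt | heq
      · exact Or.inr ⟨ha, hlt⟩
      · exact Or.inl (hp.eq_of_time_eq ha h heq)
    · rintro (rfl | ha)
      · exact ⟨h, le_rfl⟩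
      · exact ⟨ha.1, ha.2.le⟩
  rw [atomsUpTo, this, Set.ncard_insert_of_notMem (fun h => lt_irrefl _ h.2) (hp.finite_before t),
    atomsBefore]

theorem atomsUpTo_of_notMem {t : ℝ≥0} (h : ¬ ∃ C, (t, C) ∈ p) :
    atomsUpTo p t = atomsBefore p t := by
  rw [atomsUpTo, atomsBefore]
  congr 1
  ext a
  exact ⟨fun ha => ⟨ha.1, lt_of_le_of_ne ha.2 fun e => h ⟨a.2, e ▸ ha.1⟩⟩,
    fun ha => ⟨ha.1, ha.2.le⟩⟩

theorem atomsUpTo_le_atomsBefore (hp : IsSimpleConfiguration p) {s t : ℝ≥0} (h : s < t) :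
    atomsUpTo p s ≤ atomsBefore p t :=
  Set.ncard_le_ncard (fun _ ha => ⟨ha.1, ha.2.trans_lt h⟩) (hp.finite_before t)

/-- Between two atoms at different times the count of earlier atoms strictly increases, so this
count identifies the atom. It justifies numbering the atoms by `atomsBefore`. -/
theorem mark_unique (hp : IsSimpleConfiguration p) {t t' : ℝ≥0} {C C' : Mark k}
    (h : (t, C) ∈ p) (h' : (t', C') ∈ p)
    (he : atomsBefore p t = atomsBefore p t') : C = C' := by
  rcases lt_trichotomy t t' with hlt | rfl | hlt
  · have := hp.atomsUpTo_le_atomsBefore hlt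
    rw [hp.atomsUpTo_of_mem h] at this
    omega
  · exact congrArg Prod.snd (hp.eq_of_time_eq h h' rfl)
  · have := hp.atomsUpTo_le_atomsBefore hlt
    rw [hp.atomsUpTo_of_mem h'] at this
    omega

theorem eventually_atomsUpTo_right (hp : IsSimpleConfiguration p) (t : ℝ≥0) :
    ∀ᶠ s in 𝓝[>] t, atomsUpTo p s = atomsUpTo p t := by
  -- The window up to t + 1 contains finitely many atoms, so finitely many conditions keep s below
  -- each atom after t.
  have h1 : ∀ᶠ s in 𝓝[>] t, ∀ a ∈ {a ∈ p | a.1 ≤ t + 1}, t < a.1 → s < a.1 := by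
    refine (eventually_all_finite (hp.finite (t + 1))).2 fun a _ => ?_
    by_cases h : t < a.1
    · exact mem_of_superset (mem_nhdsWithin_of_mem_nhds (Iio_mem_nhds h)) fun s hs _ => hs
    · exact Eventually.of_forall fun s hs => absurd hs h
  have h2 : ∀ᶠ s in 𝓝[>] t, s < t + 1 :=
    mem_nhdsWithin_of_mem_nhds (Iio_mem_nhds (lt_add_one t))
  filter_upwards [h1, h2, self_mem_nhdsWithin] with s hs1 hs2 hs3
  rw [atomsUpTo, atomsUpTo]
  congr 1
  ext a
  refine ⟨fun ha => ⟨ha.1, ?_⟩, fun ha => ⟨ha.1, ha.2.trans (le_of_lt hs3)⟩⟩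
  by_contra h
  exact not_lt_of_ge ha.2 (hs1 a ⟨ha.1, ha.2.trans hs2.le⟩ (not_le.1 h))

theorem eventually_atomsUpTo_left (hp : IsSimpleConfiguration p) (t : ℝ≥0) :
    ∀ᶠ s in 𝓝[<] t, atomsUpTo p s = atomsBefore p t := by
  have h1 : ∀ᶠ s in 𝓝[<] t, ∀ a ∈ {a ∈ p | a.1 < t}, a.1 < s :=
    (eventually_all_finite (hp.finite_before t)).2 fun a ha =>
      mem_nhdsWithin_of_mem_nhds (Ioi_mem_nhds ha.2)
  filter_upwards [h1, self_mem_nhdsWithin] with s hs1 hs2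
  rw [atomsUpTo, atomsBefore]
  congr 1
  ext a
  exact ⟨fun ha => ⟨ha.1, ha.2.trans_lt hs2⟩, fun ha => ⟨ha.1, (hs1 a ha).le⟩⟩

theorem atomsUpTo_eq_of_forall_eq (hp : IsSimpleConfiguration p) {r t s : ℝ≥0}
    {C : Mark k} (hs : s ∈ Set.Ioc r t) (h : (s, C) ∈ p)
    (hu : ∀ a ∈ p, a.1 ∈ Set.Ioc r t → a = (s, C)) :
    atomsBefore p s = atomsUpTo p r ∧ atomsUpTo p t = atomsUpTo p r + 1 := by
  have h1 : atomsBefore p s = atomsUpTo p r := by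
    rw [atomsUpTo, atomsBefore]
    congr 1
    ext a
    refine ⟨fun ha => ⟨ha.1, ?_⟩, fun ha => ⟨ha.1, ha.2.trans_lt hs.1⟩⟩
    by_contra hr
    have := hu a ha.1 ⟨not_le.1 hr, ha.2.le.trans hs.2⟩
    subst this
    exact lt_irrefl _ ha.2
  refine ⟨h1, ?_⟩
  rw [← h1, ← hp.atomsUpTo_of_mem h, atomsUpTo, atomsUpTo]
  congr 1
  ext a
  refine ⟨fun ha => ⟨ha.1, ?_⟩, fun ha => ⟨ha.1, ha.2.trans hs.2⟩⟩
  by_cases hr : a.1 ≤ r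
  · exact hr.trans hs.1.le
  · rw [hu a ha.1 ⟨not_le.1 hr, ha.2⟩]

end IsSimpleConfiguration

theorem atomsUpTo_eq_of_forall_notMem {r t : ℝ≥0} (hrt : r ≤ t)
    (h : ∀ a ∈ p, a.1 ∉ Set.Ioc r t) : atomsUpTo p t = atomsUpTo p r := by
  rw [atomsUpTo, atomsUpTo]
  congr 1
  ext a
  refine ⟨fun ha => ⟨ha.1, ?_⟩, fun ha => ⟨ha.1, ha.2.trans hrt⟩⟩
  by_contra hr
  exact h a ha.1 ⟨not_le.1 hr, ha.2⟩

variable (π : KPartition k ℕ) (σ : ℕ → Fin k → Equiv.Perm (Fin k))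

open Classical in
/-- The mark of the atom which is preceded by exactly `m` atoms, or `C` if there is none. -/
noncomputable def markAt (p : Set (ℝ≥0 × Mark k)) (m : ℕ) (C : Mark k) : Mark k :=
  if h : ∃ C t, (t, C) ∈ p ∧ atomsBefore p t = m then h.choose else C

theorem markAt_atomsBefore (hp : IsSimpleConfiguration p) {t : ℝ≥0} {C : Mark k}
    (h : (t, C) ∈ p) (C' : Mark k) : markAt p (atomsBefore p t) C' = C := by
  have hex : ∃ C s, (s, C) ∈ p ∧ atomsBefore p s = atomsBefore p t := ⟨C, t, h, rfl⟩
  rw [markAt, dif_pos hex]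
  obtain ⟨s, hs, he⟩ := hex.choose_spec
  exact hp.mark_unique hs h he

/-- The successive states of the construction. -/
noncomputable def stateChain (p : Set (ℝ≥0 × Mark k)) : ℕ → KPartition k ℕ
  | 0 => π
  -- The atom preceded by m others uses the permutations with index m. The constant family π is only
  -- a default mark, available even when the space of partitions is not known to be inhabited; it is
  -- never used at an actual atom.
  | m + 1 => updateNat (stateChain p m) (markAt p m fun _ => π) (σ m)

/-- The path obtained from the construction. -/
noncomputable def constructedPath (p : Set (ℝ≥0 × Mark k)) (t : ℝ≥0) : KPartition k ℕ :=
  stateChain π σ p (atomsUpTo p t)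

theorem constructedPath_of_no_atom {r t : ℝ≥0} (hrt : r ≤ t)
    (h : ∀ a ∈ p, a.1 ∉ Set.Ioc r t) :
    constructedPath π σ p t = constructedPath π σ p r := by
  rw [constructedPath, constructedPath, atomsUpTo_eq_of_forall_notMem hrt h]

theorem constructedPath_of_one_atom (hp : IsSimpleConfiguration p) {r t s : ℝ≥0} {C : Mark k}
    (hs : s ∈ Set.Ioc r t) (h : (s, C) ∈ p) (hu : ∀ a ∈ p, a.1 ∈ Set.Ioc r t → a = (s, C)) :
    constructedPath π σ p t =
      updateNat (constructedPath π σ p r) C (σ (atomsUpTo p r)) := by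
  obtain ⟨h1, h2⟩ := hp.atomsUpTo_eq_of_forall_eq hs h hu
  rw [constructedPath, h2, stateChain, ← h1, markAt_atomsBefore hp h, constructedPath, ← h1]

/-- Just before t the path has made `atomsBefore p t` steps, and at t it has made `atomsUpTo p t`.
These numbers are equal unless t is an atom time, when they differ by one. -/
theorem followsConstruction_constructedPath (hp : IsSimpleConfiguration p) (n : ℕ) :
    FollowsConstruction n π p σ fun t => (constructedPath π σ p t).restrict n where
  init := by
    have : atomsUpTo p 0 = 0 := by
      have : {a ∈ p | a.1 ≤ 0} = ∅ :=
        Set.eq_empty_iff_forall_notMem.2 fun a ha => not_lt_of_ge ha.2 (hp.time_pos ha.1)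
      rw [atomsUpTo, this, Set.ncard_empty]
    rw [constructedPath, this, stateChain]
  right_cont t := by
    filter_upwards [hp.eventually_atomsUpTo_right t] with s hs
    rw [constructedPath, hs, constructedPath]
  jump t _ := by
    refine ⟨(stateChain π σ p (atomsBefore p t)).restrict n, ?_, ?_, ?_⟩
    · filter_upwards [hp.eventually_atomsUpTo_left t] with s hs
      rw [constructedPath, hs]
    · intro h
      rw [constructedPath, IsSimpleConfiguration.atomsUpTo_of_notMem h]
    · intro C h
      rw [constructedPath, hp.atomsUpTo_of_mem h, stateChain, markAt_atomsBefore hp h,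
        restrict_updateNat]

variable {π σ} in
-- Continuous induction on the set of times up to which the paths agree. Agreement strictly before t
-- forces equal left limits, hence equal values at t by the jump rule, so the set is closed;
-- right-continuity extends agreement slightly beyond any of its points.
theorem FollowsConstruction.unique {x y : ℝ≥0 → KPartition k (Fin n)}
    (hx : FollowsConstruction n π p σ x) (hy : FollowsConstruction n π p σ y) : x = y := by
  set F : Set ℝ≥0 := {t | ∀ s ≤ t, x s = y s} with hF
  have hstep : ∀ t, (∀ s < t, x s = y s) → x t = y t := by
    intro t h
    rcases eq_or_lt_of_le (zero_le (a := t)) with rfl | ht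
    · rw [hx.init, hy.init]
    obtain ⟨b, hb, hb1, hb2⟩ := hx.jump t ht
    obtain ⟨b', hb', hb1', hb2'⟩ := hy.jump t ht
    have : (𝓝[<] t).NeBot := nhdsLT_neBot_of_exists_lt ⟨0, ht⟩
    obtain ⟨s, hs1, hs2, hs3⟩ := (hb.and (hb'.and self_mem_nhdsWithin)).exists
    have hbb : b = b' := by rw [← hs1, ← hs2, h s hs3]
    subst hbb
    by_cases hC : ∃ C, (t, C) ∈ p
    · obtain ⟨C, hC⟩ := hC
      rw [hb2 C hC, hb2' C hC]
    · rw [hb1 hC, hb1' hC]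
  have hlt : ∀ t, (∀ s < t, x s = y s) → t ∈ F := by
    intro t h s hs
    exact hstep s fun u hu => h u (hu.trans_le hs)
  have hclosed : IsClosed F := by
    refine isClosed_of_closure_subset fun t ht => hlt t fun s hs => ?_
    obtain ⟨u, hu, huF⟩ := mem_closure_iff_nhds.1 ht _ (Ioi_mem_nhds hs)
    exact huF s (le_of_lt hu)
  funext t
  refine (hclosed.inter isClosed_Icc).Icc_subset_of_forall_mem_nhdsWithin (a := 0) (b := t)
    (hlt 0 fun s hs => absurd hs (not_lt_zero)) ?_ ⟨zero_le, le_rfl⟩ t le_rfl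
  rintro r ⟨hr, -⟩
  obtain ⟨u, hu, h⟩ := (mem_nhdsGT_iff_exists_Ioo_subset' (lt_add_one r)).1
    ((hx.right_cont r).and (hy.right_cont r))
  refine mem_of_superset (Ioo_mem_nhdsGT hu) fun v hv s hs => ?_
  rcases le_or_gt s r with hsr | hsr
  · exact hr s hsr
  · obtain ⟨h1, h2⟩ := h ⟨hsr, hs.trans_lt hv.2⟩
    rw [h1, h2, hr r le_rfl]

end Atoms

/-! ### Counts of a Poisson point process -/

section PoissonCounts

variable {Ω E : Type*} [MeasurableSpace Ω] [MeasurableSpace E] {μ : Measure Ω} {P : Ω → Set E}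
  {Λ : Measure E}

namespace IsPoissonPointProcess

theorem measureReal_count_eq (h : IsPoissonPointProcess μ P Λ) {A : Set E}
    (hA : MeasurableSet A) (hΛ : Λ A ≠ ∞) (m : ℕ) :
    μ.real {ω | (P ω ∩ A).encard = m} =
      Real.exp (-(Λ A).toReal) * (Λ A).toReal ^ m / m.factorial := by
  have h1 := congrArg (fun ρ : Measure ℕ∞ => ρ.real {(m : ℕ∞)}) (h.law_count A hA hΛ)
  simp only [measureReal_def] at h1
  rw [Measure.map_apply (h.measurable_count A hA) (MeasurableSet.of_discrete),
    Measure.map_apply Measurable.of_discrete (MeasurableSet.of_discrete)] at h1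
  have h2 : (fun m : ℕ => (m : ℕ∞)) ⁻¹' {(m : ℕ∞)} = {m} := by
    ext j
    simp
  rw [h2, ← measureReal_def, ← measureReal_def, poissonMeasure_real_singleton] at h1
  exact h1

theorem measureReal_two_le_count [IsProbabilityMeasure μ] (h : IsPoissonPointProcess μ P Λ)
    {A : Set E} (hA : MeasurableSet A) (hΛ : Λ A ≠ ∞) :
    μ.real {ω | ¬ (P ω ∩ A).encard ≤ 1} ≤ (Λ A).toReal ^ 2 := by
  have hm : ∀ m : ℕ, MeasurableSet {ω | (P ω ∩ A).encard = m} := fun m =>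
    h.measurable_count A hA (MeasurableSet.of_discrete (s := {(m : ℕ∞)}))
  have e : {ω | (P ω ∩ A).encard ≤ 1} =
      {ω | (P ω ∩ A).encard = (0 : ℕ)} ∪ {ω | (P ω ∩ A).encard = (1 : ℕ)} := by
    ext ω
    simp only [Set.mem_ofPred_eq, Set.mem_union, Nat.cast_zero, Nat.cast_one]
    exact Order.le_one_iff
  have hd : Disjoint {ω | (P ω ∩ A).encard = (0 : ℕ)} {ω | (P ω ∩ A).encard = (1 : ℕ)} :=
    Set.disjoint_left.2 fun ω h0 h1 => by
      rw [Set.mem_ofPred_eq] at h0 h1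
      rw [h0] at h1
      exact absurd h1 (by norm_num)
  have h1 : μ.real {ω | ¬ (P ω ∩ A).encard ≤ 1} = 1 - μ.real {ω | (P ω ∩ A).encard ≤ 1} := by
    rw [← probReal_compl_eq_one_sub]
    · rfl
    · rw [e]
      exact (hm 0).union (hm 1)
  rw [h1, e, measureReal_union hd (hm 1), h.measureReal_count_eq hA hΛ,
    h.measureReal_count_eq hA hΛ]
  have := one_sub_le_exp_neg_mul (Λ A).toReal ENNReal.toReal_nonneg
  simp only [pow_zero, pow_one, Nat.factorial_zero, Nat.factorial_one, Nat.cast_one, mul_one,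
    div_one]
  linarith

/-- The family is embedded into a sequence, with empty sets at the unused indices. -/
theorem indep_count_of_countable {ι : Type*} [Countable ι] (h : IsPoissonPointProcess μ P Λ)
    (A : ι → Set E) (hA : ∀ i, MeasurableSet (A i))
    (hd : Pairwise (Function.onFun Disjoint A)) :
    iIndepFun (fun i ω => (P ω ∩ A i).encard) μ := by
  obtain ⟨e, he⟩ := Countable.exists_injective_nat ι
  have h1 := h.indep_count (Function.extend e A fun _ => ∅) ?_ ?_
  · have h2 := h1.precomp he
    simpa only [he.extend_apply] using h2
  · intro n
    by_cases hn : ∃ i, e i = n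
    · obtain ⟨i, rfl⟩ := hn
      rw [he.extend_apply]
      exact hA i
    · rw [Function.extend_apply' _ _ _ hn]
      exact MeasurableSet.empty
  · intro n m hnm
    unfold Function.onFun
    by_cases hn : ∃ i, e i = n
    · by_cases hm : ∃ i, e i = m
      · obtain ⟨i, rfl⟩ := hn
        obtain ⟨j, rfl⟩ := hm
        rw [he.extend_apply, he.extend_apply]
        exact hd fun hij => hnm (congrArg e hij)
      · rw [Function.extend_apply' _ _ m hm]
        exact Set.disjoint_empty _
    · rw [Function.extend_apply' _ _ n hn]
      exact Set.empty_disjoint _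

/-- The point counts of subsets of `D` are independent of the point counts of two disjoint sets
in the complement of `D`. -/
theorem indep_counts (h : IsPoissonPointProcess μ P Λ) [IsProbabilityMeasure μ]
    {D : Set E} (hD : MeasurableSet D) {A : Bool → Set E} (hA : ∀ i, MeasurableSet (A i))
    (hd : Disjoint (A true) (A false)) (hAD : ∀ i, Disjoint D (A i)) :
    Indep (⨆ B : {B : Set E // MeasurableSet B ∧ B ⊆ D},
        MeasurableSpace.comap (fun ω => (P ω ∩ B.1).encard) inferInstance)
      (⨆ i, MeasurableSpace.comap (fun ω => (P ω ∩ A i).encard) inferInstance) μ := by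
  classical
  have hle : ∀ B : Set E, MeasurableSet B →
      MeasurableSpace.comap (fun ω => (P ω ∩ B).encard) inferInstance ≤
        (inferInstance : MeasurableSpace Ω) :=
    fun B hB => (h.measurable_count B hB).comap_le
  -- The left σ-algebra is a directed supremum over finite families of subsets of D, so one finite
  -- family t suffices.
  rw [iSup_eq_iSup_finset]
  refine indep_iSup_of_directed_le (fun t => ?_)
    (fun t => iSup₂_le fun B _ => hle B.1 B.2.1) (iSup_le fun i => hle _ (hA i))
    (Monotone.directed_le fun t t' htt => biSup_mono fun B hB => Finset.mem_of_subset htt hB)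
  -- The sets in t may overlap, while independence is given for disjoint sets only. The cells of the
  -- finite algebra they generate are disjoint, and the count of each set in t is the sum of the
  -- counts of its cells.
  let cell : (t → Bool) → Set E := fun s => {e ∈ D | ∀ B : t, e ∈ B.1.1 ↔ s B = true}
  have hcell : ∀ s, MeasurableSet (cell s) := fun s => by
    refine hD.inter ?_
    change MeasurableSet {e | ∀ B : t, e ∈ B.1.1 ↔ s B = true}
    rw [Set.ofPred_forall]
    refine MeasurableSet.iInter fun B => ?_
    by_cases hs : s B = true
    · convert B.1.2.1 using 1
      ext e
      simp [hs]
    · convert B.1.2.1.compl using 1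
      ext e
      simp [hs]
  have hcd : Pairwise (Function.onFun Disjoint cell) := fun s s' hss =>
    Set.disjoint_left.2 fun e he he' => hss <| funext fun B =>
      Bool.eq_iff_iff.2 ((he.2 B).symm.trans (he'.2 B))
  have hind := h.indep_count_of_countable (Sum.elim cell A)
    (by rintro (s | i); exacts [hcell s, hA i])
    (by
      rintro (s | i) (s' | j) hne
      · exact hcd fun e => hne (congrArg _ e)
      · exact (hAD j).mono_left fun e he => he.1
      · exact ((hAD i).mono_left fun e he => he.1).symm
      · unfold Function.onFun
        cases i <;> cases j
        · exact absurd rfl hne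
        · exact hd.symm
        · exact hd
        · exact absurd rfl hne)
  rw [iIndepFun_iff_iIndep] at hind
  have hsum := indep_iSup_of_disjoint (fun i => (by
    rcases i with s | i
    exacts [hle _ (hcell s), hle _ (hA i)])) hind
    (S := Set.range Sum.inl) (T := Set.range Sum.inr)
    (Set.disjoint_left.2 (by rintro _ ⟨a, rfl⟩ ⟨b, hb⟩; cases hb))
  refine indep_of_indep_of_le_left (indep_of_indep_of_le_right hsum ?_) ?_
  · refine iSup_le fun i => ?_
    exact le_iSup₂_of_le (Sum.inr i) ⟨i, rfl⟩ le_rfl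
  · refine iSup₂_le fun B hB => ?_
    rw [← measurable_iff_comap_le]
    have hcount : (fun ω => (P ω ∩ B.1).encard) =
        fun ω => ∑ s : {s : t → Bool // s ⟨B, hB⟩ = true}, (P ω ∩ cell s.1).encard := by
      funext ω
      rw [← finsum_eq_sum_of_fintype, ← Set.encard_iUnion_of_finite]
      · congr 1
        ext e
        simp only [Set.mem_inter_iff, Set.mem_iUnion]
        constructor
        · rintro ⟨he, heB⟩
          exact ⟨⟨fun B' => decide (e ∈ B'.1.1), decide_eq_true heB⟩, he, B.2.2 heB,
            fun B' => decide_eq_true_iff.symm⟩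
        · rintro ⟨s, he, hs⟩
          exact ⟨he, (hs.2 ⟨B, hB⟩).2 s.2⟩
      · intro s s' hss
        exact (hcd fun e => hss (Subtype.ext e)).mono Set.inter_subset_right
          Set.inter_subset_right
    rw [hcount]
    refine Finset.measurable_sum _ fun s _ => ?_
    rw [measurable_iff_comap_le]
    exact le_iSup₂_of_le (f := fun i (_ : i ∈ Set.range Sum.inl) => MeasurableSpace.comap
      (fun ω => (P ω ∩ (Sum.elim cell A i)).encard) inferInstance) (Sum.inl s.1) ⟨s.1, rfl⟩ le_rfl

end IsPoissonPointProcess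

end PoissonCounts

/-! ### Almost sure simplicity of the atoms -/

section Intensity

variable {k : ℕ} (lam : ℝ≥0) (ν : Measure (RankedSimplex k)) [IsProbabilityMeasure ν]

theorem poissonIntensity_prod (I : Set ℝ≥0) (D : Set (Mark k)) :
    poissonIntensity lam ν (I ×ˢ D) =
      volume ((↑) '' I : Set ℝ) * (lam * markLaw ν D) := by
  have : IsProbabilityMeasure (Measure.pi fun _ : Fin k => mixedPaintbox ν) := by infer_instance
  rw [poissonIntensity, Measure.prod_prod]
  congr 1
  exact (MeasurableEmbedding.subtype_coe measurableSet_Ici).comap_apply volume I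

theorem toReal_poissonIntensity_Ioc {r t : ℝ≥0} (hrt : r ≤ t) (D : Set (Mark k)) :
    poissonIntensity lam ν (Set.Ioc r t ×ˢ D) ≠ ∞ ∧
    (poissonIntensity lam ν (Set.Ioc r t ×ˢ D)).toReal =
      (t - r) * (lam * (markLaw ν).real D) := by
  have h : ((↑) '' Set.Ioc r t : Set ℝ) = Set.Ioc (r : ℝ) t := by
    ext x
    constructor
    · rintro ⟨y, hy, rfl⟩
      exact hy
    · exact fun hx => ⟨⟨x, r.2.trans hx.1.le⟩, hx, rfl⟩
  rw [poissonIntensity_prod, h, Real.volume_Ioc]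
  refine ⟨ENNReal.mul_ne_top ENNReal.ofReal_ne_top
    (ENNReal.mul_ne_top ENNReal.coe_ne_top (measure_ne_top _ _)), ?_⟩
  rw [ENNReal.toReal_mul, ENNReal.toReal_mul, ENNReal.toReal_ofReal
    (sub_nonneg.2 (NNReal.coe_le_coe.2 hrt))]
  rfl

theorem poissonIntensity_zero : poissonIntensity lam ν ({0} ×ˢ Set.univ) = 0 := by
  rw [poissonIntensity_prod]
  simp

variable {Ω : Type*} [MeasurableSpace Ω] {μ : Measure Ω} [IsProbabilityMeasure μ]
  {P : Ω → Set (ℝ≥0 × Mark k)}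

variable {lam ν} in
-- Of the Tc cells of length 1/c, each contains two or more atoms with probability at most (λ/c)².
-- The union bound Tλ²/c tends to 0.
theorem ae_isSimpleConfiguration (h : IsPoissonPointProcess μ P (poissonIntensity lam ν)) :
    ∀ᵐ ω ∂μ, IsSimpleConfiguration (P ω) := by
  -- An atom at time 0 would already count in `atomsUpTo p 0` and spoil the initial condition; the
  -- time axis charges no single point.
  have h0 : ∀ᵐ ω ∂μ, (P ω ∩ {0} ×ˢ Set.univ).encard = 0 := by
    have hm : MeasurableSet (({0} : Set ℝ≥0) ×ˢ (Set.univ : Set (Mark k))) :=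
      (measurableSet_singleton _).prod MeasurableSet.univ
    have h1 := h.measureReal_count_eq hm (by rw [poissonIntensity_zero]; simp) 0
    rw [poissonIntensity_zero] at h1
    have h2 : μ.real {ω | (P ω ∩ {0} ×ˢ Set.univ).encard = (0 : ℕ)} = 1 := by simpa using h1
    have h3 : μ {ω | (P ω ∩ {0} ×ˢ Set.univ).encard = (0 : ℕ)} = 1 := by
      rw [← ENNReal.toReal_eq_one_iff]
      exact h2
    rw [prob_compl_eq_zero_iff (s := _) ?_ |>.symm] at h3
    · exact h3
    · exact h.measurable_count _ hm (MeasurableSet.of_discrete (s := {((0 : ℕ) : ℕ∞)}))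
  have h1 : ∀ T : ℕ, ∀ᵐ ω ∂μ, ∃ c : ℕ, 0 < c ∧ ∀ i < T * c,
      (P ω ∩ Set.Ioc ((i : ℝ≥0) / c) (((i : ℝ≥0) + 1) / c) ×ˢ Set.univ).encard ≤ 1 := by
    intro T
    -- The bad event asks that every subdivision fail, so it does not depend on the outer c and may
    -- be bounded through any single one.
    have hbound : ∀ c : ℕ, 0 < c → μ.real {ω | ¬ ∃ c : ℕ, 0 < c ∧ ∀ i < T * c,
        (P ω ∩ Set.Ioc ((i : ℝ≥0) / c) (((i : ℝ≥0) + 1) / c) ×ˢ Set.univ).encard ≤ 1} ≤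
        T * (lam : ℝ) ^ 2 * (1 / c) := by
      intro c hc
      have hc' : (0 : ℝ) < c := by exact_mod_cast hc
      calc _ ≤ μ.real (⋃ i ∈ Finset.range (T * c), {ω | ¬ (P ω ∩
            Set.Ioc ((i : ℝ≥0) / c) (((i : ℝ≥0) + 1) / c) ×ˢ Set.univ).encard ≤ 1}) := by
            refine measureReal_mono (fun ω hω => ?_) (measure_ne_top _ _)
            by_contra hcon
            refine hω ⟨c, hc, fun i hi => ?_⟩
            by_contra hi'
            exact hcon (Set.mem_biUnion (Finset.mem_coe.2 (Finset.mem_range.2 hi)) hi')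
        _ ≤ ∑ i ∈ Finset.range (T * c), μ.real {ω | ¬ (P ω ∩
            Set.Ioc ((i : ℝ≥0) / c) (((i : ℝ≥0) + 1) / c) ×ˢ Set.univ).encard ≤ 1} :=
            measureReal_biUnion_finset_le _ _
        _ ≤ ∑ i ∈ Finset.range (T * c), ((lam : ℝ) / c) ^ 2 := by
            refine Finset.sum_le_sum fun i _ => ?_
            have hle : (i : ℝ≥0) / c ≤ ((i : ℝ≥0) + 1) / c := by gcongr; simp
            obtain ⟨h1, h2⟩ := toReal_poissonIntensity_Ioc lam ν hle Set.univ
            refine (h.measureReal_two_le_count (measurableSet_Ioc.prod MeasurableSet.univ)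
              h1).trans (le_of_eq ?_)
            rw [h2]
            simp only [NNReal.coe_div, NNReal.coe_add, NNReal.coe_natCast, NNReal.coe_one,
              probReal_univ, mul_one]
            congr 1
            field_simp
            ring
        _ = _ := by
            rw [Finset.sum_const, Finset.card_range, nsmul_eq_mul]
            push_cast
            field_simp
    rw [ae_iff, ← measureReal_eq_zero_iff]
    refine le_antisymm (ge_of_tendsto' (x := atTop) (f := fun c : ℕ =>
      T * (lam : ℝ) ^ 2 * (1 / ((c : ℝ) + 1))) ?_ fun c => ?_) measureReal_nonneg
    · simpa using tendsto_one_div_add_atTop_nhds_zero_nat.const_mul (T * (lam : ℝ) ^ 2)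
    · simpa using hbound (c + 1) (Nat.succ_pos c)
  filter_upwards [h0, ae_all_iff.2 h1] with ω hω0 hω1
  exact ⟨hω0, hω1⟩

end Intensity

/-! ### Replacing the point process by one that is simple everywhere -/

section Modification

variable {k : ℕ} {Ω : Type*}

theorem measurableSet_count {m : MeasurableSpace Ω} {E : Type*} {P : Ω → Set E} {A : Set E}
    (h : MeasurableSpace.comap (fun ω => (P ω ∩ A).encard) inferInstance ≤ m) (N : Set ℕ∞) :
    MeasurableSet[m] {ω | (P ω ∩ A).encard ∈ N} :=
  measurable_iff_comap_le.2 h (MeasurableSet.of_discrete (s := N))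

theorem comap_count_le_pointSigma {E : Type*} [MeasurableSpace E] (P : Ω → Set E) {A : Set E}
    (hA : MeasurableSet A) :
    MeasurableSpace.comap (fun ω => (P ω ∩ A).encard) inferInstance ≤ pointSigma P :=
  le_iSup (fun A : {A : Set E // MeasurableSet A} =>
    MeasurableSpace.comap (fun ω => (P ω ∩ A.1).encard) inferInstance) ⟨A, hA⟩

/-- Simplicity is phrased with countable quantifiers over counts of fixed sets precisely so that it
is an event of `pointSigma P`. -/
theorem measurableSet_isSimpleConfiguration (P : Ω → Set (ℝ≥0 × Mark k)) :
    MeasurableSet[pointSigma P] {ω | IsSimpleConfiguration (P ω)} := by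
  have e : {ω | IsSimpleConfiguration (P ω)} =
      {ω | (P ω ∩ {0} ×ˢ Set.univ).encard ∈ ({0} : Set ℕ∞)} ∩ ⋂ T : ℕ, ⋃ c : ℕ, ⋃ _ : 0 < c,
        ⋂ i : ℕ, ⋂ _ : i < T * c, {ω | (P ω ∩ Set.Ioc ((i : ℝ≥0) / c) (((i : ℝ≥0) + 1) / c) ×ˢ
          Set.univ).encard ∈ Set.Iic (1 : ℕ∞)} := by
    ext ω
    simp only [IsSimpleConfiguration, Set.mem_inter_iff, Set.mem_iInter, Set.mem_iUnion,
      Set.mem_ofPred_eq, Set.mem_singleton_iff, Set.mem_Iic, exists_prop]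
  rw [e]
  refine (measurableSet_count (comap_count_le_pointSigma P
    ((measurableSet_singleton _).prod MeasurableSet.univ)) _).inter ?_
  refine MeasurableSet.iInter fun T => MeasurableSet.iUnion fun c => MeasurableSet.iUnion fun _ =>
    MeasurableSet.iInter fun i => MeasurableSet.iInter fun _ => ?_
  exact measurableSet_count (comap_count_le_pointSigma P
    (measurableSet_Ioc.prod MeasurableSet.univ)) _

open Classical in
/-- The random configuration `P`, with the configurations which are not simple replaced by the
empty one. -/
noncomputable def simplify (P : Ω → Set (ℝ≥0 × Mark k)) (ω : Ω) : Set (ℝ≥0 × Mark k) :=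
  if IsSimpleConfiguration (P ω) then P ω else ∅

theorem isSimpleConfiguration_simplify (P : Ω → Set (ℝ≥0 × Mark k)) (ω : Ω) :
    IsSimpleConfiguration (simplify P ω) := by
  by_cases h : IsSimpleConfiguration (P ω)
  · rwa [simplify, if_pos h]
  · rw [simplify, if_neg h]
    exact ⟨by simp, fun T => ⟨1, one_pos, fun i _ => by simp⟩⟩

theorem measurable_count_simplify (P : Ω → Set (ℝ≥0 × Mark k)) {A : Set (ℝ≥0 × Mark k)}
    (hA : MeasurableSet A) :
    Measurable[pointSigma P] fun ω => (simplify P ω ∩ A).encard := by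
  classical
  have : (fun ω => (simplify P ω ∩ A).encard) =
      fun ω => if IsSimpleConfiguration (P ω) then (P ω ∩ A).encard else 0 := by
    funext ω
    by_cases h : IsSimpleConfiguration (P ω) <;> simp [simplify, h]
  rw [this]
  exact Measurable.ite (measurableSet_isSimpleConfiguration P)
    (measurable_iff_comap_le.2 (comap_count_le_pointSigma P hA))
    (@measurable_const _ _ _ (pointSigma P) _)

theorem pointSigma_simplify_le (P : Ω → Set (ℝ≥0 × Mark k)) :
    pointSigma (simplify P) ≤ pointSigma P :=
  iSup_le fun A => measurable_iff_comap_le.1 (measurable_count_simplify P A.2)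

theorem IsPoissonPointProcess.pointSigma_le {E : Type*} [MeasurableSpace E] [MeasurableSpace Ω]
    {μ : Measure Ω} {P : Ω → Set E} {Λ : Measure E} (h : IsPoissonPointProcess μ P Λ) :
    pointSigma P ≤ (inferInstance : MeasurableSpace Ω) :=
  iSup_le fun A => (h.measurable_count A.1 A.2).comap_le

variable [MeasurableSpace Ω] {μ : Measure Ω} [IsProbabilityMeasure μ] {lam : ℝ≥0}
  {ν : Measure (RankedSimplex k)} [IsProbabilityMeasure ν] {π : Ω → KPartition k ℕ}
  {P : Ω → Set (ℝ≥0 × Mark k)} {σ : ℕ → Ω → Fin k → Equiv.Perm (Fin k)}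

theorem ae_simplify_eq (h : IsPoissonPointProcess μ P (poissonIntensity lam ν)) :
    ∀ᵐ ω ∂μ, simplify P ω = P ω := by
  filter_upwards [ae_isSimpleConfiguration h] with ω hω
  rw [simplify, if_pos hω]

/-- The modification changes P on a null set, so the laws persist. It is a function of the counts of
P, so the generated σ-algebra does not grow and independence of π and σ persists too. -/
theorem isPoissonianInput_simplify (h : IsPoissonianInput μ lam ν π P σ) :
    IsPoissonianInput μ lam ν π (simplify P) σ where
  measurable_init := h.measurable_init
  poisson :=
    { measurable_count := fun A hA =>
        (measurable_count_simplify P hA).mono h.poisson.pointSigma_le le_rfl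
      law_count := fun A hA hΛ => by
        rw [← h.poisson.law_count A hA hΛ]
        refine Measure.map_congr ?_
        filter_upwards [ae_simplify_eq h.poisson] with ω hω
        rw [hω]
      indep_count := fun A hA hd => by
        refine (h.poisson.indep_count A hA hd).congr fun i => ?_
        filter_upwards [ae_simplify_eq h.poisson] with ω hω
        rw [hω] }
  measurable_perm := h.measurable_perm
  uniform_perm := h.uniform_perm
  iIndep_perm := h.iIndep_perm
  indep_perm := indep_of_indep_of_le_right h.indep_perm (pointSigma_simplify_le P)
  indep_init := indep_of_indep_of_le_right h.indep_init
    (sup_le_sup_left (pointSigma_simplify_le P) _)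

end Modification

/-! ### Regrouping independent σ-algebras -/

section IndepSup

variable {Ω : Type*} {mΩ : MeasurableSpace Ω} {μ : Measure Ω} [IsProbabilityMeasure μ]

theorem sup_eq_generateFrom_inter (a c : MeasurableSpace Ω) :
    a ⊔ c = MeasurableSpace.generateFrom
      {u | ∃ s t, MeasurableSet[a] s ∧ MeasurableSet[c] t ∧ u = s ∩ t} := by
  refine le_antisymm (sup_le ?_ ?_) (MeasurableSpace.generateFrom_le ?_)
  · exact fun s hs => MeasurableSpace.measurableSet_generateFrom
      ⟨s, Set.univ, hs, MeasurableSet.univ, (Set.inter_univ s).symm⟩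
  · exact fun s hs => MeasurableSpace.measurableSet_generateFrom
      ⟨Set.univ, s, MeasurableSet.univ, hs, (Set.univ_inter s).symm⟩
  · rintro _ ⟨s, t, hs, ht, rfl⟩
    exact MeasurableSet.inter (le_sup_left (a := a) _ hs) (le_sup_right (a := a) _ ht)

theorem isPiSystem_inter (a c : MeasurableSpace Ω) :
    IsPiSystem {u | ∃ s t, MeasurableSet[a] s ∧ MeasurableSet[c] t ∧ u = s ∩ t} := by
  rintro _ ⟨s, t, hs, ht, rfl⟩ _ ⟨s', t', hs', ht', rfl⟩ -
  exact ⟨s ∩ s', t ∩ t', MeasurableSet.inter hs hs', MeasurableSet.inter ht ht',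
    Set.inter_inter_inter_comm _ _ _ _⟩

/-- Intersections of events from the two σ-algebras form a generating π-system. On these the
probability of a fourfold intersection splits into four factors, which may be regrouped. -/
theorem indep_sup_sup {a b c d : MeasurableSpace Ω} (ha : a ≤ mΩ) (hb : b ≤ mΩ) (hc : c ≤ mΩ)
    (hd : d ≤ mΩ) (hab : Indep a b μ) (hcd : Indep c d μ) (h : Indep (a ⊔ b) (c ⊔ d) μ) :
    Indep (a ⊔ c) (b ⊔ d) μ := by
  refine IndepSets.indep (sup_le ha hc) (sup_le hb hd) (isPiSystem_inter a c)
    (isPiSystem_inter b d) (sup_eq_generateFrom_inter a c) (sup_eq_generateFrom_inter b d) ?_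
  rw [IndepSets_iff]
  rintro _ _ ⟨s, t, hs, ht, rfl⟩ ⟨s', t', hs', ht', rfl⟩
  rw [Indep_iff] at hab hcd h
  have ls : ∀ s, MeasurableSet[a] s → MeasurableSet[a ⊔ b] s := le_sup_left (a := a)
  have ls' : ∀ s, MeasurableSet[b] s → MeasurableSet[a ⊔ b] s := le_sup_right (a := a)
  have lt : ∀ s, MeasurableSet[c] s → MeasurableSet[c ⊔ d] s := le_sup_left (a := c)
  have lt' : ∀ s, MeasurableSet[d] s → MeasurableSet[c ⊔ d] s := le_sup_right (a := c)
  rw [Set.inter_inter_inter_comm, h _ _ (MeasurableSet.inter (ls _ hs) (ls' _ hs'))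
    (MeasurableSet.inter (lt _ ht) (lt' _ ht')), hab _ _ hs hs', hcd _ _ ht ht',
    h _ _ (ls _ hs) (lt _ ht), h _ _ (ls' _ hs') (lt' _ ht')]
  ring

end IndepSup

/-! ### Past and future of the random input -/

section PastInput

variable {k n : ℕ} {Ω : Type*} (π : Ω → KPartition k ℕ) (P : Ω → Set (ℝ≥0 × Mark k))
  (σ : ℕ → Ω → Fin k → Equiv.Perm (Fin k))

/-- The `σ`-algebra generated by the point counts up to time `r`. -/
@[reducible] noncomputable def pastSigma (r : ℝ≥0) : MeasurableSpace Ω :=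
  ⨆ B : {B : Set (ℝ≥0 × Mark k) // MeasurableSet B ∧ B ⊆ Set.Iic r ×ˢ Set.univ},
    MeasurableSpace.comap (fun ω => (P ω ∩ B.1).encard) inferInstance

/-- The `σ`-algebra generated by the permutations attached to the first `m` atoms. -/
@[reducible] def permSigma (m : ℕ) : MeasurableSpace Ω :=
  ⨆ i ∈ Set.Iio m, MeasurableSpace.comap (σ i) inferInstance

/-- The `σ`-algebra generated by the point counts of two sets. -/
@[reducible] noncomputable def futureSigma (A : Bool → Set (ℝ≥0 × Mark k)) : MeasurableSpace Ω :=
  ⨆ i, MeasurableSpace.comap (fun ω => (P ω ∩ A i).encard) inferInstance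

/-- The input of the construction up to time `r`, if there are `m` atoms up to this time. -/
@[reducible] noncomputable def pastInput (r : ℝ≥0) (m : ℕ) : MeasurableSpace Ω :=
  MeasurableSpace.comap π inferInstance ⊔ (pastSigma P r ⊔ permSigma σ m)

variable {P} in
theorem measurableSet_pastSigma {r : ℝ≥0} {B : Set (ℝ≥0 × Mark k)} (hB : MeasurableSet B)
    (hBr : B ⊆ Set.Iic r ×ˢ Set.univ) (N : Set ℕ∞) :
    MeasurableSet[pastSigma P r] {ω | (P ω ∩ B).encard ∈ N} :=
  measurableSet_count (le_iSup (fun B : {B : Set (ℝ≥0 × Mark k) // MeasurableSet B ∧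
    B ⊆ Set.Iic r ×ˢ Set.univ} =>
      MeasurableSpace.comap (fun ω => (P ω ∩ B.1).encard) inferInstance) ⟨B, hB, hBr⟩) N

theorem atomsUpTo_eq_toNat (p : Set (ℝ≥0 × Mark k)) (r : ℝ≥0) :
    atomsUpTo p r = (p ∩ Set.Iic r ×ˢ Set.univ).encard.toNat := by
  rw [atomsUpTo, Set.ncard_def]
  congr 2
  ext a
  simp

theorem measurableSet_atomsUpTo (r : ℝ≥0) (N : Set ℕ) :
    MeasurableSet[pastSigma P r] {ω | atomsUpTo (P ω) r ∈ N} := by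
  simp only [atomsUpTo_eq_toNat]
  exact measurableSet_pastSigma (measurableSet_Iic.prod MeasurableSet.univ) le_rfl
    (ENat.toNat ⁻¹' N)

theorem pastSigma_le_pastInput (r : ℝ≥0) (m : ℕ) : pastSigma P r ≤ pastInput π P σ r m :=
  le_sup_left.trans le_sup_right

theorem pastInput_mono {r t : ℝ≥0} (hrt : r ≤ t) {m m' : ℕ} (hm : m ≤ m') :
    pastInput π P σ r m ≤ pastInput π P σ t m' := by
  refine sup_le_sup_left (sup_le_sup (iSup_le fun B => ?_) ?_) _
  · exact le_iSup (fun B : {B : Set (ℝ≥0 × Mark k) // MeasurableSet B ∧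
      B ⊆ Set.Iic t ×ˢ Set.univ} =>
        MeasurableSpace.comap (fun ω => (P ω ∩ B.1).encard) inferInstance)
        ⟨B.1, B.2.1, B.2.2.trans (Set.prod_mono (Set.Iic_subset_Iic.2 hrt) le_rfl)⟩
  · exact biSup_mono fun i hi => lt_of_lt_of_le hi hm

/-- The events which are determined by the input of the construction up to time `r`. -/
@[reducible] noncomputable def adaptedSigma (r : ℝ≥0) : MeasurableSpace Ω where
  -- The number of permutations used by time r is random. On the event of m atoms only the
  -- permutations with index below m may enter, which leaves the one with index m fresh for the next
  -- atom.
  MeasurableSet' G := ∀ m, MeasurableSet[pastInput π P σ r m] (G ∩ {ω | atomsUpTo (P ω) r = m})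
  measurableSet_empty m := by
    rw [Set.empty_inter]
    exact @MeasurableSet.empty _ (pastInput π P σ r m)
  measurableSet_compl G hG m := by
    have : Gᶜ ∩ {ω | atomsUpTo (P ω) r = m} =
        {ω | atomsUpTo (P ω) r ∈ ({m} : Set ℕ)} \ (G ∩ {ω | atomsUpTo (P ω) r = m}) := by
      ext ω
      simp only [Set.mem_inter_iff, Set.mem_compl_iff, Set.mem_ofPred_eq, Set.mem_singleton_iff,
        Set.mem_sdiff]
      tauto
    rw [this]
    exact MeasurableSet.diff (pastSigma_le_pastInput π P σ r m _
      (measurableSet_atomsUpTo P r {m})) (hG m)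
  measurableSet_iUnion G hG m := by
    rw [Set.iUnion_inter]
    exact MeasurableSet.iUnion fun i => hG i m

theorem pastSigma_le_adaptedSigma (r : ℝ≥0) : pastSigma P r ≤ adaptedSigma π P σ r := by
  intro G hG m
  exact MeasurableSet.inter (pastSigma_le_pastInput π P σ r m _ hG)
    (pastSigma_le_pastInput π P σ r m _ (measurableSet_atomsUpTo P r {m}))

variable {P} in
theorem atomsUpTo_mono (hs : ∀ ω, IsSimpleConfiguration (P ω)) {r t : ℝ≥0} (hrt : r ≤ t)
    (ω : Ω) : atomsUpTo (P ω) r ≤ atomsUpTo (P ω) t :=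
  Set.ncard_le_ncard (fun _ ha => ⟨ha.1, ha.2.trans hrt⟩) ((hs ω).finite t)

variable {P} in
-- On the event of m atoms up to t there are some l ≤ m atoms up to r, and the input with l
-- permutations is contained in the input with m.
theorem adaptedSigma_mono (hs : ∀ ω, IsSimpleConfiguration (P ω)) {r t : ℝ≥0} (hrt : r ≤ t) :
    adaptedSigma π P σ r ≤ adaptedSigma π P σ t := by
  intro G hG m
  have : G ∩ {ω | atomsUpTo (P ω) t = m} = (⋃ l ≤ m, G ∩ {ω | atomsUpTo (P ω) r = l}) ∩
      {ω | atomsUpTo (P ω) t = m} := by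
    ext ω
    simp only [Set.mem_inter_iff, Set.mem_iUnion, Set.mem_ofPred_eq, exists_prop]
    constructor
    · rintro ⟨h, h'⟩
      exact ⟨⟨_, h' ▸ atomsUpTo_mono hs hrt ω, h, rfl⟩, h'⟩
    · rintro ⟨⟨l, -, h, -⟩, h'⟩
      exact ⟨h, h'⟩
  rw [this]
  refine MeasurableSet.inter ?_ (pastSigma_le_pastInput π P σ t m _
    (measurableSet_atomsUpTo P t {m}))
  exact MeasurableSet.iUnion fun l => MeasurableSet.iUnion fun hl =>
    pastInput_mono π P σ hrt hl _ (hG l)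

/-- The permutations attached to the first atom after time `r` are known at time `t`
if there is an atom in between. -/
theorem measurableSet_adaptedSigma_perm {r t : ℝ≥0} (hrt : r ≤ t) {G : Set Ω}
    (hG : MeasurableSet[adaptedSigma π P σ r] G) (τ : Fin k → Equiv.Perm (Fin k)) :
    MeasurableSet[adaptedSigma π P σ t] (G ∩ {ω | atomsUpTo (P ω) r < atomsUpTo (P ω) t} ∩
      {ω | σ (atomsUpTo (P ω) r) ω = τ}) := by
  intro m
  have : G ∩ {ω | atomsUpTo (P ω) r < atomsUpTo (P ω) t} ∩
      {ω | σ (atomsUpTo (P ω) r) ω = τ} ∩ {ω | atomsUpTo (P ω) t = m} =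
      (⋃ l < m, G ∩ {ω | atomsUpTo (P ω) r = l} ∩ σ l ⁻¹' {τ}) ∩
        {ω | atomsUpTo (P ω) t = m} := by
    ext ω
    simp only [Set.mem_inter_iff, Set.mem_iUnion, Set.mem_ofPred_eq, exists_prop,
      Set.mem_preimage, Set.mem_singleton_iff]
    constructor
    · rintro ⟨⟨⟨h1, h2⟩, h3⟩, h4⟩
      exact ⟨⟨_, h4 ▸ h2, ⟨h1, rfl⟩, h3⟩, h4⟩
    · rintro ⟨⟨l, h1, ⟨h2, rfl⟩, h3⟩, h4⟩
      exact ⟨⟨⟨h2, h4 ▸ h1⟩, h3⟩, h4⟩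
  rw [this]
  refine MeasurableSet.inter ?_ (pastSigma_le_pastInput π P σ t m _
    (measurableSet_atomsUpTo P t {m}))
  refine MeasurableSet.iUnion fun l => MeasurableSet.iUnion fun hl => MeasurableSet.inter
    (pastInput_mono π P σ hrt hl.le _ (hG l)) ?_
  have h1 : MeasurableSpace.comap (σ l) inferInstance ≤ pastInput π P σ t m :=
    (le_iSup₂_of_le (f := fun i (_ : i ∈ Set.Iio m) =>
      MeasurableSpace.comap (σ i) inferInstance) l hl le_rfl).trans
      (le_sup_right.trans le_sup_right)
  exact h1 _ ⟨{τ}, MeasurableSet.of_discrete, rfl⟩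

variable [MeasurableSpace Ω] {μ : Measure Ω} {lam : ℝ≥0} {ν : Measure (RankedSimplex k)} {π P σ}

theorem IsPoissonianInput.pastSigma_le (hin : IsPoissonianInput μ lam ν π P σ) (r : ℝ≥0) :
    pastSigma P r ≤ (inferInstance : MeasurableSpace Ω) :=
  iSup_le fun B => (hin.poisson.measurable_count B.1 B.2.1).comap_le

theorem IsPoissonianInput.permSigma_le (hin : IsPoissonianInput μ lam ν π P σ) (m : ℕ) :
    permSigma σ m ≤ (inferInstance : MeasurableSpace Ω) :=
  iSup₂_le fun i _ => (hin.measurable_perm i).comap_le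

theorem IsPoissonianInput.pastInput_le (hin : IsPoissonianInput μ lam ν π P σ) (r : ℝ≥0)
    (m : ℕ) : pastInput π P σ r m ≤ (inferInstance : MeasurableSpace Ω) :=
  sup_le hin.measurable_init.comap_le (sup_le (hin.pastSigma_le r) (hin.permSigma_le m))

theorem IsPoissonianInput.adaptedSigma_le (hin : IsPoissonianInput μ lam ν π P σ) (r : ℝ≥0) :
    adaptedSigma π P σ r ≤ (inferInstance : MeasurableSpace Ω) := by
  intro G hG
  have : G = ⋃ m, G ∩ {ω | atomsUpTo (P ω) r = m} := by
    ext ω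
    simp
  rw [this]
  exact MeasurableSet.iUnion fun m => hin.pastInput_le r m _ (hG m)

theorem IsPoissonianInput.indep_permSigma [IsProbabilityMeasure μ]
    (hin : IsPoissonianInput μ lam ν π P σ) (m : ℕ) :
    Indep (permSigma σ m) (MeasurableSpace.comap (σ m) inferInstance) μ := by
  have h := hin.iIndep_perm
  rw [iIndepFun_iff_iIndep] at h
  have hsum : Indep (⨆ q ∈ {q : ℕ × Fin k | q.1 < m},
      MeasurableSpace.comap (fun ω => σ q.1 ω q.2) ⊤) (⨆ q ∈ {q : ℕ × Fin k | q.1 = m},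
      MeasurableSpace.comap (fun ω => σ q.1 ω q.2) ⊤) μ := indep_iSup_of_disjoint
    (fun q : ℕ × Fin k => Measurable.comap_le (measurable_pi_iff.1 (hin.measurable_perm q.1) q.2)) h
    (S := {q | q.1 < m}) (T := {q | q.1 = m})
    (Set.disjoint_left.2 fun q hq hq' => (lt_irrefl m (hq' ▸ hq : m < m)))
  have hpi : ∀ i, MeasurableSpace.comap (σ i) inferInstance =
      ⨆ j, MeasurableSpace.comap (fun ω => σ i ω j) ⊤ := by
    intro i
    change MeasurableSpace.comap (σ i) (⨆ j, MeasurableSpace.comap _ _) = _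
    rw [MeasurableSpace.comap_iSup]
    refine iSup_congr fun j => ?_
    rw [MeasurableSpace.comap_comp]
    rfl
  refine indep_of_indep_of_le_left (indep_of_indep_of_le_right hsum ?_) ?_
  · rw [hpi]
    exact iSup_le fun j => le_biSup (fun q : ℕ × Fin k =>
      MeasurableSpace.comap (fun ω => σ q.1 ω q.2) ⊤) (i := (m, j)) rfl
  · refine iSup₂_le fun i hi => ?_
    rw [hpi]
    exact iSup_le fun j => le_biSup (fun q : ℕ × Fin k =>
      MeasurableSpace.comap (fun ω => σ q.1 ω q.2) ⊤) (i := (i, j)) hi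

theorem IsPoissonianInput.measure_perm_eq (hin : IsPoissonianInput μ lam ν π P σ) (m : ℕ)
    (τ : Fin k → Equiv.Perm (Fin k)) :
    μ {ω | σ m ω = τ} = ((k.factorial : ℝ≥0∞)⁻¹) ^ k := by
  have h := hin.iIndep_perm.precomp (g := fun j : Fin k => (m, j)) fun _ _ h =>
    congrArg Prod.snd h
  have h1 := h.meas_iInter (s := fun j => {ω | σ m ω j = τ j})
    fun j => ⟨{τ j}, MeasurableSet.of_discrete, rfl⟩
  have h2 : {ω | σ m ω = τ} = ⋂ j, {ω | σ m ω j = τ j} := by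
    ext ω
    simp [funext_iff]
  rw [h2, h1]
  simp [hin.uniform_perm]

/-- The past up to time `r` is independent of the future atoms and the next permutations. -/
theorem IsPoissonianInput.indep_pastInput [IsProbabilityMeasure μ]
    (hin : IsPoissonianInput μ lam ν π P σ) (r : ℝ≥0)
    (m : ℕ) {A : Bool → Set (ℝ≥0 × Mark k)} (hA : ∀ i, MeasurableSet (A i))
    (hd : Disjoint (A true) (A false)) (hAr : ∀ i, A i ⊆ Set.Ioi r ×ˢ Set.univ) :
    Indep (pastInput π P σ r m)
      (futureSigma P A ⊔
        MeasurableSpace.comap (σ m) inferInstance) μ ∧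
    Indep (futureSigma P A)
      (MeasurableSpace.comap (σ m) inferInstance) μ := by
  have l₄ : futureSigma P A ≤ pointSigma P := iSup_le fun i => comap_count_le_pointSigma P (hA i)
  have l₂ : pastSigma P r ≤ pointSigma P :=
    iSup_le fun B => comap_count_le_pointSigma P B.2.1
  have l₅ : MeasurableSpace.comap (σ m) inferInstance ≤
      ⨆ m, MeasurableSpace.comap (σ m) inferInstance :=
    le_iSup (fun m => MeasurableSpace.comap (σ m) inferInstance) m
  have l₃ : permSigma σ m ≤ ⨆ m, MeasurableSpace.comap (σ m) inferInstance :=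
    iSup₂_le fun i _ => le_iSup (fun m => MeasurableSpace.comap (σ m) inferInstance) i
  have hP := hin.poisson.pointSigma_le
  have hσ := (hin.measurable_perm m).comap_le
  have h24 : Indep (pastSigma P r) (futureSigma P A) μ :=
    hin.poisson.indep_counts (measurableSet_Iic.prod MeasurableSet.univ) hA hd
      fun i => Set.disjoint_left.2 fun e he he' => lt_irrefl r
        (lt_of_lt_of_le (Set.mem_Ioi.1 (hAr i he').1) (Set.mem_Iic.1 he.1))
  have h1 : Indep (pastSigma P r ⊔ permSigma σ m)
      (futureSigma P A ⊔ MeasurableSpace.comap (σ m) inferInstance) μ := by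
    refine indep_sup_sup (l₂.trans hP) (l₄.trans hP) (hin.permSigma_le m) hσ h24
      (hin.indep_permSigma m) ?_
    exact indep_of_indep_of_le_left (indep_of_indep_of_le_right hin.indep_perm.symm
      (sup_le l₃ l₅)) (sup_le l₂ l₄)
  refine ⟨?_, indep_of_indep_of_le_left (indep_of_indep_of_le_right hin.indep_perm.symm l₅) l₄⟩
  -- The initial state is adjoined to the past by regrouping, with the trivial σ-algebra as its
  -- partner on the future side.
  have h2 := indep_sup_sup (μ := μ) hin.measurable_init.comap_le (bot_le (a := ‹MeasurableSpace Ω›))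
    (sup_le (hin.pastSigma_le r) (hin.permSigma_le m)) (sup_le (l₄.trans hP) hσ)
    (indep_bot_right _) h1 ?_
  · rwa [bot_sup_eq] at h2
  · rw [sup_bot_eq]
    refine indep_of_indep_of_le_right hin.indep_init (sup_le (sup_le ?_ ?_) (sup_le ?_ ?_))
    · exact l₂.trans le_sup_right
    · exact l₃.trans le_sup_left
    · exact l₄.trans le_sup_right
    · exact l₅.trans le_sup_left

theorem measure_eq_tsum_atomsUpTo (hin : IsPoissonianInput μ lam ν π P σ) (r : ℝ≥0) {G : Set Ω}
    (hG : MeasurableSet G) : μ G = ∑' m : ℕ, μ (G ∩ {ω | atomsUpTo (P ω) r = m}) := by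
  have : G = ⋃ m, G ∩ {ω | atomsUpTo (P ω) r = m} := by
    ext ω
    simp
  conv_lhs => rw [this]
  refine measure_iUnion (fun m m' hm => Set.disjoint_left.2 fun ω h h' => hm ?_) fun m =>
    hG.inter (hin.pastSigma_le r _ (measurableSet_atomsUpTo P r {m}))
  exact h.2.symm.trans h'.2

/-- The index of the next permutation is random, but on the event of m atoms up to r it is m. There
the past, the future counts and `σ m` are independent, and the product formulas are summed over m.
-/
theorem IsPoissonianInput.measure_inter_future [IsProbabilityMeasure μ]
    (hin : IsPoissonianInput μ lam ν π P σ) {r : ℝ≥0}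
    {A : Bool → Set (ℝ≥0 × Mark k)} (hA : ∀ i, MeasurableSet (A i))
    (hd : Disjoint (A true) (A false)) (hAr : ∀ i, A i ⊆ Set.Ioi r ×ˢ Set.univ)
    {G : Set Ω} (hG : MeasurableSet[adaptedSigma π P σ r] G) {V : Set Ω}
    (hV : MeasurableSet[futureSigma P A] V) :
    μ (G ∩ V) = μ G * μ V ∧
    ∀ τ, μ (G ∩ V ∩ {ω | σ (atomsUpTo (P ω) r) ω = τ}) =
      μ G * (μ V * ((k.factorial : ℝ≥0∞)⁻¹) ^ k) := by
  have hG' := hin.adaptedSigma_le r _ hG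
  have hV' : MeasurableSet V :=
    (iSup_le fun i => (hin.poisson.measurable_count _ (hA i)).comap_le : futureSigma P A ≤ _) _ hV
  constructor
  · rw [measure_eq_tsum_atomsUpTo hin r (hG'.inter hV'), measure_eq_tsum_atomsUpTo hin r hG',
      ← ENNReal.tsum_mul_right]
    refine tsum_congr fun m => ?_
    rw [Set.inter_right_comm]
    exact (Indep_iff _ _ _).1 (hin.indep_pastInput r m hA hd hAr).1 _ _ (hG m)
      (le_sup_left (a := futureSigma P A)
        _ hV)
  · intro τ
    have hτ : MeasurableSet {ω | σ (atomsUpTo (P ω) r) ω = τ} := by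
      have : {ω | σ (atomsUpTo (P ω) r) ω = τ} =
          ⋃ m, {ω | atomsUpTo (P ω) r ∈ ({m} : Set ℕ)} ∩ σ m ⁻¹' {τ} := by
        ext ω
        simp
      rw [this]
      exact MeasurableSet.iUnion fun m =>
        (hin.pastSigma_le r _ (measurableSet_atomsUpTo P r {m})).inter
          (hin.measurable_perm m MeasurableSet.of_discrete)
    rw [measure_eq_tsum_atomsUpTo hin r ((hG'.inter hV').inter hτ),
      measure_eq_tsum_atomsUpTo hin r hG', ← ENNReal.tsum_mul_right]
    refine tsum_congr fun m => ?_
    have e : G ∩ V ∩ {ω | σ (atomsUpTo (P ω) r) ω = τ} ∩ {ω | atomsUpTo (P ω) r = m} =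
        (G ∩ {ω | atomsUpTo (P ω) r = m}) ∩ (V ∩ {ω | σ m ω = τ}) := by
      ext ω
      simp only [Set.mem_inter_iff, Set.mem_ofPred_eq]
      constructor
      · rintro ⟨⟨⟨h1, h2⟩, h3⟩, rfl⟩
        exact ⟨⟨h1, rfl⟩, h2, h3⟩
      · rintro ⟨⟨h1, rfl⟩, h2, h3⟩
        exact ⟨⟨⟨h1, h2⟩, h3⟩, rfl⟩
    obtain ⟨i1, i2⟩ := hin.indep_pastInput r m hA hd hAr
    have hτm : MeasurableSet[MeasurableSpace.comap (σ m) inferInstance] {ω | σ m ω = τ} :=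
      ⟨{τ}, MeasurableSet.of_discrete, rfl⟩
    rw [e, (Indep_iff _ _ _).1 i1 _ _ (hG m) (MeasurableSet.inter
      (le_sup_left (a := futureSigma P A)
        _ hV) (le_sup_right (b := MeasurableSpace.comap (σ m) inferInstance) _ hτm)),
      (Indep_iff _ _ _).1 i2 _ _ hV hτm, hin.measure_perm_eq]

end PastInput

/-! ### Adaptedness of the constructed path -/

section Step

variable {k n : ℕ} {Ω : Type*} {π : Ω → KPartition k ℕ} {P : Ω → Set (ℝ≥0 × Mark k)}
  {σ : ℕ → Ω → Fin k → Equiv.Perm (Fin k)}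

/-- The restriction to `[n]` of the constructed process. -/
noncomputable def restrictedPath (π : Ω → KPartition k ℕ) (P : Ω → Set (ℝ≥0 × Mark k))
    (σ : ℕ → Ω → Fin k → Equiv.Perm (Fin k)) (n : ℕ) (t : ℝ≥0) (ω : Ω) : KPartition k (Fin n) :=
  (constructedPath (π ω) (fun m => σ m ω) (P ω) t).restrict n

/-- The only atom in the time interval `(r, t]` has its mark in `D`. -/
def uniqueAtom (P : Ω → Set (ℝ≥0 × Mark k)) (r t : ℝ≥0) (D : Set (Mark k)) : Set Ω :=
  {ω | (P ω ∩ Set.Ioc r t ×ˢ D).encard = 1} ∩ {ω | (P ω ∩ Set.Ioc r t ×ˢ Dᶜ).encard = 0}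

theorem restrictedPath_of_count_eq_zero {r t : ℝ≥0} (hrt : r ≤ t) {ω : Ω}
    (h : (P ω ∩ Set.Ioc r t ×ˢ Set.univ).encard = 0) :
    restrictedPath π P σ n t ω = restrictedPath π P σ n r ω := by
  rw [restrictedPath, constructedPath_of_no_atom _ _ hrt fun a ha har => ?_, restrictedPath]
  exact Set.eq_empty_iff_forall_notMem.1 (Set.encard_eq_zero.1 h) a ⟨ha, har, trivial⟩

theorem exists_atom_of_count_eq_one (hs : ∀ ω, IsSimpleConfiguration (P ω)) {r t : ℝ≥0} {ω : Ω}
    (h : (P ω ∩ Set.Ioc r t ×ˢ Set.univ).encard = 1) :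
    ∃ C, (∃ s, P ω ∩ Set.Ioc r t ×ˢ Set.univ = {(s, C)}) ∧
      restrictedPath π P σ n t ω =
        update (restrictedPath π P σ n r ω) C (σ (atomsUpTo (P ω) r) ω) ∧
      atomsUpTo (P ω) r < atomsUpTo (P ω) t := by
  obtain ⟨⟨s, C⟩, h1⟩ := Set.encard_eq_one.1 h
  have hmem : (s, C) ∈ P ω ∩ Set.Ioc r t ×ˢ Set.univ := h1 ▸ Set.mem_singleton _
  have hu : ∀ a ∈ P ω, a.1 ∈ Set.Ioc r t → a = (s, C) := fun a ha har =>
    Set.mem_singleton_iff.1 (h1 ▸ (⟨ha, har, trivial⟩ : a ∈ P ω ∩ Set.Ioc r t ×ˢ Set.univ))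
  refine ⟨C, ⟨s, h1⟩, ?_, ?_⟩
  · rw [restrictedPath, constructedPath_of_one_atom _ _ (hs ω) hmem.2.1 hmem.1 hu,
      restrict_updateNat, restrictedPath]
  · rw [((hs ω).atomsUpTo_eq_of_forall_eq hmem.2.1 hmem.1 hu).2]
    exact Nat.lt_succ_self _

theorem mem_uniqueAtom_iff {r t : ℝ≥0} {D : Set (Mark k)} {ω : Ω} :
    ω ∈ uniqueAtom P r t D ↔
      ∃ s, ∃ C ∈ D, P ω ∩ Set.Ioc r t ×ˢ Set.univ = {(s, C)} := by
  have hun : P ω ∩ Set.Ioc r t ×ˢ Set.univ =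
      (P ω ∩ Set.Ioc r t ×ˢ D) ∪ (P ω ∩ Set.Ioc r t ×ˢ Dᶜ) := by
    rw [← Set.inter_union_distrib_left, ← Set.prod_union, Set.union_compl_self]
  constructor
  · rintro ⟨h1, h2⟩
    obtain ⟨⟨s, C⟩, h1⟩ := Set.encard_eq_one.1 h1
    have hC : (s, C) ∈ P ω ∩ Set.Ioc r t ×ˢ D := h1 ▸ Set.mem_singleton _
    refine ⟨s, C, hC.2.2, ?_⟩
    rw [hun, h1, Set.encard_eq_zero.1 h2, Set.union_empty]
  · rintro ⟨s, C, hC, h⟩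
    have hsC : (s, C) ∈ P ω ∩ Set.Ioc r t ×ˢ Set.univ := h ▸ Set.mem_singleton _
    have hall : ∀ a ∈ P ω, a.1 ∈ Set.Ioc r t → a = (s, C) := fun a ha har =>
      Set.mem_singleton_iff.1 (h ▸ (⟨ha, har, trivial⟩ : a ∈ P ω ∩ Set.Ioc r t ×ˢ Set.univ))
    constructor
    · refine Set.encard_eq_one.2 ⟨(s, C), Set.eq_singleton_iff_unique_mem.2
        ⟨⟨hsC.1, hsC.2.1, hC⟩, fun a ha => hall a ha.1 ha.2.1⟩⟩
    · refine Set.encard_eq_zero.2 (Set.eq_empty_iff_forall_notMem.2 fun a ha => ha.2.2 ?_)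
      rw [hall a ha.1 ha.2.1]
      exact hC

/-- With a single atom in (r, t], the state at t is a function of the state at r, the next
permutations and the mark. Fixing the first two turns the event into a condition that the mark lies
in a deterministic set, to which the Poisson law applies. -/
theorem restrictedPath_eq_inter_count_eq_one (hs : ∀ ω, IsSimpleConfiguration (P ω)) (r t : ℝ≥0)
    (y : KPartition k (Fin n)) :
    {ω | restrictedPath π P σ n t ω = y} ∩
        {ω | (P ω ∩ Set.Ioc r t ×ˢ Set.univ).encard = 1} =
      ⋃ q : KPartition k (Fin n) × (Fin k → Equiv.Perm (Fin k)),
        {ω | restrictedPath π P σ n r ω = q.1} ∩ uniqueAtom P r t {C | update q.1 C q.2 = y} ∩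
          {ω | σ (atomsUpTo (P ω) r) ω = q.2} := by
  ext ω
  simp only [Set.mem_inter_iff, Set.mem_ofPred_eq, Set.mem_iUnion, mem_uniqueAtom_iff]
  constructor
  · rintro ⟨rfl, h⟩
    obtain ⟨C, ⟨s, hsC⟩, h1, -⟩ := exists_atom_of_count_eq_one (π := π) (σ := σ) (n := n) hs h
    exact ⟨(_, _), ⟨rfl, s, C, h1.symm, hsC⟩, rfl⟩
  · rintro ⟨⟨x, τ⟩, ⟨rfl, s, C, hC, h⟩, rfl⟩
    have h1 : (P ω ∩ Set.Ioc r t ×ˢ Set.univ).encard = 1 := by rw [h, Set.encard_singleton]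
    obtain ⟨C', ⟨s', hsC⟩, h2, -⟩ := exists_atom_of_count_eq_one (π := π) (σ := σ) (n := n) hs h1
    have : (s, C) = (s', C') := Set.singleton_eq_singleton_iff.1 (h.symm.trans hsC)
    obtain ⟨rfl, rfl⟩ := Prod.mk.inj this
    exact ⟨h2.trans hC, h1⟩

theorem lt_of_mem_uniqueAtom (hs : ∀ ω, IsSimpleConfiguration (P ω)) {r t : ℝ≥0}
    {D : Set (Mark k)} {ω : Ω} (h : ω ∈ uniqueAtom P r t D) :
    atomsUpTo (P ω) r < atomsUpTo (P ω) t := by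
  obtain ⟨s, C, -, h⟩ := mem_uniqueAtom_iff.1 h
  have h1 : (P ω ∩ Set.Ioc r t ×ˢ Set.univ).encard = 1 := by rw [h, Set.encard_singleton]
  have hmem : (s, C) ∈ P ω ∩ Set.Ioc r t ×ˢ Set.univ := h ▸ Set.mem_singleton _
  rw [((hs ω).atomsUpTo_eq_of_forall_eq hmem.2.1 hmem.1 fun a ha har =>
    Set.mem_singleton_iff.1 (h ▸ (⟨ha, har, trivial⟩ : a ∈ P ω ∩ Set.Ioc r t ×ˢ Set.univ))).2]
  exact Nat.lt_succ_self _

theorem measurableSet_markSet (x y : KPartition k (Fin n)) (τ : Fin k → Equiv.Perm (Fin k)) :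
    MeasurableSet {C : Mark k | update x C τ = y} :=
  measurable_update x τ (MeasurableSet.of_discrete (s := {y}))

theorem measurableSet_uniqueAtom {r t : ℝ≥0} {D : Set (Mark k)} (hD : MeasurableSet D) :
    MeasurableSet[pastSigma P t] (uniqueAtom P r t D) := by
  have hsub : ∀ D : Set (Mark k), Set.Ioc r t ×ˢ D ⊆ Set.Iic t ×ˢ Set.univ :=
    fun D => Set.prod_mono Set.Ioc_subset_Iic_self (Set.subset_univ _)
  exact MeasurableSet.inter
    (measurableSet_pastSigma (measurableSet_Ioc.prod hD) (hsub D) {1})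
    (measurableSet_pastSigma (measurableSet_Ioc.prod hD.compl) (hsub Dᶜ) {0})

/-- If a path is determined by the past at time `r`, then it is at time `t`, on the event that
there is at most one atom in between. -/
theorem measurableSet_restrictedPath_step (hs : ∀ ω, IsSimpleConfiguration (P ω)) {r t : ℝ≥0}
    (hrt : r ≤ t) {W : Set Ω}
    (h : ∀ x, MeasurableSet[adaptedSigma π P σ r] ({ω | restrictedPath π P σ n r ω = x} ∩ W))
    (y : KPartition k (Fin n)) :
    MeasurableSet[adaptedSigma π P σ t] ({ω | restrictedPath π P σ n t ω = y} ∩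
      (W ∩ {ω | (P ω ∩ Set.Ioc r t ×ˢ Set.univ).encard ≤ 1})) := by
  have hsub : Set.Ioc r t ×ˢ Set.univ ⊆ Set.Iic t ×ˢ (Set.univ : Set (Mark k)) :=
    Set.prod_mono Set.Ioc_subset_Iic_self le_rfl
  have hle := pastSigma_le_adaptedSigma π P σ t
  have h0 : MeasurableSet[adaptedSigma π P σ t] (({ω | restrictedPath π P σ n r ω = y} ∩ W) ∩
      {ω | (P ω ∩ Set.Ioc r t ×ˢ Set.univ).encard = 0}) :=
    MeasurableSet.inter (adaptedSigma_mono π σ hs hrt _ (h y))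
      (hle _ (measurableSet_pastSigma (measurableSet_Ioc.prod MeasurableSet.univ) hsub {0}))
  have h1 : ∀ q : KPartition k (Fin n) × (Fin k → Equiv.Perm (Fin k)),
      MeasurableSet[adaptedSigma π P σ t]
        ((({ω | restrictedPath π P σ n r ω = q.1} ∩ W) ∩
          {ω | atomsUpTo (P ω) r < atomsUpTo (P ω) t} ∩ {ω | σ (atomsUpTo (P ω) r) ω = q.2}) ∩
            uniqueAtom P r t {C | update q.1 C q.2 = y}) := fun q =>
    MeasurableSet.inter (measurableSet_adaptedSigma_perm π P σ hrt (h q.1) q.2)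
      (hle _ (measurableSet_uniqueAtom (measurableSet_markSet _ _ _)))
  convert MeasurableSet.union h0 (MeasurableSet.iUnion h1) using 1
  ext ω
  constructor
  · rintro ⟨hy, hW, hc⟩
    rcases Order.le_one_iff.1 (show
      (P ω ∩ Set.Ioc r t ×ˢ Set.univ).encard ≤ 1 from hc) with hc | hc
    · left
      exact ⟨⟨(restrictedPath_of_count_eq_zero hrt hc).symm.trans hy, hW⟩, hc⟩
    · right
      have := (restrictedPath_eq_inter_count_eq_one hs r t y).subset ⟨hy, hc⟩
      obtain ⟨q, ⟨hq1, hq2⟩, hq3⟩ := Set.mem_iUnion.1 this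
      exact Set.mem_iUnion.2 ⟨q, ⟨⟨⟨hq1, hW⟩, lt_of_mem_uniqueAtom hs hq2⟩, hq3⟩, hq2⟩
  · rintro (⟨⟨hy, hW⟩, hc⟩ | hq)
    · exact ⟨(restrictedPath_of_count_eq_zero hrt hc).trans hy, hW,
        le_of_eq_of_le (show (P ω ∩ Set.Ioc r t ×ˢ Set.univ).encard = 0 from hc) zero_le_one⟩
    · obtain ⟨q, ⟨⟨⟨hq1, hW⟩, -⟩, hq3⟩, hq2⟩ := Set.mem_iUnion.1 hq
      have := (restrictedPath_eq_inter_count_eq_one hs r t y).symm.subset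
        (Set.mem_iUnion.2 ⟨q, ⟨hq1, hq2⟩, hq3⟩)
      exact ⟨this.1, hW, le_of_eq this.2⟩

/-- Induction along the grid j/c, truncated at u so that no information after u is used and the last
grid point can be u itself. With at most one atom per cell, each step is
`measurableSet_restrictedPath_step`. -/
theorem measurableSet_restrictedPath_grid (hs : ∀ ω, IsSimpleConfiguration (P ω)) (u : ℝ≥0)
    (c i : ℕ) (y : KPartition k (Fin n)) :
    MeasurableSet[adaptedSigma π P σ (min (i / c) u)]
      ({ω | restrictedPath π P σ n (min (i / c) u) ω = y} ∩
        {ω | ∀ j < i, (P ω ∩ Set.Ioc (min ((j : ℝ≥0) / c) u) (min (((j : ℝ≥0) + 1) / c) u) ×ˢ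
          Set.univ).encard ≤ 1}) := by
  induction i generalizing y with
  | zero =>
    have e0 : min (((0 : ℕ) : ℝ≥0) / c) u = 0 := by simp
    rw [e0]
    intro m
    have : {ω | restrictedPath π P σ n 0 ω = y} ∩
        {ω | ∀ j : ℕ, j < 0 → (P ω ∩
          Set.Ioc (min ((j : ℝ≥0) / c) u) (min (((j : ℝ≥0) + 1) / c) u) ×ˢ Set.univ).encard ≤ 1} =
        π ⁻¹' (restrict n ⁻¹' {y}) := by
      ext ω
      have h0 := (followsConstruction_constructedPath (π ω) (fun m => σ m ω) (hs ω) n).init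
      simp [restrictedPath, show restrict n (constructedPath (π ω) (fun m => σ m ω) (P ω) 0) =
        restrict n (π ω) from h0]
    rw [this]
    refine MeasurableSet.inter ?_ (pastSigma_le_pastInput π P σ 0 m _
      (measurableSet_atomsUpTo P 0 {m}))
    have hle : MeasurableSpace.comap π inferInstance ≤ pastInput π P σ 0 m := le_sup_left
    exact hle _ ⟨_, measurable_restrict n MeasurableSet.of_discrete, rfl⟩
  | succ i ih =>
    have hle : min ((i : ℝ≥0) / c) u ≤ min (((i + 1 : ℕ) : ℝ≥0) / c) u := by
      gcongr
      exact Nat.le_succ i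
    have := measurableSet_restrictedPath_step hs hle ih y
    convert this using 2
    ext ω
    simp only [Nat.lt_succ_iff_lt_or_eq, Set.mem_ofPred_eq, Set.mem_inter_iff, or_imp,
      forall_and, forall_eq, Nat.cast_succ]

theorem measurableSet_restrictedPath (hs : ∀ ω, IsSimpleConfiguration (P ω)) (u : ℝ≥0)
    (y : KPartition k (Fin n)) :
    MeasurableSet[adaptedSigma π P σ u] {ω | restrictedPath π P σ n u ω = y} := by
  obtain ⟨T, hT⟩ := exists_nat_ge u
  have hgrid : ∀ c : ℕ, 0 < c → min (((T * c : ℕ) : ℝ≥0) / c) u = u := by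
    intro c hc
    have : (c : ℝ≥0) ≠ 0 := by exact_mod_cast hc.ne'
    rw [Nat.cast_mul, mul_div_cancel_right₀ _ this]
    exact min_eq_right hT
  -- By simplicity some grid separates the atoms up to T ≥ u, so countably many grids exhaust the
  -- event.
  have e : {ω | restrictedPath π P σ n u ω = y} = ⋃ c : ℕ, ⋃ _ : 0 < c,
      ({ω | restrictedPath π P σ n u ω = y} ∩ {ω | ∀ j < T * c, (P ω ∩
        Set.Ioc (min ((j : ℝ≥0) / c) u) (min (((j : ℝ≥0) + 1) / c) u) ×ˢ
          Set.univ).encard ≤ 1}) := by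
    ext ω
    simp only [Set.mem_iUnion, Set.mem_inter_iff, Set.mem_ofPred_eq, exists_prop]
    constructor
    · intro h
      obtain ⟨c, hc, h'⟩ := (hs ω).2 T
      refine ⟨c, hc, h, fun j hj => (Set.encard_le_encard ?_).trans (h' j hj)⟩
      rintro a ⟨ha, ⟨ha1, ha2⟩, -⟩
      refine ⟨ha, ⟨?_, ha2.trans (min_le_left _ _)⟩, trivial⟩
      rcases min_lt_iff.1 ha1 with h1 | h1
      · exact h1
      · exact absurd (ha2.trans (min_le_right _ _)) (not_le_of_gt h1)
    · rintro ⟨c, -, h, -⟩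
      exact h
  rw [e]
  refine MeasurableSet.iUnion fun c => MeasurableSet.iUnion fun hc => ?_
  have := measurableSet_restrictedPath_grid (π := π) (σ := σ) hs u c (T * c) y
  rwa [hgrid c hc] at this

end Step

/-! ### Time slabs split according to the mark -/

section MarkSlab

variable {k : ℕ} {Ω : Type*} {P : Ω → Set (ℝ≥0 × Mark k)}

/-- The points with time in `(r, t]` and mark in `D` or in its complement. -/
def markSlab (r t : ℝ≥0) (D : Set (Mark k)) (b : Bool) : Set (ℝ≥0 × Mark k) :=
  Set.Ioc r t ×ˢ (if b then D else Dᶜ)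

theorem measurableSet_markSlab {r t : ℝ≥0} {D : Set (Mark k)} (hD : MeasurableSet D) (b : Bool) :
    MeasurableSet (markSlab r t D b) := by
  refine measurableSet_Ioc.prod ?_
  cases b
  · exact hD.compl
  · exact hD

theorem disjoint_markSlab (r t : ℝ≥0) (D : Set (Mark k)) :
    Disjoint (markSlab r t D true) (markSlab r t D false) :=
  Set.disjoint_left.2 fun _ h h' => h'.2 h.2

theorem markSlab_subset (r t : ℝ≥0) (D : Set (Mark k)) (b : Bool) :
    markSlab r t D b ⊆ Set.Ioi r ×ˢ Set.univ :=
  Set.prod_mono (fun _ h => h.1) (Set.subset_univ _)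

theorem measurableSet_count_markSlab (r t : ℝ≥0) (D : Set (Mark k)) (b : Bool) (N : Set ℕ∞) :
    MeasurableSet[futureSigma P (markSlab r t D)] {ω | (P ω ∩ markSlab r t D b).encard ∈ N} :=
  measurableSet_count (le_iSup (fun b =>
    MeasurableSpace.comap (fun ω => (P ω ∩ markSlab r t D b).encard) inferInstance) b) N

end MarkSlab

/-! ### The Markov property on finite state spaces -/

section LocalStep

variable {k n : ℕ} {Ω : Type*} [MeasurableSpace Ω] {μ : Measure Ω}
  {lam : ℝ≥0} {ν : Measure (RankedSimplex k)} [IsProbabilityMeasure ν]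
  {π : Ω → KPartition k ℕ} {P : Ω → Set (ℝ≥0 × Mark k)}
  {σ : ℕ → Ω → Fin k → Equiv.Perm (Fin k)}

/-- The counts of atoms with mark in D and outside D are independent Poisson variables. The
exponentials of their two intensities multiply to exp(−λh), and the single atom in D contributes the
intensity of D. -/
theorem measureReal_uniqueAtom (hin : IsPoissonianInput μ lam ν π P σ) (r h : ℝ≥0)
    {D : Set (Mark k)} (hD : MeasurableSet D) :
    μ.real (uniqueAtom P r (r + h) D) =
      Real.exp (-(lam * h : ℝ≥0)) * (lam * h : ℝ≥0) * (markLaw ν).real D := by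
  have hr : r ≤ r + h := le_self_add
  have hind := hin.poisson.indep_count_of_countable (markSlab r (r + h) D)
    (measurableSet_markSlab hD) (by
      rintro (_ | _) (_ | _) hne
      · exact absurd rfl hne
      · exact (disjoint_markSlab _ _ _).symm
      · exact disjoint_markSlab _ _ _
      · exact absurd rfl hne)
  have h2 := (hind.indepFun (i := true) (j := false) (by simp)).measure_inter_preimage_eq_mul
    {(1 : ℕ∞)} {(0 : ℕ∞)} MeasurableSet.of_discrete MeasurableSet.of_discrete
  obtain ⟨t1, t2⟩ := toReal_poissonIntensity_Ioc lam ν hr D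
  obtain ⟨c1, c2⟩ := toReal_poissonIntensity_Ioc lam ν hr Dᶜ
  have e1 := hin.poisson.measureReal_count_eq (measurableSet_Ioc.prod hD) t1 1
  have e2 := hin.poisson.measureReal_count_eq (measurableSet_Ioc.prod hD.compl) c1 0
  rw [t2] at e1
  rw [c2, probReal_compl_eq_one_sub hD] at e2
  have h3 : μ.real (uniqueAtom P r (r + h) D) =
      μ.real {ω | (P ω ∩ Set.Ioc r (r + h) ×ˢ D).encard = (1 : ℕ)} *
        μ.real {ω | (P ω ∩ Set.Ioc r (r + h) ×ˢ Dᶜ).encard = (0 : ℕ)} := by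
    rw [measureReal_def, measureReal_def, measureReal_def, ← ENNReal.toReal_mul]
    exact congrArg ENNReal.toReal h2
  rw [h3, e1, e2]
  have ee : Real.exp (-(lam * h : ℝ≥0)) =
      Real.exp (-(((r + h : ℝ≥0) - r : ℝ) * (lam * (markLaw ν).real D))) *
      Real.exp (-(((r + h : ℝ≥0) - r : ℝ) * (lam * (1 - (markLaw ν).real D)))) := by
    rw [← Real.exp_add]
    congr 1
    push_cast
    ring
  rw [ee]
  simp only [pow_one, pow_zero, Nat.factorial_one, Nat.factorial_zero, Nat.cast_one, div_one,
    mul_one]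
  push_cast
  ring

/-- Split by the number of atoms in (r, r + h]. With none the state is unchanged; with one it moves
by the step kernel, since mark and permutations are independent of G and of the state at r. These
are exactly the first two terms of `poissonSemigroup_expansion`, so only events of two or more atoms
contribute to the error. -/
theorem abs_measureReal_step_le [IsProbabilityMeasure μ] (hin : IsPoissonianInput μ lam ν π P σ)
    (hs : ∀ ω, IsSimpleConfiguration (P ω)) {r : ℝ≥0} (h : ℝ≥0) {G : Set Ω}
    (hG : MeasurableSet[adaptedSigma π P σ r] G) (y : KPartition k (Fin n)) :
    |μ.real (G ∩ {ω | restrictedPath π P σ n (r + h) ω = y}) -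
      ∑ x, μ.real (G ∩ {ω | restrictedPath π P σ n r ω = x}) *
        (poissonSemigroup (stepKernel ν n) (lam * h) x).real {y}| ≤
      ((lam * h : ℝ≥0) : ℝ) ^ 2 := by
  classical
  set a : ℝ≥0 := lam * h with ha
  set t := r + h with ht
  have hrt : r ≤ t := le_self_add
  set N : Ω → ℕ∞ := fun ω => (P ω ∩ Set.Ioc r t ×ˢ Set.univ).encard with hN
  have hGx : ∀ x, MeasurableSet[adaptedSigma π P σ r]
      (G ∩ {ω | restrictedPath π P σ n r ω = x}) := fun x =>
    MeasurableSet.inter hG (measurableSet_restrictedPath hs r x)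
  have hNm : Measurable N := hin.poisson.measurable_count _
    (measurableSet_Ioc.prod MeasurableSet.univ)
  have hNs : ∀ M : Set ℕ∞, MeasurableSet {ω | N ω ∈ M} := fun M =>
    hNm (MeasurableSet.of_discrete (s := M))
  have hGt : MeasurableSet (G ∩ {ω | restrictedPath π P σ n t ω = y}) :=
    MeasurableSet.inter (hin.adaptedSigma_le r _ hG)
      (hin.adaptedSigma_le t _ (measurableSet_restrictedPath hs t y))
  obtain ⟨i1, i2⟩ := toReal_poissonIntensity_Ioc lam ν hrt Set.univ
  have i3 : (poissonIntensity lam ν (Set.Ioc r t ×ˢ Set.univ)).toReal = a := by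
    rw [i2, probReal_univ, ht, ha]
    push_cast
    ring
  have p0 : μ.real (G ∩ {ω | restrictedPath π P σ n t ω = y} ∩ {ω | N ω = 0}) =
      μ.real (G ∩ {ω | restrictedPath π P σ n r ω = y}) * Real.exp (-a) := by
    have e : G ∩ {ω | restrictedPath π P σ n t ω = y} ∩ {ω | N ω = 0} =
        (G ∩ {ω | restrictedPath π P σ n r ω = y}) ∩
          {ω | (P ω ∩ markSlab r t Set.univ true).encard ∈ ({0} : Set ℕ∞)} := by
      ext ω
      constructor
      · rintro ⟨⟨h1, h2⟩, h3⟩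
        exact ⟨⟨h1, (restrictedPath_of_count_eq_zero hrt h3).symm.trans h2⟩, h3⟩
      · rintro ⟨⟨h1, h2⟩, h3⟩
        exact ⟨⟨h1, (restrictedPath_of_count_eq_zero hrt h3).trans h2⟩, h3⟩
    have h1 := (hin.measure_inter_future (measurableSet_markSlab MeasurableSet.univ)
      (disjoint_markSlab _ _ _) (markSlab_subset r t Set.univ) (hGx y)
      (measurableSet_count_markSlab r t Set.univ true {0})).1
    have h2 := hin.poisson.measureReal_count_eq (measurableSet_Ioc.prod MeasurableSet.univ) i1 0
    rw [i3] at h2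
    have h3 : μ.real {ω | (P ω ∩ markSlab r t Set.univ true).encard ∈ ({0} : Set ℕ∞)} =
        Real.exp (-a) := by
      refine Eq.trans ?_ (h2.trans (by simp))
      rfl
    rw [e, measureReal_def, h1, ENNReal.toReal_mul, ← measureReal_def, ← measureReal_def, h3]
  have p1 : μ.real (G ∩ {ω | restrictedPath π P σ n t ω = y} ∩ {ω | N ω = 1}) =
      ∑ x, μ.real (G ∩ {ω | restrictedPath π P σ n r ω = x}) *
        (Real.exp (-a) * a * (stepKernel ν n x).real {y}) := by
    have hpiece : ∀ q : KPartition k (Fin n) × (Fin k → Equiv.Perm (Fin k)),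
        μ.real ((G ∩ {ω | restrictedPath π P σ n r ω = q.1}) ∩
          uniqueAtom P r t {C | update q.1 C q.2 = y} ∩ {ω | σ (atomsUpTo (P ω) r) ω = q.2}) =
        μ.real (G ∩ {ω | restrictedPath π P σ n r ω = q.1}) * (Real.exp (-a) * a *
          (((k.factorial : ℝ)⁻¹) ^ k * (markLaw ν).real {C | update q.1 C q.2 = y})) := by
      intro q
      have hD := measurableSet_markSet q.1 y q.2
      have h1 := (hin.measure_inter_future (measurableSet_markSlab hD)
        (disjoint_markSlab _ _ _) (markSlab_subset r t _) (hGx q.1) (MeasurableSet.inter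
          (measurableSet_count_markSlab r t _ true {1})
          (measurableSet_count_markSlab r t _ false {0}))).2 q.2
      have h2 := measureReal_uniqueAtom hin r h hD
      rw [measureReal_def]
      refine (congrArg ENNReal.toReal h1).trans ?_
      rw [ENNReal.toReal_mul, ENNReal.toReal_mul, ENNReal.toReal_pow, ENNReal.toReal_inv,
        ENNReal.toReal_natCast]
      refine congrArg _ ((congrArg (· * ((k.factorial : ℝ)⁻¹) ^ k) h2).trans ?_)
      ring
    have e : G ∩ {ω | restrictedPath π P σ n t ω = y} ∩ {ω | N ω = 1} =
        ⋃ q : KPartition k (Fin n) × (Fin k → Equiv.Perm (Fin k)),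
          (G ∩ {ω | restrictedPath π P σ n r ω = q.1}) ∩
          uniqueAtom P r t {C | update q.1 C q.2 = y} ∩ {ω | σ (atomsUpTo (P ω) r) ω = q.2} := by
      rw [Set.inter_assoc, hN, restrictedPath_eq_inter_count_eq_one hs r t y, Set.inter_iUnion]
      refine Set.iUnion_congr fun q => ?_
      simp only [Set.inter_assoc]
    rw [e, measureReal_iUnion_fintype]
    · simp only [hpiece]
      rw [Fintype.sum_prod_type]
      refine Finset.sum_congr rfl fun x _ => ?_
      rw [stepKernel_real_singleton_eq_sum, Finset.mul_sum, Finset.mul_sum]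
    · intro q q' hq
      refine Set.disjoint_left.2 fun ω h1 h2 => hq (Prod.ext ?_ ?_)
      · exact h1.1.1.2.symm.trans h2.1.1.2
      · exact h1.2.symm.trans h2.2
    · intro q
      refine hin.adaptedSigma_le t _ ?_
      convert MeasurableSet.inter (measurableSet_adaptedSigma_perm π P σ hrt (hGx q.1) q.2)
        (pastSigma_le_adaptedSigma π P σ t _ (measurableSet_uniqueAtom (r := r)
          (measurableSet_markSet q.1 y q.2))) using 1
      ext ω
      constructor
      · rintro ⟨⟨h1, h2⟩, h3⟩
        exact ⟨⟨⟨h1, lt_of_mem_uniqueAtom hs h2⟩, h3⟩, h2⟩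
      · rintro ⟨⟨⟨h1, -⟩, h3⟩, h2⟩
        exact ⟨⟨h1, h2⟩, h3⟩
  have p2 : μ.real (G ∩ {ω | restrictedPath π P σ n t ω = y} ∩ {ω | ¬ N ω ≤ 1}) ≤ (a : ℝ) ^ 2 := by
    refine (measureReal_mono Set.inter_subset_right (measure_ne_top _ _)).trans ?_
    have := hin.poisson.measureReal_two_le_count (measurableSet_Ioc.prod MeasurableSet.univ) i1
    rwa [i3] at this
  have hsplit : μ.real (G ∩ {ω | restrictedPath π P σ n t ω = y}) =
      μ.real (G ∩ {ω | restrictedPath π P σ n t ω = y} ∩ {ω | N ω = 0}) +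
      μ.real (G ∩ {ω | restrictedPath π P σ n t ω = y} ∩ {ω | N ω = 1}) +
      μ.real (G ∩ {ω | restrictedPath π P σ n t ω = y} ∩ {ω | ¬ N ω ≤ 1}) := by
    rw [← measureReal_union, ← measureReal_union]
    · congr 1
      ext ω
      have := Order.le_one_iff (x := N ω)
      simp only [Set.mem_inter_iff, Set.mem_union, Set.mem_ofPred_eq]
      tauto
    · refine Set.disjoint_left.2 fun ω h1 h2 => h2.2 (Order.le_one_iff.2 ?_)
      exact h1.imp (fun h => h.2) fun h => h.2
    · exact hGt.inter (hNs {m | ¬ m ≤ 1})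
    · refine Set.disjoint_left.2 fun ω h1 h2 => ?_
      have h3 : (0 : ℕ∞) = 1 := h1.2.symm.trans h2.2
      exact absurd h3 (by norm_num)
    · exact hGt.inter (hNs {1})
  choose R hR0 hR1 hR using fun x : KPartition k (Fin n) =>
    poissonSemigroup_expansion (stepKernel ν n) a x (A := {y}) MeasurableSet.of_discrete
  have hsum1 : ∑ x, μ.real (G ∩ {ω | restrictedPath π P σ n r ω = x}) ≤ 1 := by
    rw [← measureReal_iUnion_fintype]
    · exact measureReal_le_one
    · intro x x' hx
      exact Set.disjoint_left.2 fun ω h1 h2 => hx (h1.2.symm.trans h2.2)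
    · exact fun x => hin.adaptedSigma_le r _ (hGx x)
  -- After cancellation the difference is one remainder minus another. Both lie in [0, a²], so its
  -- absolute value is at most a².
  have hdiff : μ.real (G ∩ {ω | restrictedPath π P σ n t ω = y}) -
      ∑ x, μ.real (G ∩ {ω | restrictedPath π P σ n r ω = x}) *
        (poissonSemigroup (stepKernel ν n) a x).real {y} =
      μ.real (G ∩ {ω | restrictedPath π P σ n t ω = y} ∩ {ω | ¬ N ω ≤ 1}) -
      ∑ x, μ.real (G ∩ {ω | restrictedPath π P σ n r ω = x}) * R x := by
    have e0 : ∑ x, μ.real (G ∩ {ω | restrictedPath π P σ n r ω = x}) *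
        (Real.exp (-a) * ({y} : Set (KPartition k (Fin n))).indicator 1 x) =
        μ.real (G ∩ {ω | restrictedPath π P σ n r ω = y}) * Real.exp (-a) := by
      rw [Finset.sum_eq_single y]
      · simp
      · intro x _ hx
        simp [hx]
      · simp
    rw [hsplit, p0, p1, ← e0]
    simp only [hR, mul_add, Finset.sum_add_distrib]
    ring
  have hRs0 : 0 ≤ ∑ x, μ.real (G ∩ {ω | restrictedPath π P σ n r ω = x}) * R x :=
    Finset.sum_nonneg fun x _ => mul_nonneg measureReal_nonneg (hR0 x)
  have hRs1 : ∑ x, μ.real (G ∩ {ω | restrictedPath π P σ n r ω = x}) * R x ≤ (a : ℝ) ^ 2 := by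
    calc _ ≤ ∑ x, μ.real (G ∩ {ω | restrictedPath π P σ n r ω = x}) * (a : ℝ) ^ 2 :=
        Finset.sum_le_sum fun x _ => mul_le_mul_of_nonneg_left (hR1 x) measureReal_nonneg
      _ = (∑ x, μ.real (G ∩ {ω | restrictedPath π P σ n r ω = x})) * (a : ℝ) ^ 2 :=
        (Finset.sum_mul _ _ _).symm
      _ ≤ 1 * (a : ℝ) ^ 2 := by gcongr
      _ = _ := one_mul _
  have h2 : 0 ≤ μ.real (G ∩ {ω | restrictedPath π P σ n t ω = y} ∩ {ω | ¬ N ω ≤ 1}) :=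
    measureReal_nonneg
  rw [hdiff, abs_le]
  constructor <;> linarith

theorem poissonSemigroup_add_real {S : Type*} [MeasurableSpace S] [Fintype S]
    [DiscreteMeasurableSpace S] (K : Kernel S S) [IsMarkovKernel K] (a b : ℝ≥0) (x y : S) :
    (poissonSemigroup K (a + b) x).real {y} =
      ∑ z, (poissonSemigroup K a x).real {z} * (poissonSemigroup K b z).real {y} := by
  rw [poissonSemigroup_add, measureReal_def, Kernel.comp_apply' _ _ _ MeasurableSet.of_discrete,
    lintegral_fintype, ENNReal.toReal_sum]
  · refine Finset.sum_congr rfl fun z _ => ?_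
    rw [ENNReal.toReal_mul, mul_comm]
    rfl
  · exact fun z _ => ENNReal.mul_ne_top (measure_ne_top _ _) (measure_ne_top _ _)

/-- The Markov property of the restricted path, tested on an event `G` of the past. -/
theorem measureReal_restrictedPath_eq [IsProbabilityMeasure μ]
    (hin : IsPoissonianInput μ lam ν π P σ)
    (hs : ∀ ω, IsSimpleConfiguration (P ω)) {s : ℝ≥0} (t : ℝ≥0) {G : Set Ω}
    (hG : MeasurableSet[adaptedSigma π P σ s] G) (y : KPartition k (Fin n)) :
    μ.real (G ∩ {ω | restrictedPath π P σ n (s + t) ω = y}) =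
      ∑ x, μ.real (G ∩ {ω | restrictedPath π P σ n s ω = x}) *
        (poissonSemigroup (stepKernel ν n) (lam * t) x).real {y} := by
  classical
  set v : ℝ≥0 → KPartition k (Fin n) → ℝ :=
    fun r x => μ.real (G ∩ {ω | restrictedPath π P σ n r ω = x}) with hv
  set κ : ℝ≥0 → KPartition k (Fin n) → KPartition k (Fin n) → ℝ :=
    fun u x y => (poissonSemigroup (stepKernel ν n) (lam * u) x).real {y} with hκ
  set c : ℝ := ((Fintype.card (KPartition k (Fin n)) : ℕ) : ℝ) with hc
  have hκ1 : ∀ u z, ∑ y, κ u z y = 1 := fun u z => by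
    have := measureReal_iUnion_fintype (μ := poissonSemigroup (stepKernel ν n) (lam * u) z)
      (f := fun y : KPartition k (Fin n) => {y})
      (fun y y' hy => Set.disjoint_singleton.2 hy) fun y => MeasurableSet.of_discrete
    rw [← this, Set.iUnion_of_singleton, probReal_univ]
  -- Errors are measured in ℓ¹. Each step adds at most (λh)² per state, c times that in total, and
  -- errors already made do not grow because the rows of κ_h sum to 1.
  have herr : ∀ (h : ℝ≥0) (j : ℕ), ∑ y, |v (s + j * h) y - ∑ x, v s x * κ (j * h) x y| ≤
      j * (c * ((lam * h : ℝ≥0) : ℝ) ^ 2) := by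
    intro h j
    induction j with
    | zero =>
      have : ∀ x y, κ 0 x y = if x = y then 1 else 0 := fun x y => by
        simp only [hκ, mul_zero, poissonSemigroup_zero, Kernel.id_apply, measureReal_def,
          Measure.dirac_apply' _ (MeasurableSet.of_discrete (s := {y}))]
        by_cases hxy : x = y <;> simp [hxy]
      simp [this]
    | succ j ih =>
      have hstep : ∀ y, |v (s + (j + 1 : ℕ) * h) y - ∑ z, v (s + j * h) z * κ h z y| ≤
          ((lam * h : ℝ≥0) : ℝ) ^ 2 := fun y => by
        have e : s + (j + 1 : ℕ) * h = (s + j * h) + h := by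
          push_cast
          ring
        rw [e]
        exact abs_measureReal_step_le hin hs h (adaptedSigma_mono π σ hs le_self_add _ hG) y
      have hck : ∀ y, ∑ x, v s x * κ ((j + 1 : ℕ) * h) x y =
          ∑ z, (∑ x, v s x * κ (j * h) x z) * κ h z y := fun y => by
        have e : lam * ((j + 1 : ℕ) * h) = lam * (j * h) + lam * h := by
          push_cast
          ring
        simp only [hκ, e, poissonSemigroup_add_real, Finset.mul_sum, Finset.sum_mul, mul_assoc]
        exact Finset.sum_comm
      calc _ ≤ ∑ y, (((lam * h : ℝ≥0) : ℝ) ^ 2 +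
            ∑ z, |v (s + j * h) z - ∑ x, v s x * κ (j * h) x z| * κ h z y) := by
            refine Finset.sum_le_sum fun y _ => ?_
            have e : v (s + (j + 1 : ℕ) * h) y - ∑ x, v s x * κ ((j + 1 : ℕ) * h) x y =
                (v (s + (j + 1 : ℕ) * h) y - ∑ z, v (s + j * h) z * κ h z y) +
                ∑ z, (v (s + j * h) z - ∑ x, v s x * κ (j * h) x z) * κ h z y := by
              rw [hck]
              simp only [sub_mul, Finset.sum_sub_distrib]
              ring
            rw [e]
            refine (abs_add_le _ _).trans (add_le_add (hstep y) ?_)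
            refine (Finset.abs_sum_le_sum_abs _ _).trans (le_of_eq ?_)
            refine Finset.sum_congr rfl fun z _ => ?_
            rw [abs_mul, abs_of_nonneg (measureReal_nonneg : 0 ≤ κ h z y)]
        _ = c * ((lam * h : ℝ≥0) : ℝ) ^ 2 +
            ∑ z, |v (s + j * h) z - ∑ x, v s x * κ (j * h) x z| := by
            rw [Finset.sum_add_distrib, Finset.sum_comm]
            simp only [← Finset.mul_sum, hκ1, mul_one]
            simp [hc]
        _ ≤ _ := by
            push_cast at ih ⊢
            linarith
  rw [← sub_eq_zero, ← abs_eq_zero]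
  -- With m + 1 steps of length t/(m + 1) the accumulated error is c(λt)²/(m + 1).
  refine le_antisymm (ge_of_tendsto' (x := atTop) (f := fun m : ℕ =>
    c * (lam * t : ℝ) ^ 2 * (1 / ((m : ℝ) + 1))) ?_ fun m => ?_) (abs_nonneg _)
  · simpa using tendsto_one_div_add_atTop_nhds_zero_nat.const_mul (c * (lam * t : ℝ) ^ 2)
  · have hm : ((m + 1 : ℕ) : ℝ≥0) ≠ 0 := by positivity
    have e : ((m + 1 : ℕ) : ℝ≥0) * (t / (m + 1 : ℕ)) = t := mul_div_cancel₀ _ hm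
    have h1 := herr (t / (m + 1 : ℕ)) (m + 1)
    rw [e] at h1
    refine (Finset.single_le_sum (f := fun y => |v (s + t) y - ∑ x, v s x * κ t x y|)
      (fun y _ => abs_nonneg _) (Finset.mem_univ y)).trans (h1.trans (le_of_eq ?_))
    push_cast
    field_simp

end LocalStep

/-! ### From laws on past events to conditional expectations -/

section Markov

variable {Ω T T' : Type*} [MeasurableSpace T] [MeasurableSpace T']

/-- The natural filtration of a process. -/
@[reducible] def naturalSigma (X : ℝ≥0 → Ω → T) (s : ℝ≥0) : MeasurableSpace Ω :=
  ⨆ u : Set.Iic s, MeasurableSpace.comap (X u) inferInstance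

theorem exists_preimage_of_naturalSigma {X : ℝ≥0 → Ω → T} {s : ℝ≥0} {G : Set Ω}
    (hG : MeasurableSet[naturalSigma X s] G) :
    ∃ E : Set (Set.Iic s → T), MeasurableSet E ∧ (fun ω (u : Set.Iic s) => X u ω) ⁻¹' E = G := by
  have : naturalSigma X s =
      MeasurableSpace.comap (fun ω (u : Set.Iic s) => X u ω) inferInstance := by
    change _ = MeasurableSpace.comap _ (⨆ u, MeasurableSpace.comap _ _)
    rw [MeasurableSpace.comap_iSup]
    refine iSup_congr fun u => ?_
    rw [MeasurableSpace.comap_comp]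
    rfl
  rw [this] at hG
  exact hG

variable [MeasurableSpace Ω] {μ : Measure Ω}

theorem naturalSigma_le {X : ℝ≥0 → Ω → T} (hX : ∀ t, Measurable (X t)) (s : ℝ≥0) :
    naturalSigma X s ≤ (inferInstance : MeasurableSpace Ω) :=
  iSup_le fun u => (hX u).comap_le

/-- Evaluating the hypothesis at A states that the two sides have the same integral over every past
event G. Since the right side is a function of the present X s, it is measurable for the past, which
characterises the conditional expectation. -/
theorem condExp_eq_of_map_restrict_eq [IsProbabilityMeasure μ] {X : ℝ≥0 → Ω → T}
    (hX : ∀ t, Measurable (X t))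
    {κ : Kernel T T} [IsMarkovKernel κ] {s t : ℝ≥0}
    (h : ∀ G, MeasurableSet[naturalSigma X s] G →
      (μ.restrict G).map (X (s + t)) = ((μ.restrict G).map (X s)).bind κ)
    {A : Set T} (hA : MeasurableSet A) :
    μ[fun ω => A.indicator (fun _ => (1 : ℝ)) (X (s + t) ω) | naturalSigma X s] =ᵐ[μ]
      fun ω => (κ (X s ω)).real A := by
  have hle := naturalSigma_le hX s
  have hκ : Measurable fun x => (κ x).real A := (κ.measurable_coe hA).ennreal_toReal
  have hint : Integrable (fun ω => (κ (X s ω)).real A) μ := by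
    refine Integrable.of_bound (hκ.comp (hX s)).aestronglyMeasurable 1
      (Eventually.of_forall fun ω => ?_)
    rw [Real.norm_of_nonneg measureReal_nonneg]
    exact measureReal_le_one
  have hind : (fun ω => A.indicator (fun _ => (1 : ℝ)) (X (s + t) ω)) =
      (X (s + t) ⁻¹' A).indicator fun _ => (1 : ℝ) := rfl
  refine (ae_eq_condExp_of_forall_setIntegral_eq hle ?_ (fun G _ _ => hint.integrableOn) ?_
    ?_).symm
  · rw [hind]
    exact (integrable_const _).indicator (hX _ hA)
  · intro G hG _
    have h1 := congrArg (fun m : Measure T => (m A).toReal) (h G hG)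
    rw [Measure.map_apply (hX _) hA, Measure.bind_apply hA κ.measurable.aemeasurable,
      lintegral_map (κ.measurable_coe hA) (hX s)] at h1
    rw [hind, integral_indicator_const _ (hX _ hA), smul_eq_mul, mul_one, measureReal_def, h1]
    exact integral_toReal ((κ.measurable_coe hA).comp (hX s)).aemeasurable
      (Eventually.of_forall fun ω => measure_lt_top _ _)
  · have : Measurable[naturalSigma X s] (X s) := by
      rw [measurable_iff_comap_le]
      exact le_iSup (fun u : Set.Iic s => MeasurableSpace.comap (X u) inferInstance)
        ⟨s, Set.mem_Iic.2 le_rfl⟩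
    exact (hκ.comp this).aestronglyMeasurable

theorem isMarkovProcessWithRates_of_poissonSemigroup [IsProbabilityMeasure μ]
    {X : ℝ≥0 → Ω → T}
    (hX : ∀ t, Measurable (X t)) (K : Kernel T T) [IsMarkovKernel K] (lam : ℝ≥0)
    (h : ∀ s t G, MeasurableSet[naturalSigma X s] G →
      (μ.restrict G).map (X (s + t)) =
        ((μ.restrict G).map (X s)).bind (poissonSemigroup K (lam * t)))
    {Q : T → Set T → ℝ}
    (hQ : ∀ x A, MeasurableSet A → Q x A = lam * ((K x).real A - A.indicator 1 x)) :
    IsMarkovProcessWithRates μ X Q where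
  measurable := hX
  markov := by
    refine ⟨fun t => poissonSemigroup K (lam * t), fun t => inferInstance, ?_, fun s t => ?_,
      fun x A hA => ?_, fun s t A hA => condExp_eq_of_map_restrict_eq hX (h s t) hA⟩
    · simp only [mul_zero, poissonSemigroup_zero]
    · simp only [mul_add, poissonSemigroup_add]
    · rw [hQ x A hA]
      exact tendsto_poissonSemigroup_rate K lam x hA

theorem map_bind_kernel {m : Measure T} {κ : Kernel T T} {κ' : Kernel T' T'} {f : T → T'}
    (hf : Measurable f) (h : ∀ x, (κ x).map f = κ' (f x)) :
    (m.bind κ).map f = (m.map f).bind κ' := by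
  ext A hA
  rw [Measure.map_apply hf hA, Measure.bind_apply (hf hA) κ.measurable.aemeasurable,
    Measure.bind_apply hA κ'.measurable.aemeasurable, lintegral_map (κ'.measurable_coe hA) hf]
  refine lintegral_congr fun x => ?_
  rw [← h, Measure.map_apply hf hA]

end Markov

/-! ### The constructed process and its law -/

section ConstructedProcess

variable {k n : ℕ} {Ω : Type*} {π : Ω → KPartition k ℕ} {P : Ω → Set (ℝ≥0 × Mark k)}
  {σ : ℕ → Ω → Fin k → Equiv.Perm (Fin k)}

/-- The process obtained from the construction. -/
noncomputable def constructedProcess (π : Ω → KPartition k ℕ) (P : Ω → Set (ℝ≥0 × Mark k))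
    (σ : ℕ → Ω → Fin k → Equiv.Perm (Fin k)) (t : ℝ≥0) (ω : Ω) : KPartition k ℕ :=
  constructedPath (π ω) (fun m => σ m ω) (P ω) t

theorem measurable_adaptedSigma_constructedProcess (hs : ∀ ω, IsSimpleConfiguration (P ω))
    (t : ℝ≥0) : Measurable[adaptedSigma π P σ t] (constructedProcess π P σ t) := by
  refine @measurable_of_restrict k Ω (adaptedSigma π P σ t) _ fun n => ?_
  exact @measurable_to_countable' _ _ _ _ (adaptedSigma π P σ t) _
    fun y => measurableSet_restrictedPath hs t y

theorem naturalSigma_constructedProcess_le (hs : ∀ ω, IsSimpleConfiguration (P ω)) (s : ℝ≥0) :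
    naturalSigma (constructedProcess π P σ) s ≤ adaptedSigma π P σ s :=
  iSup_le fun u => (measurable_iff_comap_le.1
    (measurable_adaptedSigma_constructedProcess hs u)).trans (adaptedSigma_mono π σ hs u.2)

theorem measurable_constructedProcess [MeasurableSpace Ω] {μ : Measure Ω} {lam : ℝ≥0}
    {ν : Measure (RankedSimplex k)} (hin : IsPoissonianInput μ lam ν π P σ)
    (hs : ∀ ω, IsSimpleConfiguration (P ω)) (t : ℝ≥0) :
    Measurable (constructedProcess π P σ t) :=
  (measurable_adaptedSigma_constructedProcess hs t).mono (hin.adaptedSigma_le t) le_rfl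

end ConstructedProcess

section Constructed

variable {k n : ℕ} {Ω : Type*} [MeasurableSpace Ω] {μ : Measure Ω} [IsProbabilityMeasure μ]
  {lam : ℝ≥0} {ν : Measure (RankedSimplex k)} [IsProbabilityMeasure ν]
  {π : Ω → KPartition k ℕ} {P : Ω → Set (ℝ≥0 × Mark k)}
  {σ : ℕ → Ω → Fin k → Equiv.Perm (Fin k)}

/-- Both sides are measures on partitions of ℕ, so comparison on the π-system of cylinders suffices.
The restriction map carries the semigroup to its finite version, and the finite statement is
`measureReal_restrictedPath_eq`. -/
theorem map_constructedProcess (hin : IsPoissonianInput μ lam ν π P σ)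
    (hs : ∀ ω, IsSimpleConfiguration (P ω)) (s t : ℝ≥0) {G : Set Ω}
    (hG : MeasurableSet[adaptedSigma π P σ s] G) :
    (μ.restrict G).map (constructedProcess π P σ (s + t)) =
      ((μ.restrict G).map (constructedProcess π P σ s)).bind
        (poissonSemigroup (stepKernelNat ν) (lam * t)) := by
  have hm := measurable_constructedProcess hin hs
  have hr : ∀ n u, Measurable (restrictedPath π P σ n u) := fun n u =>
    (measurable_restrict n).comp (hm u)
  have hmap : ∀ n, ((μ.restrict G).map (constructedProcess π P σ (s + t))).map (restrict n) =
      (((μ.restrict G).map (constructedProcess π P σ s)).bind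
        (poissonSemigroup (stepKernelNat ν) (lam * t))).map (restrict n) := by
    intro n
    rw [map_bind_kernel (measurable_restrict n) (map_poissonSemigroup (lam * t)
      (measurable_restrict n) fun x => map_restrict_stepKernelNat ν x),
      Measure.map_map (measurable_restrict n) (hm _),
      Measure.map_map (measurable_restrict n) (hm _)]
    refine Measure.ext_of_singleton fun y => ?_
    have h := measureReal_restrictedPath_eq (n := n) hin hs t hG y
    have hrestrict : ∀ u (z : KPartition k (Fin n)),
        (μ.restrict G).map (restrictedPath π P σ n u) {z} =
          μ (G ∩ {ω | restrictedPath π P σ n u ω = z}) := fun u z => by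
      rw [Measure.map_apply (hr n u) MeasurableSet.of_discrete,
        Measure.restrict_apply (hr n u MeasurableSet.of_discrete), Set.inter_comm]
      rfl
    change (μ.restrict G).map (restrictedPath π P σ n (s + t)) {y} =
      ((μ.restrict G).map (restrictedPath π P σ n s)).bind _ {y}
    rw [hrestrict, Measure.bind_apply MeasurableSet.of_discrete (Kernel.measurable _).aemeasurable,
      lintegral_fintype]
    simp only [hrestrict]
    rw [← ENNReal.toReal_eq_toReal_iff' (measure_ne_top _ _) (ENNReal.sum_ne_top.2 fun z _ =>
      ENNReal.mul_ne_top (measure_ne_top _ _) (measure_ne_top _ _)), ENNReal.toReal_sum fun z _ =>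
      ENNReal.mul_ne_top (measure_ne_top _ _) (measure_ne_top _ _)]
    refine h.trans (Finset.sum_congr rfl fun z _ => ?_)
    rw [ENNReal.toReal_mul, mul_comm]
    rfl
  have : IsFiniteMeasure ((μ.restrict G).map (constructedProcess π P σ (s + t))) :=
    inferInstance
  have hcyl : ∀ n (A : Set (KPartition k (Fin n))),
      (μ.restrict G).map (constructedProcess π P σ (s + t)) (restrict n ⁻¹' A) =
      ((μ.restrict G).map (constructedProcess π P σ s)).bind
        (poissonSemigroup (stepKernelNat ν) (lam * t)) (restrict n ⁻¹' A) := fun n A => by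
    have := congrArg (fun m : Measure (KPartition k (Fin n)) => m A) (hmap n)
    simpa only [Measure.map_apply (measurable_restrict n) MeasurableSet.of_discrete] using this
  refine ext_of_generate_finite _ generateFrom_cylinders isPiSystem_cylinders ?_ ?_
  · rintro _ ⟨n, A, rfl⟩
    exact hcyl n A
  · simpa using hcyl 0 Set.univ

/-- Every process which follows the construction agrees with the constructed one. -/
theorem IsPoissonianProcess.ae_eq_constructedProcess (hin : IsPoissonianInput μ lam ν π P σ)
    {B : ℝ≥0 → Ω → KPartition k ℕ} (hB : IsPoissonianProcess μ π P σ B) :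
    ∀ᵐ ω ∂μ, ∀ t, B t ω = constructedProcess π (simplify P) σ t ω := by
  filter_upwards [hB.follows, ae_simplify_eq hin.poisson] with ω hω hP t
  refine restrict_ext fun n => ?_
  have h := followsConstruction_constructedPath (π ω) (fun m => σ m ω)
    (isSimpleConfiguration_simplify P ω) n
  rw [hP] at h
  have := congrFun ((hω n).unique h) t
  rw [constructedProcess, hP]
  exact this

theorem IsPoissonianProcess.map_eq (hin : IsPoissonianInput μ lam ν π P σ)
    {B : ℝ≥0 → Ω → KPartition k ℕ} (hB : IsPoissonianProcess μ π P σ B) (s t : ℝ≥0) {G : Set Ω}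
    (hG : MeasurableSet[naturalSigma B s] G) :
    (μ.restrict G).map (B (s + t)) =
      ((μ.restrict G).map (B s)).bind (poissonSemigroup (stepKernelNat ν) (lam * t)) := by
  have hae := hB.ae_eq_constructedProcess hin
  -- A past event of B need not be a past event of the constructed process, but it is a set E of
  -- paths pulled back by B. Pulling E back by the constructed process changes it by a null set
  -- only, as the two processes agree at all times at once.
  obtain ⟨E, hE, rfl⟩ := exists_preimage_of_naturalSigma hG
  set X := constructedProcess π (simplify P) σ with hX
  have hG' : MeasurableSet[naturalSigma X s] ((fun ω (u : Set.Iic s) => X u ω) ⁻¹' E) := by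
    refine (@measurable_pi_lambda _ _ _ (naturalSigma X s) _ _ fun u => ?_) hE
    rw [measurable_iff_comap_le]
    exact le_iSup (fun u : Set.Iic s => MeasurableSpace.comap (X u) inferInstance) u
  have hs := isSimpleConfiguration_simplify P
  have hGG : μ.restrict ((fun ω (u : Set.Iic s) => B u ω) ⁻¹' E) =
      μ.restrict ((fun ω (u : Set.Iic s) => X u ω) ⁻¹' E) := by
    refine Measure.restrict_congr_set ?_
    filter_upwards [hae] with ω hω
    have : (fun u : Set.Iic s => B u ω) = fun u : Set.Iic s => X u ω := funext fun u => hω u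
    exact congrArg (fun x => E x) this
  have hBX : ∀ u (m : Set Ω), (μ.restrict m).map (B u) = (μ.restrict m).map (X u) := fun u m =>
    Measure.map_congr (ae_restrict_of_ae (hae.mono fun ω hω => hω u))
  rw [hGG, hBX, hBX]
  exact map_constructedProcess (isPoissonianInput_simplify hin) hs s t
    (naturalSigma_constructedProcess_le hs s _ hG')

theorem exists_isPoissonianProcess (hin : IsPoissonianInput μ lam ν π P σ) :
    ∃ B : ℝ≥0 → Ω → KPartition k ℕ, IsPoissonianProcess μ π P σ B := by
  have hs := isSimpleConfiguration_simplify P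
  refine ⟨constructedProcess π (simplify P) σ,
    measurable_constructedProcess (isPoissonianInput_simplify hin) hs, ?_⟩
  filter_upwards [ae_simplify_eq hin.poisson] with ω hω n
  have h := followsConstruction_constructedPath (π ω) (fun m => σ m ω) (hs ω) n
  rw [hω] at h
  simp only [constructedProcess, hω]
  exact h

end Constructed

/-! ### The rate kernel and conclusion -/

section Rates

variable {k n : ℕ} (lam : ℝ≥0) (ν : Measure (RankedSimplex k)) [IsProbabilityMeasure ν]

theorem rateMatrix_eq (x y : KPartition k (Fin n)) :
    rateMatrix ν lam n x y =
      lam * ((stepKernel ν n x).real {y} - ({y} : Set (KPartition k (Fin n))).indicator 1 x) := by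
  rw [rateMatrix, stepKernel_real_singleton]
  by_cases h : x = y
  · subst h
    simp
  · simp [h]

theorem finsum_rateMatrix (x : KPartition k (Fin n)) (A : Set (KPartition k (Fin n))) :
    ∑ᶠ y ∈ A, rateMatrix ν lam n x y =
      lam * ((stepKernel ν n x).real A - A.indicator 1 x) := by
  classical
  rw [finsum_mem_eq_finite_toFinset_sum _ A.toFinite]
  simp only [rateMatrix_eq]
  rw [← Finset.mul_sum, Finset.sum_sub_distrib, sum_measureReal_singleton]
  congr 2
  · simp
  · simp [Set.indicator_apply, Finset.sum_ite_eq]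

/-- The rate kernel on the partitions of `ℕ`. -/
noncomputable def rateKernel (x : KPartition k ℕ) : SignedMeasure (KPartition k ℕ) :=
  (lam : ℝ) • ((stepKernelNat ν x).toSignedMeasure - (Measure.dirac x).toSignedMeasure)

theorem rateKernel_apply (x : KPartition k ℕ) {A : Set (KPartition k ℕ)} (hA : MeasurableSet A) :
    rateKernel lam ν x A = lam * ((stepKernelNat ν x).real A - A.indicator 1 x) := by
  rw [rateKernel, _root_.smul_apply, _root_.sub_apply,
    Measure.toSignedMeasure_apply_measurable hA, Measure.toSignedMeasure_apply_measurable hA,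
    smul_eq_mul]
  congr 2
  rw [measureReal_def, Measure.dirac_apply' _ hA]
  by_cases hx : x ∈ A <;> simp [hx]

theorem isRateKernel_rateKernel : IsRateKernel ν lam (rateKernel lam ν) := by
  intro n x y
  have hA : {z : KPartition k ℕ | z.restrict n = y} = restrict n ⁻¹' {y} := rfl
  rw [hA, rateKernel_apply _ _ _ (measurable_restrict n MeasurableSet.of_discrete), rateMatrix_eq,
    ← map_restrict_stepKernelNat, map_measureReal_apply (measurable_restrict n)
    MeasurableSet.of_discrete]
  rfl

end Rates

theorem proposition7 {Ω : Type*} [MeasurableSpace Ω] (μ : Measure Ω) [IsProbabilityMeasure μ]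
    (k : ℕ) (lam : ℝ≥0) (hlam : 0 < lam)
    (ν : Measure (RankedSimplex k)) [IsProbabilityMeasure ν]
    (π : Ω → KPartition k ℕ) (P : Ω → Set (ℝ≥0 × Mark k))
    (σ : ℕ → Ω → Fin k → Equiv.Perm (Fin k))
    (hinput : IsPoissonianInput μ lam ν π P σ) :
    (∃ B : ℝ≥0 → Ω → KPartition k ℕ, IsPoissonianProcess μ π P σ B) ∧
    ∃ Q : KPartition k ℕ → SignedMeasure (KPartition k ℕ),
      IsRateKernel ν lam Q ∧
      ∀ B : ℝ≥0 → Ω → KPartition k ℕ, IsPoissonianProcess μ π P σ B →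
        IsMarkovProcessWithRates μ B (fun x A => Q x A) ∧
        ∀ n : ℕ, IsMarkovProcessWithRates μ (fun t ω => (B t ω).restrict n)
          (fun x A => ∑ᶠ y ∈ A, rateMatrix ν lam n x y) := by
  refine ⟨exists_isPoissonianProcess hinput, rateKernel lam ν, isRateKernel_rateKernel lam ν,
    fun B hB => ⟨?_, fun n => ?_⟩⟩
  · exact isMarkovProcessWithRates_of_poissonSemigroup hB.measurable (stepKernelNat ν) lam
      (fun s t G hG => hB.map_eq hinput s t hG) fun x A hA => rateKernel_apply lam ν x hA
  · have hr := measurable_restrict (k := k) n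
    refine isMarkovProcessWithRates_of_poissonSemigroup (fun t => hr.comp (hB.measurable t))
      (stepKernel ν n) lam (fun s t G hG => ?_) fun x A _ => finsum_rateMatrix lam ν x A
    -- The restriction has a smaller past than B, and its transition function is a projection of
    -- that of B; pushing the identity for B forward therefore gives the Markov property with
    -- respect to the restriction's own filtration.
    have hle : naturalSigma (fun t ω => (B t ω).restrict n) s ≤ naturalSigma B s := by
      refine iSup_mono fun u => ?_
      change MeasurableSpace.comap (restrict n ∘ B u) inferInstance ≤ _
      rw [← MeasurableSpace.comap_comp]
      exact MeasurableSpace.comap_mono (measurable_iff_comap_le.1 hr)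
    have h := congrArg (Measure.map (restrict n)) (hB.map_eq hinput s t (hle _ hG))
    rwa [map_bind_kernel hr (map_poissonSemigroup (lam * t) hr fun x =>
      map_restrict_stepKernelNat ν x), Measure.map_map hr (hB.measurable _),
      Measure.map_map hr (hB.measurable _)] at h
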